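/- **Setting.** Let $\Psi:\mathbb R\to[0,1]$ be differentiable with $\Psi'\le 0$ Riemann integrable, $\Psi\in L^1(0,\infty)$ and $1-\Psi\in L^1(-\infty,0)$, and put $\Phi=-\Psi'$. Let $\alpha\in(0,1)$ and $\tau,\nu,\beta,\epsilon>0$. For $N>0$ let $\Gamma=\Gamma_N>0$, let $\eta=\eta_N:\mathbb Z\to\mathbb R$ be non-decreasing, and let $\xi_k=\xi_{N,k}\in(0,1)$ be such that $\frac1{\tau N^\alpha}\Phi\big(\frac{k+\xi_k}{\tau N^\alpha}\big)=\Psi\big(\frac{k}{\tau N^\alpha}\big)-\Psi\big(\frac{k+1}{\tau N^\alpha}\big)$ for all $k\in\mathbb Z$ (mean value theorem). Define the kernel $$L^N_{\Psi,\eta}(x,y)=\frac1{\tau N^\alpha}\sum_{k\in\mathbb Z,\ |k|\le\Gamma N^\alpha}\Phi\Big(\frac{k+\xi_k}{\tau N^\alpha}\Big)\frac{\sin[2\pi\eta(k)(x-y)]}{\pi(x-y)},$$ where the quotient is read as $2\eta(k)$ for $x=y$. Assume that, as $N\to\infty$, $\Gamma_N/N^\nu\to0$, $$\eta_N(k)=N^\nu+\beta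 kN^{-\alpha}+O(N^{-\epsilon})\quad\text{uniformly in }|k|\le\Gamma_N N^\alpha,$$ $$N^\nu\max\Big\{\Psi\Big(\frac{\Gamma_N}{\tau}\Big),\ 1-\Psi\Big(-\frac{\lfloor\Gamma_NN^\alpha\rfloor}{\tau N^\alpha}\Big)\Big\}\longrightarrow0 .$$ Let $f\in H^1_0(\mathbb R)$, i.e. $f$ is a real, continuous, compactly supported function with $\int|\hat f(u)|^2|u|^2du<\infty$, where $\hat f(u)=\int f(x)e^{-2\pi ixu}dx$. **Notation.** A composition of $n$ is a tuple ${\bf m}=(m_1,\dots,m_\ell)$ of positive integers with $|{\bf m}|=m_1+\dots+m_\ell=n$; its length is $\ell=\ell({\bf m})$. Put $\binom n{\bf m}=\frac{n!}{m_1!\cdots m_\ell!}$, $\mathrm M({\bf m})=\frac{(-1)^{\ell+1}}{\ell}\binom n{\bf m}$, $\overline m_i=m_1+\dots+m_i$ and $\Lambda^{\bf m}_{is}(u)=\sum_{j\le\overline m_i}u_j-\sum_{j\le\overline m_s}u_j$. For a permutation $\sigma\in\mathbb S(n)$ let $\underline s\le\ell$ be the index with $\sigma(\underline s)=\min_{j\le\ell}\sigma(j)$,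 and for $t>0$ put $$\mathrm G^{\bf m}_{t}(u,x)=\sum_{\sigma\in\mathbb S(n)}\max_{i\le\ell}\big\{\Lambda^{\bf m}_{i\underline s}(u)-t\,(x_{\sigma(i)}-x_{\sigma(\underline s)})\big\}.$$ Further, for $n\ge2$, $$\mathrm B^n_\Psi=\sum_{k=0}^{n-1}b^n_k\int_{\mathbb R}x\Phi(x)\Psi(x)^k(1-\Psi(x))^{n-1-k}dx,\qquad b^n_k=\sum_{l=1}^{k+1}(-1)^{l+1}\binom{n-l}{k+1-l}\sum_{|{\bf m}|=n,\ \ell({\bf m})=l}\binom n{\bf m}.$$ Let $\mathbb R^n_<=\{x\in\mathbb R^n: x_1<\dots<x_n\}$ and $\mathbb R^n_0=\{u\in\mathbb R^n: u_1+\dots+u_n=0\}$, the latter with Lebesgue measure $d^{n-1}u=du_1\cdots du_{n-1}$. For a kernel $K$ let $$C^n_K[\Xi f]=\sum_{|{\bf m}|=n}\mathrm M({\bf m})\int_{\mathbb R^\ell}\prod_{i=1}^{\ell}f(x_i)^{m_i}K(x_i,x_{i+1})\,dx\qquad(x_{\ell+1}=x_1).$$ **Theorem.** For every $n\ge2$ the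 integrals below (and those in $\mathrm B^n_\Psi$) converge absolutely, and $$\lim_{N\to\infty}C^n_{L^N_{\Psi,\eta}}[\Xi f]=2\beta\tau\,\mathrm B^n_\Psi\int_{\mathbb R}f(t)^n\,dt-2\iint_{\mathbb R^n_0\times\mathbb R^n_<}\Re\Big\{\prod_{i=1}^n\hat f(u_i)\Phi(x_i)\Big\}\sum_{|{\bf m}|=n}\mathrm M({\bf m})\,\mathrm G^{\bf m}_{\beta\tau}(u,x)\,d^{n-1}u\,d^nx .$$ Moreover, if for all large $N$ a determinantal point process $(X_i)$ on $\mathbb R$ with correlation kernel $L^N_{\Psi,\eta}$ (with respect to Lebesgue measure) is given, then for all large $N$ the linear statistic $\Xi f=\sum_if(X_i)$ has finite exponential moments of all orders, and its $n$-th cumulant, i.e. the coefficient of $t^n/n!$ in the expansion of $\log\mathbb E[e^{t\,\Xi f}]$ at $t=0$, converges to the same limit. -/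

import Mathlib

open MeasureTheory ProbabilityTheory Filter Topology
open scoped FourierTransform Nat

/-- The class of shapes: differentiable, non-increasing functions `Ψ : ℝ → [0,1]` whose derivative
is Riemann integrable, with `Ψ ∈ L¹(0,∞)` and `1 - Ψ ∈ L¹(-∞,0)`.  (Since `Ψ' ≤ 0` and `Ψ` is
bounded, the improper integral of `Ψ'` over `ℝ` converges as soon as `Ψ'` is Riemann integrable
on bounded intervals.) -/
structure IsShape (Ψ : ℝ → ℝ) : Prop where
  mem_Icc : ∀ t, Ψ t ∈ Set.Icc (0 : ℝ) 1
  differentiable : Differentiable ℝ Ψ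
  deriv_nonpos : ∀ t, deriv Ψ t ≤ 0
  riemann : ∀ I : BoxIntegral.Box (Fin 1),
    BoxIntegral.Integrable I BoxIntegral.IntegrationParams.Riemann
      (fun x : Fin 1 → ℝ => deriv Ψ (x 0)) BoxIntegral.BoxAdditiveMap.volume
  integrable_pos : IntegrableOn Ψ (Set.Ioi 0)
  integrable_neg : IntegrableOn (fun t => 1 - Ψ t) (Set.Iio 0)

/-- The density `Φ = -Ψ'` of a shape. -/
noncomputable def shapeDensity (Ψ : ℝ → ℝ) (t : ℝ) : ℝ := -deriv Ψ t

/-- The numbers `ξ_k ∈ (0,1)` given by the mean value theorem: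
`(τ N^α)⁻¹ Φ((k + ξ_k)/(τ N^α)) = Ψ(k/(τ N^α)) - Ψ((k+1)/(τ N^α))`. -/
def IsMeanValueChoice (Ψ : ℝ → ℝ) (α τ N : ℝ) (ξ : ℤ → ℝ) : Prop :=
  ∀ k : ℤ, ξ k ∈ Set.Ioo (0 : ℝ) 1 ∧
    1 / (τ * N ^ α) * shapeDensity Ψ ((k + ξ k) / (τ * N ^ α)) =
      Ψ (k / (τ * N ^ α)) - Ψ ((k + 1) / (τ * N ^ α))

/-- The kernel `sin(2π a t) / (π t)`, with its continuous value `2 a` at `t = 0`. -/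
noncomputable def sineKernel (a t : ℝ) : ℝ := 2 * a * Real.sinc (2 * Real.pi * a * t)

theorem sineKernel_zero (a : ℝ) : sineKernel a 0 = 2 * a := by
  simp [sineKernel]

theorem sineKernel_of_ne_zero (a : ℝ) {t : ℝ} (ht : t ≠ 0) :
    sineKernel a t = Real.sin (2 * Real.pi * a * t) / (Real.pi * t) := by
  rcases eq_or_ne a 0 with rfl | ha
  · simp [sineKernel]
  · have hp := Real.pi_ne_zero
    rw [sineKernel, Real.sinc_of_ne_zero (by positivity)]
    field_simp

/-- The kernel `L^N_{Ψ,η}(x,y) = (τ N^α)⁻¹ ∑_{|k| ≤ Γ N^α} Φ((k+ξ_k)/(τ N^α)) ·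
sin(2π η(k)(x-y)) / (π(x-y))`, the sum being over integers `k`. -/
noncomputable def kernelL (Ψ : ℝ → ℝ) (α τ Γ : ℝ) (η ξ : ℤ → ℝ) (N x y : ℝ) : ℝ :=
  1 / (τ * N ^ α) * ∑ k ∈ Finset.Icc (-⌊Γ * N ^ α⌋) ⌊Γ * N ^ α⌋,
    shapeDensity Ψ ((k + ξ k) / (τ * N ^ α)) * sineKernel (η k) (x - y)

/-- The growth conditions on the cut-off `Γ = Γ_N > 0` and on the non-decreasing functions
`η = η_N`: `Γ_N = o(N^ν)`, the expansion `η_N(k) = N^ν + β k N^{-α} + O(N^{-ε})` uniformly in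
`|k| ≤ Γ_N N^α`, and the mass of `Φ` (at temperature `τ`) that the cut-off neglects is
`o(N^{-ν})`; the smallest index retained by the cut-off is `-⌊Γ_N N^α⌋`. -/
structure GrowthConditions (Ψ : ℝ → ℝ) (α τ ν β ε : ℝ) (Γ : ℝ → ℝ) (η : ℝ → ℤ → ℝ) : Prop where
  cutoff_pos : ∀ N, 0 < N → 0 < Γ N
  monotone : ∀ N, 0 < N → Monotone (η N)
  cutoff_small : Tendsto (fun N : ℝ => Γ N / N ^ ν) atTop (𝓝 0)
  expansion : ∃ C N₀ : ℝ, ∀ N ≥ N₀, ∀ k : ℤ, |(k : ℝ)| ≤ Γ N * N ^ α →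
    |η N k - (N ^ ν + β * k * N ^ (-α))| ≤ C * N ^ (-ε)
  tails : Tendsto (fun N : ℝ => N ^ ν *
    max (Ψ (Γ N / τ)) (1 - Ψ (-(⌊Γ N * N ^ α⌋ : ℝ) / (τ * N ^ α)))) atTop (𝓝 0)

/-- `f ∈ H¹_0(ℝ)`: the (continuous representative of a) compactly supported real-valued function
with `∫ |f̂(u)|² |u|² du < ∞`. -/
structure IsH1Compact (f : ℝ → ℝ) : Prop where
  continuous : Continuous f
  compact : HasCompactSupport f
  sobolev : Integrable (fun u : ℝ => ‖𝓕 (fun x : ℝ => (f x : ℂ)) u‖ ^ 2 * |u| ^ 2)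

/-- `M(m) = ((-1)^(ℓ+1)/ℓ) · n!/(m_1! ⋯ m_ℓ!)` for a composition `m` of `n` of length `ℓ`. -/
noncomputable def compWeight {n : ℕ} (c : Composition n) : ℝ :=
  (-1) ^ (c.length + 1) / c.length * (n ! / ∏ i, (c.blocksFun i)! : ℝ)

/-- `Tr[f^{m_1} K f^{m_2} ⋯ f^{m_ℓ} K] = ∫ ∏_i f(x_i)^{m_i} K(x_i, x_{i+1}) dx`, with
`x_{ℓ+1} = x_1`. -/
noncomputable def compTrace (K : ℝ → ℝ → ℝ) (f : ℝ → ℝ) {n : ℕ} (c : Composition n) : ℝ :=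
  ∫ x : Fin c.length → ℝ,
    ∏ i, f (x i) ^ c.blocksFun i * K (x i) (x (finRotate c.length i))

/-- The `n`-th cumulant `C^n_K[Ξf]` of a linear statistic in terms of the kernel `K`. -/
noncomputable def kernelCumulant (K : ℝ → ℝ → ℝ) (f : ℝ → ℝ) (n : ℕ) : ℝ :=
  ∑ c : Composition n, compWeight c * compTrace K f c

/-- The random configuration `X : Ω → Set ℝ` (without accumulation points) is a determinantal
point process with correlation kernel `K` with respect to Lebesgue measure: its correlation
functions are `ρ_k(x_1, …, x_k) = det [K(x_i, x_j)]`, that is,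
`E ∏_{x ∈ X} (1 + g(x)) = ∑_{k ≥ 0} (1/k!) ∫ ∏_i g(x_i) det [K(x_i, x_j)] dx`
for all continuous compactly supported `g : ℝ → ℂ`. -/
structure IsDeterminantalProcess {Ω : Type*} [MeasurableSpace Ω] (P : Measure Ω)
    (X : Ω → Set ℝ) (K : ℝ → ℝ → ℝ) : Prop where
  locallyFinite : ∀ ω, ∀ C : Set ℝ, IsCompact C → (X ω ∩ C).Finite
  measurable_count : ∀ B : Set ℝ, MeasurableSet B → Bornology.IsBounded B →
    Measurable fun ω => (X ω ∩ B).ncard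
  integrable : ∀ g : ℝ → ℂ, Continuous g → HasCompactSupport g →
    Integrable (fun ω => ∏ᶠ x ∈ X ω, (1 + g x)) P
  hasSum : ∀ g : ℝ → ℂ, Continuous g → HasCompactSupport g →
    HasSum (fun k : ℕ => (1 / (k ! : ℂ)) * ∫ x : Fin k → ℝ,
        (∏ i, g (x i)) * ((Matrix.of fun i j => K (x i) (x j)).det : ℂ))
      (∫ ω, ∏ᶠ x ∈ X ω, (1 + g x) ∂P)

/-- The linear statistic `Ξf = ∑_{x ∈ X} f(x)`. -/
noncomputable def linearStatistic {Ω : Type*} (X : Ω → Set ℝ) (f : ℝ → ℝ) (ω : Ω) : ℝ :=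
  ∑ᶠ x ∈ X ω, f x

/-- The `n`-th cumulant of a random variable: the coefficient of `t^n / n!` in the expansion of
`log E[exp(t Z)]` at `t = 0`. -/
noncomputable def cumulant {Ω : Type*} [MeasurableSpace Ω] (P : Measure Ω) (Z : Ω → ℝ)
    (n : ℕ) : ℝ :=
  iteratedDeriv n (cgf Z P) 0

/-- The coefficients `b^n_k = ∑_{l=1}^{k+1} (-1)^(l+1) (n-l choose k+1-l)
∑_{|m| = n, ℓ(m) = l} n!/(m_1! ⋯ m_l!)`. -/
noncomputable def coeffB (n k : ℕ) : ℝ :=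
  ∑ l ∈ Finset.Icc 1 (k + 1), (-1) ^ (l + 1) * ((n - l).choose (k + 1 - l) : ℝ) *
    ∑ c : Composition n with c.length = l, (n ! / ∏ i, (c.blocksFun i)! : ℝ)

/-- `B^n_Ψ = ∑_{k=0}^{n-1} b^n_k ∫ x Φ(x) Ψ(x)^k (1-Ψ(x))^(n-1-k) dx` (used for `n ≥ 2`). -/
noncomputable def shapeB (Ψ : ℝ → ℝ) (n : ℕ) : ℝ :=
  ∑ k ∈ Finset.range n, coeffB n k *
    ∫ x : ℝ, x * shapeDensity Ψ x * Ψ x ^ k * (1 - Ψ x) ^ (n - 1 - k)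

/-- `u_1 + ⋯ + u_{m_1 + ⋯ + m_i}`, where the `i`-th part is indexed from `0`. -/
def blockSum {n : ℕ} (c : Composition n) (u : Fin n → ℝ) (i : Fin c.length) : ℝ :=
  ∑ j : Fin n with j.val < c.sizeUpTo (i.val + 1), u j

/-- The antisymmetric matrix `Λ^m_{is}(u)`. -/
def blockLambda {n : ℕ} (c : Composition n) (u : Fin n → ℝ) (i s : Fin c.length) : ℝ :=
  blockSum c u i - blockSum c u s

/-- The index `s ≤ ℓ(m)` with `σ(s) = min {σ(j) : j ≤ ℓ(m)}`. -/
noncomputable def argMinIndex {n : ℕ} (hn : 0 < n) (c : Composition n)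
    (σ : Equiv.Perm (Fin n)) : Fin c.length :=
  haveI : Nonempty (Fin c.length) := ⟨⟨0, c.length_pos_of_pos hn⟩⟩
  Function.argmin fun i : Fin c.length => σ (Fin.castLE c.length_le i)

/-- `G^m_τ(u,x) = ∑_σ max_{i ≤ ℓ} {Λ^m_{is}(u) - τ (x_{σ(i)} - x_{σ(s)})}`, where `s` is the
index at which `σ` is minimal on `{1, …, ℓ(m)}`. -/
noncomputable def compG {n : ℕ} (hn : 0 < n) (τ : ℝ) (c : Composition n)
    (u x : Fin n → ℝ) : ℝ :=
  ∑ σ : Equiv.Perm (Fin n), ⨆ i : Fin c.length,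
    (blockLambda c u i (argMinIndex hn c σ) -
      τ * (x (σ (Fin.castLE c.length_le i)) -
        x (σ (Fin.castLE c.length_le (argMinIndex hn c σ)))))

/-- The parametrization `(u_1, …, u_{n-1}) ↦ (u_1, …, u_{n-1}, -(u_1 + ⋯ + u_{n-1}))` of the
hyperplane `ℝ^n_0 = {u : u_1 + ⋯ + u_n = 0}`; the measure `d^{n-1}u` is Lebesgue measure in these
coordinates. -/
def zeroSum {n : ℕ} (v : Fin (n - 1) → ℝ) (i : Fin n) : ℝ :=
  if h : i.val < n - 1 then v ⟨i.val, h⟩ else -∑ j, v j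

/-- The integrand
`Re {∏_i f̂(u_i) Φ(x_i)} ∑_{|m| = n} M(m) G^m_τ(u,x)` with `u` in the coordinates `zeroSum`. -/
noncomputable def limitIntegrand {n : ℕ} (hn : 0 < n) (Ψ f : ℝ → ℝ) (τ : ℝ)
    (p : (Fin (n - 1) → ℝ) × (Fin n → ℝ)) : ℝ :=
  (∏ i, 𝓕 (fun y : ℝ => (f y : ℂ)) (zeroSum p.1 i) * (shapeDensity Ψ (p.2 i) : ℂ)).re *
    ∑ c : Composition n, compWeight c * compG hn τ c (zeroSum p.1) p.2

/-- The integration domain `ℝ^n_0 × ℝ^n_<` in the coordinates `zeroSum`. -/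
def limitDomain (n : ℕ) : Set ((Fin (n - 1) → ℝ) × (Fin n → ℝ)) :=
  Set.univ ×ˢ {x | StrictMono x}

/-- `2 τ B^n_Ψ ∫ f^n - 2 ∬_{ℝ^n_0 × ℝ^n_<} Re {∏ f̂(u_i) Φ(x_i)} ∑_m M(m) G^m_τ(u,x)`. -/
noncomputable def limitCumulant {n : ℕ} (hn : 0 < n) (Ψ f : ℝ → ℝ) (τ : ℝ) : ℝ :=
  2 * τ * shapeB Ψ n * (∫ t : ℝ, f t ^ n) -
    2 * ∫ p in limitDomain n, limitIntegrand hn Ψ f τ p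

/-!
By Fourier inversion the trace `Tr[f^{m_1} K ⋯ f^{m_ℓ} K]` of the kernel `K = L^N_{Ψ,η}` is the
integral of `∏ f̂(u_j)` over the hyperplane `∑ u_j = 0`, weighted by the length of the intersection
of intervals `[L_i - η(k_i), L_i + η(k_i)]`. The offsets `L_i` are partial sums of the `u_j`, and
the indices `k_1, …, k_ℓ` are independent, with `k_i = ⌊τ N^α x_i⌋` for independent variables `x_i`
with survival function `Ψ`. As `η(k) ≈ N^ν + βτ x_i`, this length is `2 N^ν` plus a bounded
correction, a minimum of partial sums of the `u_j` and multiples of the `x_i`. The divergent term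
`2 N^ν ∫ f^n` is the same for all compositions, and cancels because `∑ M(m) = 0`. Averaging the
correction over the permutations of the `x_i` gives `G^m`, and the leftover minima of independent
variables give `B^n_Ψ`.

The moment generating function of the linear statistic is the Fredholm determinant
`det (1 + (e^{tf} - 1) K)`. Newton's identities for its coefficients (Plemelj's recursion) show that
its logarithm is `∑_l (-1)^{l+1} / l * Tr[((e^{tf} - 1) K)^l]`, and expanding `e^{tf} - 1` in powers
of `t` identifies the cumulants with the traces above.
-/

/-- The survival functions `Ψ t = μ(t, ∞)` of probability measures `μ` on the line with a finite
first moment, in the case where `Ψ` is differentiable. -/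
structure IsSurvivalFunction (Ψ : ℝ → ℝ) : Prop where
  mem_Icc : ∀ t, Ψ t ∈ Set.Icc (0 : ℝ) 1
  differentiable : Differentiable ℝ Ψ
  deriv_nonpos : ∀ t, deriv Ψ t ≤ 0
  integrable_pos : IntegrableOn Ψ (Set.Ioi 0)
  integrable_neg : IntegrableOn (fun t => 1 - Ψ t) (Set.Iio 0)

theorem IsShape.isSurvivalFunction {Ψ : ℝ → ℝ} (h : IsShape Ψ) : IsSurvivalFunction Ψ :=
  ⟨h.mem_Icc, h.differentiable, h.deriv_nonpos, h.integrable_pos, h.integrable_neg⟩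

theorem measurable_shapeDensity (Ψ : ℝ → ℝ) : Measurable (shapeDensity Ψ) :=
  (measurable_deriv Ψ).neg

theorem tendsto_zero_of_antitone_of_integrableOn_Ioi {g : ℝ → ℝ} {a : ℝ} (hg : Antitone g)
    (hnonneg : ∀ t, 0 ≤ g t) (hinteg : IntegrableOn g (Set.Ioi a)) : Tendsto g atTop (𝓝 0) := by
  have hlim := tendsto_atTop_ciInf hg ⟨0, Set.forall_mem_range.2 hnonneg⟩
  have hzero : ⨅ i, g i = 0 := by
    refine IntegrableAtFilter.eq_zero_of_tendsto ⟨_, Ioi_mem_atTop a, hinteg⟩ (fun s hs => ?_) hlim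
    obtain ⟨b, hb⟩ := mem_atTop_sets.1 hs
    exact measure_mono_top hb Real.volume_Ici
  rwa [hzero] at hlim

theorem integrableOn_comp_neg_iff {E : Type*} [NormedAddCommGroup E] {g : ℝ → E} {s : Set ℝ} :
    IntegrableOn (fun t => g (-t)) (-s) ↔ IntegrableOn g s :=
  (Measure.measurePreserving_neg (volume : Measure ℝ)).integrableOn_comp_preimage
    (MeasurableEquiv.neg ℝ).measurableEmbedding

namespace IsSurvivalFunction

variable {Ψ : ℝ → ℝ}

theorem antitone (h : IsSurvivalFunction Ψ) : Antitone Ψ :=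
  antitone_of_deriv_nonpos h.differentiable h.deriv_nonpos

theorem density_nonneg (h : IsSurvivalFunction Ψ) (t : ℝ) : 0 ≤ shapeDensity Ψ t :=
  neg_nonneg.2 (h.deriv_nonpos t)

theorem hasDerivAt (h : IsSurvivalFunction Ψ) (t : ℝ) :
    HasDerivAt Ψ (-shapeDensity Ψ t) t := by
  simpa [shapeDensity] using (h.differentiable t).hasDerivAt

theorem hasDerivAt_neg (h : IsSurvivalFunction Ψ) (t : ℝ) :
    HasDerivAt (-Ψ) (shapeDensity Ψ t) t := by
  simpa using (h.hasDerivAt t).neg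

theorem density_eq_zero_of_eq_zero (h : IsSurvivalFunction Ψ) {t : ℝ} (ht : Ψ t = 0) :
    shapeDensity Ψ t = 0 := by
  have hmin : IsLocalMin Ψ t := Eventually.of_forall fun s => ht.trans_le (h.mem_Icc s).1
  simp [shapeDensity, hmin.deriv_eq_zero]

theorem density_eq_zero_of_eq_one (h : IsSurvivalFunction Ψ) {t : ℝ} (ht : Ψ t = 1) :
    shapeDensity Ψ t = 0 := by
  have hmax : IsLocalMax Ψ t := Eventually.of_forall fun s => (h.mem_Icc s).2.trans_eq ht.symm
  simp [shapeDensity, hmax.deriv_eq_zero]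

theorem tendsto_atTop (h : IsSurvivalFunction Ψ) : Tendsto Ψ atTop (𝓝 0) :=
  tendsto_zero_of_antitone_of_integrableOn_Ioi h.antitone (fun t => (h.mem_Icc t).1)
    h.integrable_pos

theorem integrableOn_Ioi_one_sub_comp_neg (h : IsSurvivalFunction Ψ) :
    IntegrableOn (fun t => 1 - Ψ (-t)) (Set.Ioi 0) := by
  simpa using integrableOn_comp_neg_iff.2 h.integrable_neg

theorem tendsto_atBot (h : IsSurvivalFunction Ψ) : Tendsto Ψ atBot (𝓝 1) := by
  have hreflected : Tendsto (fun t => 1 - Ψ (-t)) atTop (𝓝 0) :=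
    tendsto_zero_of_antitone_of_integrableOn_Ioi
      (fun a b hab => sub_le_sub_left (h.antitone (neg_le_neg hab)) 1)
      (fun t => sub_nonneg.2 (h.mem_Icc (-t)).2) h.integrableOn_Ioi_one_sub_comp_neg
  simpa using (hreflected.comp tendsto_neg_atBot_atTop).const_sub 1

theorem integrable_density (h : IsSurvivalFunction Ψ) : Integrable (shapeDensity Ψ) := by
  have hpos : IntegrableOn (shapeDensity Ψ) (Set.Ioi 0) :=
    integrableOn_Ioi_deriv_of_nonneg' (fun t _ => h.hasDerivAt_neg t)
      (fun t _ => h.density_nonneg t) h.tendsto_atTop.neg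
  have hneg : IntegrableOn (fun t => shapeDensity Ψ (-t)) (Set.Ioi 0) := by
    refine integrableOn_Ioi_deriv_of_nonneg' (g := Ψ ∘ Neg.neg) (l := 1) (fun t _ => ?_)
      (fun t _ => h.density_nonneg _) (h.tendsto_atBot.comp tendsto_neg_atTop_atBot)
    simpa using (h.hasDerivAt (-t)).scomp t (_root_.hasDerivAt_neg t)
  have hIio : IntegrableOn (shapeDensity Ψ) (Set.Iio 0) :=
    integrableOn_comp_neg_iff.1 (by simpa using hneg)
  rw [← integrableOn_univ, ← Set.Iic_union_Ioi (a := (0 : ℝ))]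
  exact ((integrableOn_Iic_iff_integrableOn_Iio (by simp)).2 hIio).union hpos

theorem integral_Ioi_density (h : IsSurvivalFunction Ψ) (t : ℝ) :
    ∫ x in Set.Ioi t, shapeDensity Ψ x = Ψ t := by
  rw [integral_Ioi_of_hasDerivAt_of_tendsto' (fun x _ => h.hasDerivAt_neg x)
    h.integrable_density.integrableOn h.tendsto_atTop.neg]
  simp

theorem integral_density (h : IsSurvivalFunction Ψ) : ∫ x, shapeDensity Ψ x = 1 := by
  rw [integral_of_hasDerivAt_of_tendsto (fun x => h.hasDerivAt_neg x) h.integrable_density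
    h.tendsto_atBot.neg h.tendsto_atTop.neg]
  simp

end IsSurvivalFunction

/-- The measure with density `Φ = -Ψ'`, the law of a random variable with survival function `Ψ`. -/
noncomputable def shapeMeasure (Ψ : ℝ → ℝ) : Measure ℝ :=
  volume.withDensity fun t => ENNReal.ofReal (shapeDensity Ψ t)

instance nullSingletonClass_shapeMeasure (Ψ : ℝ → ℝ) : NullSingletonClass (shapeMeasure Ψ) :=
  ⟨fun x => (withDensity_absolutelyContinuous volume _) (measure_singleton x)⟩

theorem ae_shapeDensity_pos (Ψ : ℝ → ℝ) : ∀ᵐ x ∂shapeMeasure Ψ, 0 < shapeDensity Ψ x := by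
  rw [shapeMeasure, ae_withDensity_iff (measurable_shapeDensity Ψ).ennreal_ofReal]
  exact Eventually.of_forall fun x hx => by simpa using hx

theorem integrable_max_zero_of_integrableOn_tail {α : Type*} [MeasurableSpace α] {μ : Measure α}
    {X : α → ℝ} {G : ℝ → ℝ} (hX : AEMeasurable X μ) (hG : IntegrableOn G (Set.Ioi 0))
    (htail : ∀ t, 0 < t → μ {a | t < X a} = ENNReal.ofReal (G t)) :
    Integrable (fun a => max (X a) 0) μ := by
  have hmeas : AEMeasurable (fun a => max (X a) 0) μ := hX.max aemeasurable_const
  have hnonneg : 0 ≤ᵐ[μ] fun a => max (X a) 0 := Eventually.of_forall fun a => le_max_right _ _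
  refine ⟨hmeas.aestronglyMeasurable, ?_⟩
  rw [hasFiniteIntegral_iff_ofReal hnonneg, lintegral_eq_lintegral_meas_lt μ hnonneg hmeas]
  refine (setLIntegral_mono' measurableSet_Ioi fun t (ht : 0 < t) => ?_).trans_lt
    (hG.hasFiniteIntegral)
  simp only [lt_max_iff, ht.not_gt, or_false]
  exact (htail t ht).trans_le (Real.ofReal_le_enorm (G t))

namespace IsSurvivalFunction

variable {Ψ : ℝ → ℝ}

theorem isProbabilityMeasure (h : IsSurvivalFunction Ψ) :
    IsProbabilityMeasure (shapeMeasure Ψ) := by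
  constructor
  rw [shapeMeasure, withDensity_apply _ MeasurableSet.univ, Measure.restrict_univ,
    ← ofReal_integral_eq_lintegral_ofReal h.integrable_density
      (Eventually.of_forall h.density_nonneg), h.integral_density, ENNReal.ofReal_one]

theorem integrable_shapeMeasure_iff (h : IsSurvivalFunction Ψ) {E : Type*}
    [NormedAddCommGroup E] [NormedSpace ℝ E] (g : ℝ → E) :
    Integrable g (shapeMeasure Ψ) ↔ Integrable (fun x => shapeDensity Ψ x • g x) := by
  rw [shapeMeasure, integrable_withDensity_iff_integrable_smul'
    (measurable_shapeDensity Ψ).ennreal_ofReal (by simp)]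
  simp [ENNReal.toReal_ofReal (h.density_nonneg _)]

theorem measure_Ioi (h : IsSurvivalFunction Ψ) (t : ℝ) :
    shapeMeasure Ψ (Set.Ioi t) = ENNReal.ofReal (Ψ t) := by
  rw [shapeMeasure, withDensity_apply _ measurableSet_Ioi, ← h.integral_Ioi_density t,
    ofReal_integral_eq_lintegral_ofReal h.integrable_density.integrableOn
      (Eventually.of_forall h.density_nonneg)]

theorem measureReal_Ioi (h : IsSurvivalFunction Ψ) (t : ℝ) :
    (shapeMeasure Ψ).real (Set.Ioi t) = Ψ t := by
  rw [measureReal_def, h.measure_Ioi, ENNReal.toReal_ofReal (h.mem_Icc t).1]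

theorem measure_Iio (h : IsSurvivalFunction Ψ) (t : ℝ) :
    shapeMeasure Ψ (Set.Iio t) = ENNReal.ofReal (1 - Ψ t) := by
  have := h.isProbabilityMeasure
  rw [measure_congr (Iio_ae_eq_Iic (μ := shapeMeasure Ψ) (a := t)), ← Set.compl_Ioi,
    prob_compl_eq_one_sub measurableSet_Ioi, h.measure_Ioi,
    ENNReal.ofReal_sub _ (h.mem_Icc t).1, ENNReal.ofReal_one]

theorem integrable_id (h : IsSurvivalFunction Ψ) :
    Integrable (fun x : ℝ => x) (shapeMeasure Ψ) := by
  have hpos : Integrable (fun x : ℝ => max x 0) (shapeMeasure Ψ) :=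
    integrable_max_zero_of_integrableOn_tail aemeasurable_id h.integrable_pos
      fun t _ => h.measure_Ioi t
  have hneg : Integrable (fun x : ℝ => max (-x) 0) (shapeMeasure Ψ) := by
    refine integrable_max_zero_of_integrableOn_tail aemeasurable_id.neg
      h.integrableOn_Ioi_one_sub_comp_neg fun t _ => ?_
    simpa only [Set.Iio, lt_neg] using h.measure_Iio (-t)
  exact (hpos.sub hneg).congr (Eventually.of_forall fun x => by simp)

theorem integrable_moment (h : IsSurvivalFunction Ψ) (k m : ℕ) :
    Integrable fun x : ℝ => x * shapeDensity Ψ x * Ψ x ^ k * (1 - Ψ x) ^ m := by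
  have hbdd : ∀ x, ‖Ψ x ^ k * (1 - Ψ x) ^ m‖ ≤ 1 := fun x => by
    obtain ⟨hnonneg, hle⟩ := h.mem_Icc x
    rw [norm_mul, norm_pow, norm_pow, Real.norm_of_nonneg hnonneg,
      Real.norm_of_nonneg (sub_nonneg.2 hle)]
    exact mul_le_one₀ (pow_le_one₀ hnonneg hle) (pow_nonneg (sub_nonneg.2 hle) _)
      (pow_le_one₀ (sub_nonneg.2 hle) (sub_le_self 1 hnonneg))
  have hcont := h.differentiable.continuous
  refine (((h.integrable_shapeMeasure_iff _).1 h.integrable_id).bdd_mul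
    (by fun_prop) (Eventually.of_forall hbdd)).congr (Eventually.of_forall fun x => ?_)
  simp only [smul_eq_mul]
  ring

end IsSurvivalFunction

theorem indicator_pi_prod {ι α M : Type*} [Fintype ι] [CommMonoidWithZero M] (s : ι → Set α)
    (g : ι → α → M) (x : ι → α) :
    (Set.univ.pi s).indicator (fun x => ∏ i, g i (x i)) x = ∏ i, (s i).indicator (g i) (x i) := by
  by_cases hx : x ∈ Set.univ.pi s
  · rw [Set.indicator_of_mem hx]
    exact Finset.prod_congr rfl fun i _ => (Set.indicator_of_mem (hx i trivial) _).symm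
  · rw [Set.indicator_of_notMem hx]
    obtain ⟨i, hi⟩ : ∃ i, x i ∉ s i := by simpa using hx
    exact (Finset.prod_eq_zero (Finset.mem_univ i) (Set.indicator_of_notMem hi _)).symm

theorem pi_withDensity_ofReal {ι : Type*} [Fintype ι] {g : ℝ → ℝ}
    (hnonneg : ∀ x, 0 ≤ g x) (hinteg : Integrable g) :
    Measure.pi (fun _ : ι => volume.withDensity fun x => ENNReal.ofReal (g x)) =
      volume.withDensity fun x : ι → ℝ => ENNReal.ofReal (∏ i, g (x i)) := by
  refine Measure.pi_eq fun s hs => ?_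
  have hprod : Integrable fun x : ι → ℝ => ∏ i, g (x i) :=
    Integrable.fintype_prod (f := fun _ => g) fun _ => hinteg
  have hm := MeasurableSet.univ_pi hs
  rw [withDensity_apply _ hm, ← ofReal_integral_eq_lintegral_ofReal hprod.integrableOn
    (Eventually.of_forall fun x => Finset.prod_nonneg fun i _ => hnonneg _),
    ← integral_indicator hm]
  simp_rw [indicator_pi_prod s fun _ => g]
  rw [integral_fintype_prod_volume_eq_prod (fun i => (s i).indicator g),
    ENNReal.ofReal_prod_of_nonneg fun i _ =>
      integral_nonneg fun x => Set.indicator_nonneg (fun x _ => hnonneg x) x]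
  refine Finset.prod_congr rfl fun i _ => ?_
  rw [integral_indicator (hs i), withDensity_apply _ (hs i),
    ofReal_integral_eq_lintegral_ofReal hinteg.integrableOn (Eventually.of_forall hnonneg)]

theorem IsSurvivalFunction.pi_shapeMeasure {Ψ : ℝ → ℝ} (h : IsSurvivalFunction Ψ) (ι : Type*)
    [Fintype ι] : Measure.pi (fun _ : ι => shapeMeasure Ψ) =
      volume.withDensity fun x : ι → ℝ => ENNReal.ofReal (∏ i, shapeDensity Ψ (x i)) :=
  pi_withDensity_ofReal h.density_nonneg h.integrable_density

/-- The character `x ↦ exp (2 π i x)` of the additive group `ℝ`, with values in `ℂ` rather than in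
the circle group. -/
noncomputable def planeWave (x : ℝ) : ℂ := (Real.fourierChar x : ℂ)

theorem planeWave_add (x y : ℝ) : planeWave (x + y) = planeWave x * planeWave y := by
  simp [planeWave, AddChar.map_add_eq_mul]

theorem planeWave_zero : planeWave 0 = 1 := by simp [planeWave]

theorem planeWave_sum {ι : Type*} (s : Finset ι) (g : ι → ℝ) :
    planeWave (∑ i ∈ s, g i) = ∏ i ∈ s, planeWave (g i) := by
  induction s using Finset.cons_induction with
  | empty => simp [planeWave_zero]
  | cons a s ha ih => rw [Finset.sum_cons, Finset.prod_cons, planeWave_add, ih]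

theorem norm_planeWave (x : ℝ) : ‖planeWave x‖ = 1 := Circle.norm_coe _

theorem planeWave_eq_exp (x : ℝ) : planeWave x = Complex.exp (↑(2 * Real.pi * x) * Complex.I) :=
  Real.fourierChar_apply x

@[fun_prop]
theorem continuous_planeWave : Continuous planeWave := by
  rw [funext planeWave_eq_exp]
  fun_prop

theorem star_planeWave (x : ℝ) : (starRingEnd ℂ) (planeWave x) = planeWave (-x) := by
  simp [planeWave, AddChar.map_neg_eq_inv]

/-- The Fourier transform `f̂(u) = ∫ f(x) exp (-2 π i x u) dx` of a real-valued function. -/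
noncomputable def realFourier (f : ℝ → ℝ) (u : ℝ) : ℂ := 𝓕 (fun y : ℝ => (f y : ℂ)) u

theorem realFourier_eq (f : ℝ → ℝ) (u : ℝ) :
    realFourier f u = ∫ x : ℝ, (f x : ℂ) * planeWave (-(x * u)) := by
  simp only [realFourier, Real.fourier_real_eq, planeWave, Circle.smul_def, smul_eq_mul, mul_comm]

theorem realFourier_neg (f : ℝ → ℝ) (u : ℝ) :
    realFourier f (-u) = (starRingEnd ℂ) (realFourier f u) := by
  rw [realFourier_eq, realFourier_eq, ← integral_conj]
  simp [star_planeWave]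

theorem norm_realFourier_le (f : ℝ → ℝ) (u : ℝ) : ‖realFourier f u‖ ≤ ∫ x, ‖(f x : ℂ)‖ := by
  rw [realFourier_eq]
  refine (norm_integral_le_integral_norm _).trans_eq ?_
  simp [norm_planeWave]

namespace IsH1Compact

variable {f : ℝ → ℝ}

theorem integrable_ofReal (hf : IsH1Compact f) : Integrable fun x => (f x : ℂ) :=
  (hf.continuous.integrable_of_hasCompactSupport hf.compact).ofReal

theorem continuous_realFourier (hf : IsH1Compact f) : Continuous (realFourier f) :=
  VectorFourier.fourierIntegral_continuous Real.continuous_fourierChar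
    (by exact continuous_inner) hf.integrable_ofReal

theorem integrable_sq_mul_norm_sq (hf : IsH1Compact f) :
    Integrable fun u : ℝ => |u| ^ 2 * ‖realFourier f u‖ ^ 2 := by
  simpa only [realFourier, mul_comm] using hf.sobolev

theorem integrable_norm_sq (hf : IsH1Compact f) :
    Integrable fun u : ℝ => ‖realFourier f u‖ ^ 2 := by
  have hcont := hf.continuous_realFourier.norm.pow 2
  refine ((hcont.integrableOn_Icc (a := -1) (b := 1)).integrable_indicator measurableSet_Icc
    |>.add hf.integrable_sq_mul_norm_sq).mono' hcont.aestronglyMeasurable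
      (Eventually.of_forall fun u => ?_)
  rw [Real.norm_of_nonneg (sq_nonneg _), Pi.add_apply]
  by_cases hu : u ∈ Set.Icc (-1 : ℝ) 1
  · rw [Set.indicator_of_mem hu]
    exact le_add_of_nonneg_right (by positivity)
  · rw [Set.indicator_of_notMem hu, zero_add]
    rw [Set.mem_Icc, ← abs_le, not_le] at hu
    exact le_mul_of_one_le_left (sq_nonneg _) (one_le_pow₀ hu.le)

theorem integrable_norm (hf : IsH1Compact f) : Integrable fun u : ℝ => ‖realFourier f u‖ := by
  have hcont := hf.continuous_realFourier.norm
  refine (integrable_inv_one_add_sq.add (hf.integrable_norm_sq.add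
    hf.integrable_sq_mul_norm_sq)).mono' hcont.aestronglyMeasurable
      (Eventually.of_forall fun u => ?_)
  rw [norm_norm]
  simp only [Pi.add_apply, sq_abs]
  set a := ‖realFourier f u‖
  have ha : 0 ≤ a := norm_nonneg _
  have hAMGM : 0 ≤ (1 + u ^ 2)⁻¹ * (1 - (1 + u ^ 2) * a) ^ 2 := by positivity
  have hexpand : (1 + u ^ 2)⁻¹ * (1 - (1 + u ^ 2) * a) ^ 2 =
      (1 + u ^ 2)⁻¹ + (a ^ 2 + u ^ 2 * a ^ 2) - 2 * a := by
    field_simp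
    ring
  linarith

theorem integrable_realFourier (hf : IsH1Compact f) : Integrable (realFourier f) :=
  (integrable_norm_iff hf.continuous_realFourier.aestronglyMeasurable).1 hf.integrable_norm

theorem inversion (hf : IsH1Compact f) (x : ℝ) :
    ∫ u, realFourier f u * planeWave (u * x) = (f x : ℂ) := by
  have hcont := hf.continuous
  have hinv := congrFun (Continuous.fourierInv_fourier_eq (by fun_prop) hf.integrable_ofReal
    hf.integrable_realFourier) x
  rw [← hinv, Real.fourierInv_eq]
  refine integral_congr_ae (Eventually.of_forall fun u => ?_)
  simp [planeWave, Circle.smul_def, realFourier, mul_comm]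

end IsH1Compact

theorem zeroSum_castSucc {m : ℕ} (v : Fin m → ℝ) (j : Fin m) :
    zeroSum (n := m + 1) v j.castSucc = v j := by
  simp [zeroSum]

theorem zeroSum_last {m : ℕ} (v : Fin m → ℝ) :
    zeroSum (n := m + 1) v (Fin.last m) = -∑ j, v j := by
  simp [zeroSum]

theorem sum_zeroSum {m : ℕ} (v : Fin m → ℝ) : ∑ i, zeroSum (n := m + 1) v i = 0 := by
  simp [Fin.sum_univ_castSucc, zeroSum_castSucc, zeroSum_last]

theorem prod_zeroSum {m : ℕ} {M : Type*} [CommMonoid M] (g : ℝ → M) (v : Fin m → ℝ) :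
    ∏ i, g (zeroSum (n := m + 1) v i) = (∏ j, g (v j)) * g (-∑ j, v j) := by
  simp [Fin.prod_univ_castSucc, zeroSum_castSucc, zeroSum_last]

theorem zeroSum_neg {m : ℕ} (v : Fin m → ℝ) (i : Fin (m + 1)) :
    zeroSum (n := m + 1) (-v) i = -zeroSum (n := m + 1) v i := by
  induction i using Fin.lastCases with
  | last => simp [zeroSum_last]
  | cast j => simp [zeroSum_castSucc]

@[fun_prop]
theorem continuous_zeroSum {m : ℕ} (i : Fin (m + 1)) :
    Continuous fun v : Fin m → ℝ => zeroSum (n := m + 1) v i := by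
  induction i using Fin.lastCases with
  | last => simp only [zeroSum_last]; fun_prop
  | cast j => simp only [zeroSum_castSucc]; fun_prop

theorem abs_zeroSum_le {m : ℕ} (v : Fin m → ℝ) (i : Fin (m + 1)) :
    |zeroSum (n := m + 1) v i| ≤ ∑ j, |v j| := by
  induction i using Fin.lastCases with
  | last => rw [zeroSum_last, abs_neg]; exact Finset.abs_sum_le_sum_abs _ _
  | cast j =>
    rw [zeroSum_castSucc]
    exact Finset.single_le_sum (f := fun j => |v j|) (fun _ _ => abs_nonneg _) (Finset.mem_univ j)

/-- The product `∏ f̂(u_i)` over the hyperplane `u_1 + ⋯ + u_n = 0`. -/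
noncomputable def hyperplaneProd (f : ℝ → ℝ) {m : ℕ} (v : Fin m → ℝ) : ℂ :=
  ∏ i, realFourier f (zeroSum (n := m + 1) v i)

theorem hyperplaneProd_eq (f : ℝ → ℝ) {m : ℕ} (v : Fin m → ℝ) :
    hyperplaneProd f v = (∏ j, realFourier f (v j)) * realFourier f (-∑ j, v j) :=
  prod_zeroSum _ _

theorem hyperplaneProd_neg (f : ℝ → ℝ) {m : ℕ} (v : Fin m → ℝ) :
    hyperplaneProd f (-v) = (starRingEnd ℂ) (hyperplaneProd f v) := by
  simp [hyperplaneProd, zeroSum_neg, realFourier_neg]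

theorem measurePreserving_of_abs_det_eq_one {ι : Type*} [Fintype ι]
    (T : (ι → ℝ) →ₗ[ℝ] (ι → ℝ)) (hT : |LinearMap.det T| = 1) :
    MeasurePreserving T volume volume := by
  have hdet : LinearMap.det T ≠ 0 := by intro h; simp [h] at hT
  refine ⟨T.continuous_on_pi.measurable, ?_⟩
  rw [Real.map_linearMap_volume_pi_eq_smul_volume_pi hdet, abs_inv, hT]
  simp

/-- The reflection of `ℝ^m` replacing the coordinate `v_j` by `-(v_1 + ⋯ + v_m)`. -/
noncomputable def negSumReflection {m : ℕ} (j : Fin m) : (Fin m → ℝ) →ₗ[ℝ] (Fin m → ℝ) :=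
  LinearMap.pi fun k => if k = j then -∑ i, LinearMap.proj i else LinearMap.proj k

theorem negSumReflection_self {m : ℕ} (j : Fin m) (v : Fin m → ℝ) :
    negSumReflection j v j = -∑ i, v i := by
  simp [negSumReflection]

theorem negSumReflection_of_ne {m : ℕ} {j k : Fin m} (h : k ≠ j) (v : Fin m → ℝ) :
    negSumReflection j v k = v k := by
  simp [negSumReflection, h]

theorem negSumReflection_sum {m : ℕ} (j : Fin m) (v : Fin m → ℝ) :
    ∑ k, negSumReflection j v k = -v j := by
  rw [← Finset.add_sum_erase _ _ (Finset.mem_univ j), negSumReflection_self,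
    Finset.sum_congr rfl fun k hk => negSumReflection_of_ne (Finset.ne_of_mem_erase hk) v,
    ← Finset.add_sum_erase Finset.univ v (Finset.mem_univ j)]
  ring

theorem measurePreserving_negSumReflection {m : ℕ} (j : Fin m) :
    MeasurePreserving (negSumReflection j) volume volume := by
  refine measurePreserving_of_abs_det_eq_one _ ?_
  have hinv : negSumReflection j ∘ₗ negSumReflection j = LinearMap.id := by
    refine LinearMap.ext fun v => funext fun k => ?_
    simp only [LinearMap.comp_apply, LinearMap.id_apply]
    by_cases hk : k = j
    · subst hk; rw [negSumReflection_self, negSumReflection_sum, neg_neg]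
    · rw [negSumReflection_of_ne hk, negSumReflection_of_ne hk]
  have hsq := congrArg LinearMap.det hinv
  rw [LinearMap.det_comp, LinearMap.det_id, ← sq] at hsq
  rcases sq_eq_one_iff.1 hsq with hdet | hdet <;> simp [hdet]

theorem integrable_mul_prod_erase {ι : Type*} [Fintype ι] [DecidableEq ι] {G F : ℝ → ℝ}
    (hG : Integrable G) (hF : Integrable F) (j : ι) :
    Integrable fun v : ι → ℝ => G (v j) * ∏ k ∈ Finset.univ.erase j, F (v k) := by
  have hprod : Integrable fun v : ι → ℝ => ∏ k, (if k = j then G else F) (v k) :=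
    Integrable.fintype_prod fun k => by split_ifs <;> assumption
  refine hprod.congr (Eventually.of_forall fun v => ?_)
  simp only
  rw [← Finset.mul_prod_erase _ _ (Finset.mem_univ j), if_pos rfl]
  exact congrArg _ (Finset.prod_congr rfl fun k hk => by rw [if_neg (Finset.ne_of_mem_erase hk)])

namespace IsH1Compact

variable {f : ℝ → ℝ}

@[fun_prop]
theorem continuous_hyperplaneProd (hf : IsH1Compact f) {m : ℕ} :
    Continuous fun v : Fin m → ℝ => hyperplaneProd f v := by
  have := hf.continuous_realFourier
  unfold hyperplaneProd
  fun_prop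

theorem integrable_hyperplaneProd (hf : IsH1Compact f) {m : ℕ} :
    Integrable fun v : Fin m → ℝ => hyperplaneProd f v := by
  have h : Integrable fun v : Fin m → ℝ => ∏ j, realFourier f (v j) :=
    Integrable.fintype_prod (f := fun _ => realFourier f) fun _ => hf.integrable_realFourier
  simp_rw [hyperplaneProd_eq, mul_comm _ (realFourier f _)]
  have := hf.continuous_realFourier
  exact h.bdd_mul (c := ∫ x, ‖(f x : ℂ)‖) (by fun_prop)
    (Eventually.of_forall fun v => norm_realFourier_le f _)

theorem integrable_abs_mul_hyperplaneProd (hf : IsH1Compact f) {m : ℕ} (j : Fin m) :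
    Integrable fun v : Fin m → ℝ => |v j| * ‖hyperplaneProd f v‖ := by
  have hsq_mul := integrable_mul_prod_erase hf.integrable_sq_mul_norm_sq hf.integrable_norm j
  have hsq := (measurePreserving_negSumReflection j).integrable_comp_of_integrable
    (integrable_mul_prod_erase hf.integrable_norm_sq hf.integrable_norm j)
  refine (hsq_mul.add hsq).mono'
    (continuous_abs.comp (continuous_apply j) |>.mul hf.continuous_hyperplaneProd.norm
      |>.aestronglyMeasurable) (Eventually.of_forall fun v => ?_)
  rw [Real.norm_of_nonneg (by positivity), hyperplaneProd_eq, norm_mul, norm_prod,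
    ← Finset.mul_prod_erase _ _ (Finset.mem_univ j)]
  simp only [Pi.add_apply, Function.comp_apply, negSumReflection_self]
  have hprod : ∏ k ∈ Finset.univ.erase j, ‖realFourier f (negSumReflection j v k)‖ =
      ∏ k ∈ Finset.univ.erase j, ‖realFourier f (v k)‖ := Finset.prod_congr rfl fun k hk => by
    rw [negSumReflection_of_ne (Finset.ne_of_mem_erase hk)]
  rw [hprod, ← add_mul]
  set a := |v j| * ‖realFourier f (v j)‖ with ha
  set b := ‖realFourier f (-∑ i, v i)‖
  set R := ∏ k ∈ Finset.univ.erase j, ‖realFourier f (v k)‖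
  calc |v j| * (‖realFourier f (v j)‖ * R * b) = a * b * R := by rw [ha]; ring
    _ ≤ (a ^ 2 + b ^ 2) * R := by
        refine mul_le_mul_of_nonneg_right ?_ (Finset.prod_nonneg fun k _ => norm_nonneg _)
        nlinarith [sq_nonneg (a - b), sq_nonneg a, sq_nonneg b]
    _ = _ := by rw [ha, mul_pow]

theorem integral_hyperplaneProd (hf : IsH1Compact f) (m : ℕ) :
    ∫ v : Fin m → ℝ, hyperplaneProd f v = ((∫ t, f t ^ (m + 1) : ℝ) : ℂ) := by
  have hinteg : Integrable (fun p : (Fin m → ℝ) × ℝ =>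
      ((∏ j, realFourier f (p.1 j)) * (f p.2 : ℂ)) *
      planeWave ((∑ j, p.1 j) * p.2)) (volume.prod volume) := by
    refine ((Integrable.fintype_prod (f := fun _ : Fin m => realFourier f)
      fun _ => hf.integrable_realFourier).mul_prod hf.integrable_ofReal).mul_bdd (c := 1) ?_ ?_
    · fun_prop
    · exact Eventually.of_forall fun p => (norm_planeWave _).le
  calc ∫ v : Fin m → ℝ, hyperplaneProd f v
      = ∫ v : Fin m → ℝ, ∫ x : ℝ, ((∏ j, realFourier f (v j)) * (f x : ℂ)) *
          planeWave ((∑ j, v j) * x) := by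
        refine integral_congr_ae (Eventually.of_forall fun v => ?_)
        simp only [hyperplaneProd_eq]
        rw [realFourier_eq, ← integral_const_mul]
        refine integral_congr_ae (Eventually.of_forall fun x => ?_)
        simp only
        rw [mul_assoc]; congr 3; ring
    _ = ∫ x : ℝ, ∫ v : Fin m → ℝ, ((∏ j, realFourier f (v j)) * (f x : ℂ)) *
          planeWave ((∑ j, v j) * x) := integral_integral_swap hinteg
    _ = ∫ x : ℝ, ((f x ^ (m + 1) : ℝ) : ℂ) := by
        refine integral_congr_ae (Eventually.of_forall fun x => ?_)
        have : ∀ v : Fin m → ℝ, ((∏ j, realFourier f (v j)) * (f x : ℂ)) *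
            planeWave ((∑ j, v j) * x) =
            (f x : ℂ) * ∏ j, (realFourier f (v j) * planeWave (v j * x)) := by
          intro v
          rw [Finset.sum_mul, planeWave_sum, Finset.prod_mul_distrib]; ring
        simp only [this]
        rw [integral_const_mul, integral_fintype_prod_volume_eq_pow
          (fun u => realFourier f u * planeWave (u * x)), hf.inversion]
        simp [pow_succ']
    _ = _ := integral_ofReal

end IsH1Compact

/-- The matrix of the shear taking `v` to the vector with entries `-∑_{k ≤ j} v_k` for `j ∈ P` and
`v_j` for `j ∉ P`. -/
noncomputable def partialSumMatrix {m : ℕ} (P : Fin m → Prop) [DecidablePred P] :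
    Matrix (Fin m) (Fin m) ℝ :=
  Matrix.of fun j k => if P j then (if k ≤ j then -1 else 0) else if k = j then 1 else 0

theorem partialSumMatrix_mulVec {m : ℕ} (P : Fin m → Prop) [DecidablePred P] (v : Fin m → ℝ)
    (j : Fin m) :
    Matrix.toLin' (partialSumMatrix P) v j = if P j then -∑ k with k ≤ j, v k else v j := by
  simp only [Matrix.toLin'_apply, Matrix.mulVec, dotProduct, partialSumMatrix, Matrix.of_apply]
  split_ifs
  · simp only [ite_mul, neg_mul, one_mul, zero_mul, Finset.sum_filter, ← Finset.sum_neg_distrib]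
    exact Finset.sum_congr rfl fun k _ => by split_ifs <;> simp
  · simp

theorem measurePreserving_partialSum {m : ℕ} (P : Fin m → Prop) [DecidablePred P] :
    MeasurePreserving (Matrix.toLin' (partialSumMatrix P)) volume volume := by
  refine measurePreserving_of_abs_det_eq_one _ ?_
  rw [LinearMap.det_toLin', Matrix.det_of_isLowerTriangular, Finset.abs_prod]
  · refine Finset.prod_eq_one fun j _ => ?_
    simp only [partialSumMatrix, Matrix.of_apply]
    split_ifs <;> simp_all
  · intro j k hjk
    have : j < k := hjk
    simp [partialSumMatrix, this.ne', not_le.2 this]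

/-- The affine shear of `ℝ × ℝ^m` onto `ℝ^(m+1)`, with last coordinate `s` and with `j`-th
coordinate `s - ∑_{k ≤ j} v_k` for `j ∈ P` and `v_j` for `j ∉ P`. -/
noncomputable def affineShear {m : ℕ} (P : Fin m → Prop) [DecidablePred P] (q : ℝ × (Fin m → ℝ)) :
    Fin (m + 1) → ℝ :=
  Fin.snoc (fun j => if P j then q.1 - ∑ k with k ≤ j, q.2 k else q.2 j) q.1

theorem measurePreserving_affineShear {m : ℕ} (P : Fin m → Prop) [DecidablePred P] :
    MeasurePreserving (affineShear P) (volume.prod volume) volume := by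
  have hshear : MeasurePreserving (fun q : ℝ × (Fin m → ℝ) =>
      (q.1, Matrix.toLin' (partialSumMatrix P) q.2 + fun j => if P j then q.1 else 0))
      (volume.prod volume) (volume.prod volume) := by
    refine (MeasurePreserving.id volume).skew_product (g := fun s v =>
      Matrix.toLin' (partialSumMatrix P) v + fun j => if P j then s else 0) ?_ ?_
    · have hlin : Continuous (Matrix.toLin' (partialSumMatrix P)) := LinearMap.continuous_on_pi _
      have hadd : Continuous fun s : ℝ => fun j => if P j then s else 0 :=
        continuous_pi fun j => by split_ifs <;> fun_prop
      exact ((hlin.comp continuous_snd).add (hadd.comp continuous_fst)).measurable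
    · refine Eventually.of_forall fun s => ?_
      exact ((measurePreserving_add_right volume (fun j => if P j then s else 0)).comp
        (measurePreserving_partialSum P)).map_eq
  have hsnoc := (volume_preserving_piFinSuccAbove (fun _ : Fin (m + 1) => ℝ) (Fin.last m)).symm
  suffices hcomp : affineShear P = (MeasurableEquiv.piFinSuccAbove (fun _ => ℝ) (Fin.last m)).symm ∘
      fun q : ℝ × (Fin m → ℝ) =>
        (q.1, Matrix.toLin' (partialSumMatrix P) q.2 + fun j => if P j then q.1 else 0) by
    rw [hcomp]; exact hsnoc.comp hshear
  funext q j
  induction j using Fin.lastCases with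
  | last => simp [affineShear, MeasurableEquiv.piFinSuccAbove, Fin.insertNthEquiv]
  | cast j =>
    simp only [affineShear, Fin.snoc_castSucc, MeasurableEquiv.piFinSuccAbove, Function.comp_apply,
      MeasurableEquiv.symm_mk, MeasurableEquiv.coe_mk, Equiv.symm_symm, Fin.insertNthEquiv,
      Equiv.coe_fn_mk, Fin.insertNth_last', Pi.add_apply, partialSumMatrix_mulVec]
    split_ifs <;> ring

theorem coe_finRotate_of_lt {k : ℕ} {i : Fin k} (hi : (i : ℕ) + 1 < k) :
    (finRotate k i : ℕ) = i + 1 := by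
  obtain _ | k := k
  · exact i.elim0
  · rw [coe_finRotate, if_neg]
    rintro rfl
    simp at hi

theorem coe_finRotate_of_eq {k : ℕ} {i : Fin k} (hi : (i : ℕ) + 1 = k) :
    (finRotate k i : ℕ) = 0 := by
  obtain _ | k := k
  · exact i.elim0
  · rw [coe_finRotate, if_pos]
    ext
    simpa using hi

section Blocks

variable {m : ℕ} (c : Composition (m + 1))

theorem composition_index_eq_iff (j : Fin (m + 1)) (i : Fin c.length) :
    c.index j = i ↔ c.sizeUpTo i ≤ j ∧ (j : ℕ) < c.sizeUpTo (i + 1) := by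
  rw [eq_comm, ← c.mem_range_embedding_iff', c.mem_range_embedding_iff]

theorem card_filter_index_eq (i : Fin c.length) :
    (Finset.univ.filter fun j => c.index j = i).card = c.blocksFun i := by
  have hrange : (Finset.univ.filter fun j => c.index j = i) =
      Finset.univ.map (c.embedding i).toEmbedding := by
    ext j
    simp only [Finset.mem_filter, Finset.mem_univ, true_and, Finset.mem_map]
    rw [eq_comm, ← c.mem_range_embedding_iff']
    rfl
  simp [hrange]

theorem prod_comp_index {M : Type*} [CommMonoid M] (g : Fin c.length → M) :
    ∏ j, g (c.index j) = ∏ i, g i ^ c.blocksFun i := by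
  rw [← Finset.prod_fiberwise Finset.univ c.index]
  refine Finset.prod_congr rfl fun i _ => ?_
  rw [Finset.prod_congr rfl (g := fun _ => g i) fun j hj => by rw [(Finset.mem_filter.1 hj).2],
    Finset.prod_const, card_filter_index_eq]

/-- The last element `m_1 + ⋯ + m_i` of the `i`-th block of a composition (with indices counted
from `0`). -/
def blockEnd (i : Fin c.length) : Fin (m + 1) :=
  ⟨c.sizeUpTo (i + 1) - 1, by
    have := c.sizeUpTo_le (i + 1)
    omega⟩

theorem blockEnd_add_one (i : Fin c.length) : (blockEnd c i : ℕ) + 1 = c.sizeUpTo (i + 1) := by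
  have := c.sizeUpTo_strict_mono i.2
  simp only [blockEnd]
  omega

theorem index_blockEnd (i : Fin c.length) : c.index (blockEnd c i) = i := by
  have := blockEnd_add_one c i
  have := c.sizeUpTo_strict_mono i.2
  rw [composition_index_eq_iff]
  omega

theorem blockEnd_injective : Function.Injective (blockEnd c) :=
  Function.LeftInverse.injective (index_blockEnd c)

theorem blockEnd_eq_last {i : Fin c.length} (hi : (i : ℕ) + 1 = c.length) :
    blockEnd c i = Fin.last m := by
  have h := blockEnd_add_one c i
  rw [hi, c.sizeUpTo_length] at h
  ext
  simpa using h

@[to_additive]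
theorem prod_blockEnd {M : Type*} [CommMonoid M] (g : Fin (m + 1) → M) :
    ∏ i, g (blockEnd c i) = ∏ j with ∃ i, blockEnd c i = j, g j := by
  classical
  rw [← Finset.prod_image (f := g) (blockEnd_injective c).injOn]
  refine Finset.prod_congr ?_ fun _ _ => rfl
  ext j
  simp

theorem prod_ite_blockEnd {M : Type*} [CommMonoid M] (a b : Fin (m + 1) → M) :
    (∏ j, if ∃ i, blockEnd c i = j then a j else b j) * ∏ i, b (blockEnd c i) =
      (∏ i, a (blockEnd c i)) * ∏ j, b j := by
  rw [Finset.prod_ite, prod_blockEnd c a, prod_blockEnd c b, mul_assoc,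
    mul_comm (∏ j with ¬∃ i, blockEnd c i = j, b j), Finset.prod_filter_mul_prod_filter_not]

theorem blockSum_eq_sum_filter_le (u : Fin (m + 1) → ℝ) (i : Fin c.length) :
    blockSum c u i = ∑ j with j ≤ blockEnd c i, u j := by
  refine Finset.sum_congr ?_ fun _ _ => rfl
  ext j
  have := blockEnd_add_one c i
  simp only [Finset.mem_filter, Finset.mem_univ, true_and, Fin.le_def]
  omega

theorem blockSum_eq_zero_of_last {u : Fin (m + 1) → ℝ} (hu : ∑ j, u j = 0) {i : Fin c.length}
    (hi : (i : ℕ) + 1 = c.length) : blockSum c u i = 0 := by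
  rw [blockSum_eq_sum_filter_le, blockEnd_eq_last c hi,
    Finset.filter_true_of_mem fun j _ => Fin.le_last j, hu]

theorem sum_filter_index_eq_finRotate {u : Fin (m + 1) → ℝ} (hu : ∑ j, u j = 0)
    (i : Fin c.length) :
    ∑ j with c.index j = finRotate _ i, u j = blockSum c u (finRotate _ i) - blockSum c u i := by
  simp only [composition_index_eq_iff]
  rcases (Nat.succ_le_of_lt i.2).lt_or_eq with hi | hi
  · have hmono := c.monotone_sizeUpTo (Nat.le_succ ((i : ℕ) + 1))
    rw [Nat.succ_eq_add_one] at hmono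
    simp only [blockSum, coe_finRotate_of_lt hi]
    rw [eq_sub_iff_add_eq, ← Finset.sum_union]
    · refine Finset.sum_congr ?_ fun _ _ => rfl
      ext j
      simp only [Finset.mem_union, Finset.mem_filter, Finset.mem_univ, true_and]
      omega
    · rw [Finset.disjoint_filter]
      omega
  · rw [blockSum_eq_zero_of_last c hu hi, sub_zero]
    simp only [blockSum, coe_finRotate_of_eq hi, c.sizeUpTo_zero, Nat.zero_le, true_and]

open scoped Classical in
/-- The shear taking a pair of a point `s` and a vector `u` of the hyperplane `∑ u_j = 0` (in the
coordinates `zeroSum`) to the vector with entries `s - (u_1 + ⋯ + u_j)` at the ends `j` of the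
blocks of `c`, and `u_j` elsewhere. -/
noncomputable def blockShear : ℝ × (Fin m → ℝ) → Fin (m + 1) → ℝ :=
  affineShear fun j : Fin m => ∃ i, blockEnd c i = j.castSucc

theorem measurePreserving_blockShear :
    MeasurePreserving (blockShear c) (volume.prod volume) volume :=
  measurePreserving_affineShear _

theorem blockShear_blockEnd (q : ℝ × (Fin m → ℝ)) (i : Fin c.length) :
    blockShear c q (blockEnd c i) = q.1 - blockSum c (zeroSum (n := m + 1) q.2) i := by
  rcases Fin.eq_castSucc_or_eq_last (blockEnd c i) with ⟨j, hj⟩ | hj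
  · have hend : ∃ i, blockEnd c i = j.castSucc := ⟨i, hj⟩
    rw [blockSum_eq_sum_filter_le, hj]
    simp only [blockShear, affineShear, Fin.snoc_castSucc, if_pos hend, Finset.sum_filter]
    rw [Fin.sum_univ_castSucc]
    simp [zeroSum_castSucc]
  · rw [blockSum_eq_sum_filter_le, hj, Finset.filter_true_of_mem fun j _ => Fin.le_last j,
      sum_zeroSum]
    simp [blockShear, affineShear]

theorem blockShear_of_not_blockEnd (q : ℝ × (Fin m → ℝ)) {j : Fin (m + 1)}
    (hj : ¬∃ i, blockEnd c i = j) : blockShear c q j = zeroSum (n := m + 1) q.2 j := by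
  induction j using Fin.lastCases with
  | last =>
    have hlen := c.length_pos_of_pos m.succ_pos
    exact absurd ⟨⟨c.length - 1, by omega⟩, blockEnd_eq_last c (Nat.sub_add_cancel hlen)⟩ hj
  | cast j => simp only [blockShear, affineShear, Fin.snoc_castSucc, if_neg hj, zeroSum_castSucc]

end Blocks

section Trace

variable {m : ℕ} (c : Composition (m + 1))

open scoped Classical in
/-- The factor in the `j`-th frequency when the trace `Tr[f^{m_1} K ⋯ f^{m_ℓ} K]` is expanded by
Fourier inversion: there is one frequency per factor `f`, except that the frequency of the last
factor of each block is eliminated and the slot is used for the frequency of the adjacent factor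
`K`. -/
noncomputable def traceFactor (f w : ℝ → ℝ) (j : Fin (m + 1)) : ℝ → ℂ :=
  if ∃ i, blockEnd c i = j then fun s => (w s : ℂ) else realFourier f

/-- The frequency conjugate to the position `x_{i+1}` in the expansion of the trace, for the
frequencies `z`. -/
noncomputable def tracePhase (z : Fin (m + 1) → ℝ) (i : Fin c.length) : ℝ :=
  ∑ j with c.index j = finRotate _ i, z j - z (blockEnd c i)

@[fun_prop]
theorem continuous_tracePhase (i : Fin c.length) : Continuous fun z => tracePhase c z i := by
  unfold tracePhase
  fun_prop

open scoped Classical in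
theorem sum_mul_tracePhase (z : Fin (m + 1) → ℝ) (x : Fin c.length → ℝ) :
    ∑ j, z j * (x (c.index j) - if ∃ i, blockEnd c i = j then x (finRotate _ (c.index j)) else 0) =
      ∑ i, x (finRotate _ i) * tracePhase c z i := by
  simp only [mul_sub, mul_ite, mul_zero, Finset.sum_sub_distrib, tracePhase]
  rw [← Finset.sum_filter, ← sum_blockEnd c fun j => z j * x (finRotate _ (c.index j))]
  simp only [index_blockEnd]
  congr 1
  · rw [Equiv.sum_comp (finRotate c.length) (fun k => x k * ∑ j with c.index j = k, z j),
      ← Finset.sum_fiberwise Finset.univ c.index]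
    refine Finset.sum_congr rfl fun k _ => ?_
    rw [Finset.mul_sum]
    refine Finset.sum_congr rfl fun j hj => ?_
    rw [(Finset.mem_filter.1 hj).2, mul_comm]
  · exact Finset.sum_congr rfl fun i _ => mul_comm _ _

theorem neg_tracePhase_blockShear (q : ℝ × (Fin m → ℝ)) (i : Fin c.length) :
    -tracePhase c (blockShear c q) i = zeroSum (n := m + 1) q.2 (blockEnd c (finRotate _ i)) := by
  set k := finRotate _ i
  have hmem : blockEnd c k ∈ Finset.univ.filter fun j => c.index j = k := by
    simp [index_blockEnd]
  have hrest : ∑ j ∈ (Finset.univ.filter fun j => c.index j = k).erase (blockEnd c k),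
      blockShear c q j = ∑ j ∈ (Finset.univ.filter fun j => c.index j = k).erase (blockEnd c k),
        zeroSum (n := m + 1) q.2 j := by
    refine Finset.sum_congr rfl fun j hj => blockShear_of_not_blockEnd c q ?_
    rintro ⟨l, rfl⟩
    simp only [Finset.mem_erase, Finset.mem_filter, index_blockEnd] at hj
    exact hj.1 (by rw [hj.2.2])
  have hblock := sum_filter_index_eq_finRotate c (sum_zeroSum q.2) i
  rw [← Finset.add_sum_erase _ _ hmem] at hblock
  rw [tracePhase, ← Finset.add_sum_erase _ _ hmem, hrest, blockShear_blockEnd, blockShear_blockEnd]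
  linarith

theorem prod_traceFactor_blockShear (f w : ℝ → ℝ) (q : ℝ × (Fin m → ℝ)) :
    (∏ j, traceFactor c f w j (blockShear c q j)) *
      ∏ i, realFourier f (-tracePhase c (blockShear c q) i) =
      ((∏ i, w (q.1 - blockSum c (zeroSum (n := m + 1) q.2) i) : ℝ) : ℂ) *
        hyperplaneProd f q.2 := by
  classical
  have hfactor : ∀ j, traceFactor c f w j (blockShear c q j) =
      if ∃ i, blockEnd c i = j then (w (blockShear c q j) : ℂ)
        else realFourier f (zeroSum (n := m + 1) q.2 j) := by
    intro j
    unfold traceFactor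
    split_ifs with h
    · rfl
    · rw [blockShear_of_not_blockEnd c q h]
  simp only [neg_tracePhase_blockShear, hfactor]
  rw [Equiv.prod_comp (finRotate c.length) fun i =>
      realFourier f (zeroSum (n := m + 1) q.2 (blockEnd c i)),
    prod_ite_blockEnd c (fun j => (w (blockShear c q j) : ℂ))]
  simp only [blockShear_blockEnd, hyperplaneProd, Complex.ofReal_prod]

theorem integral_position (f : ℝ → ℝ) (z : Fin (m + 1) → ℝ) (a : ℂ) :
    ∫ x : Fin c.length → ℝ, (∏ i, (f (x i) : ℂ)) * a *
        planeWave (∑ i, x (finRotate _ i) * tracePhase c z i) =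
      a * ∏ i, realFourier f (-tracePhase c z i) := by
  have hsplit : ∀ x : Fin c.length → ℝ, (∏ i, (f (x i) : ℂ)) * a *
        planeWave (∑ i, x (finRotate _ i) * tracePhase c z i) =
      a * ∏ i, ((f (x i) : ℂ) * planeWave (-(x i * -tracePhase c z ((finRotate _).symm i)))) := by
    intro x
    rw [mul_comm _ a, mul_assoc, planeWave_sum, Finset.prod_mul_distrib,
      ← Equiv.prod_comp (finRotate c.length)
        (fun i => planeWave (-(x i * -tracePhase c z ((finRotate _).symm i))))]
    simp only [Equiv.symm_apply_apply, mul_neg, neg_neg]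
  simp only [hsplit]
  rw [integral_const_mul, integral_fintype_prod_volume_eq_prod (fun i s =>
    (f s : ℂ) * planeWave (-(s * -tracePhase c z ((finRotate _).symm i))))]
  simp only [← realFourier_eq]
  rw [Equiv.prod_comp (finRotate c.length).symm fun i => realFourier f (-tracePhase c z i)]

namespace IsH1Compact

variable {f w : ℝ → ℝ}

theorem integrable_prod_traceFactor (hf : IsH1Compact f) (hw : Integrable w) :
    Integrable fun z : Fin (m + 1) → ℝ => ∏ j, traceFactor c f w j (z j) := by
  refine Integrable.fintype_prod fun j => ?_
  unfold traceFactor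
  split_ifs
  · exact hw.ofReal
  · exact hf.integrable_realFourier

theorem integrable_prod_traceFactor_mul (hf : IsH1Compact f) (hw : Integrable w) :
    Integrable fun z : Fin (m + 1) → ℝ =>
      (∏ j, traceFactor c f w j (z j)) * ∏ i, realFourier f (-tracePhase c z i) := by
  have hcont := hf.continuous_realFourier
  refine (hf.integrable_prod_traceFactor c hw).mul_bdd
    (c := ∏ i : Fin c.length, ∫ x, ‖(f x : ℂ)‖) (by fun_prop) (Eventually.of_forall fun z => ?_)
  rw [norm_prod]
  exact Finset.prod_le_prod (fun _ _ => norm_nonneg _) fun i _ => norm_realFourier_le f _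

theorem integrable_prod_mul_hyperplaneProd (hf : IsH1Compact f) (hw : Integrable w) :
    Integrable (fun q : ℝ × (Fin m → ℝ) =>
      ((∏ i, w (q.1 - blockSum c (zeroSum (n := m + 1) q.2) i) : ℝ) : ℂ) *
        hyperplaneProd f q.2) (volume.prod volume) :=
  ((measurePreserving_blockShear c).integrable_comp_of_integrable
    (hf.integrable_prod_traceFactor_mul c hw)).congr
      (Eventually.of_forall fun q => prod_traceFactor_blockShear c f w q)

variable {K : ℝ → ℝ → ℝ}

theorem prod_mul_kernel_eq_integral (hf : IsH1Compact f)
    (hK : ∀ x y, (K x y : ℂ) = ∫ s, (w s : ℂ) * planeWave (s * (x - y)))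
    (x : Fin c.length → ℝ) :
    ((∏ i, f (x i) ^ c.blocksFun i * K (x i) (x (finRotate c.length i)) : ℝ) : ℂ) =
      ∫ z : Fin (m + 1) → ℝ, (∏ i, (f (x i) : ℂ)) * (∏ j, traceFactor c f w j (z j)) *
        planeWave (∑ i, x (finRotate _ i) * tracePhase c z i) := by
  classical
  let y : Fin (m + 1) → ℝ := fun j =>
    x (c.index j) - if ∃ i, blockEnd c i = j then x (finRotate _ (c.index j)) else 0
  have hfactor : ∀ j, ∫ s, traceFactor c f w j s * planeWave (s * y j) =
      if ∃ i, blockEnd c i = j then (K (x (c.index j)) (x (finRotate _ (c.index j))) : ℂ)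
        else (f (x (c.index j)) : ℂ) := by
    intro j
    simp only [traceFactor, y]
    split_ifs
    · rw [hK]
    · rw [sub_zero, hf.inversion]
  have hexchange := prod_ite_blockEnd c
    (fun j => (K (x (c.index j)) (x (finRotate _ (c.index j))) : ℂ))
    (fun j => (f (x (c.index j)) : ℂ))
  simp only [index_blockEnd] at hexchange
  simp only [← sum_mul_tracePhase, planeWave_sum, mul_assoc, ← Finset.prod_mul_distrib]
  rw [integral_const_mul, integral_fintype_prod_volume_eq_prod (fun j s =>
    traceFactor c f w j s * planeWave (s * y j))]
  simp only [hfactor]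
  rw [mul_comm, hexchange, prod_comp_index c fun i => (f (x i) : ℂ), mul_comm]
  simp [Finset.prod_mul_distrib]

theorem compTrace_eq_integral_frequency (hf : IsH1Compact f) (hw : Integrable w)
    (hK : ∀ x y, (K x y : ℂ) = ∫ s, (w s : ℂ) * planeWave (s * (x - y))) :
    (compTrace K f c : ℂ) = ∫ z : Fin (m + 1) → ℝ,
      (∏ j, traceFactor c f w j (z j)) * ∏ i, realFourier f (-tracePhase c z i) := by
  have hprod : Integrable fun x : Fin c.length → ℝ => ∏ i, (f (x i) : ℂ) :=
    Integrable.fintype_prod (f := fun _ s => (f s : ℂ)) fun _ => hf.integrable_ofReal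
  have hinteg : Integrable (fun p : (Fin c.length → ℝ) × (Fin (m + 1) → ℝ) =>
      (∏ i, (f (p.1 i) : ℂ)) * (∏ j, traceFactor c f w j (p.2 j)) *
        planeWave (∑ i, p.1 (finRotate _ i) * tracePhase c p.2 i)) (volume.prod volume) :=
    (hprod.mul_prod (hf.integrable_prod_traceFactor c hw)).mul_bdd (c := 1) (by fun_prop)
      (Eventually.of_forall fun p => (norm_planeWave _).le)
  rw [compTrace, ← integral_complex_ofReal]
  simp only [hf.prod_mul_kernel_eq_integral c hK]
  rw [integral_integral_swap hinteg]
  simp only [integral_position]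

theorem compTrace_eq (hf : IsH1Compact f) (hw : Integrable w)
    (hK : ∀ x y, (K x y : ℂ) = ∫ s, (w s : ℂ) * planeWave (s * (x - y))) :
    (compTrace K f c : ℂ) = ∫ q : ℝ × (Fin m → ℝ),
      ((∏ i, w (q.1 - blockSum c (zeroSum (n := m + 1) q.2) i) : ℝ) : ℂ) *
        hyperplaneProd f q.2 ∂(volume.prod volume) := by
  have hshear := measurePreserving_blockShear c
  rw [hf.compTrace_eq_integral_frequency c hw hK, ← hshear.map_eq,
    integral_map hshear.measurable.aemeasurable
      (by rw [hshear.map_eq]; exact (hf.integrable_prod_traceFactor_mul c hw).1)]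
  simp only [prod_traceFactor_blockShear]

end IsH1Compact

end Trace

/-! ### Sine kernels and cut-off multipliers -/

theorem intervalIntegral_planeWave (a t : ℝ) :
    ∫ s in (-a)..a, planeWave (s * t) = (sineKernel a t : ℂ) := by
  rcases eq_or_ne t 0 with rfl | ht
  · simp only [mul_zero, planeWave_zero, sineKernel_zero]
    rw [intervalIntegral.integral_const]
    simp only [sub_neg_eq_add, Complex.real_smul, mul_one]
    push_cast
    ring
  · obtain ⟨θ, hθ⟩ : ∃ θ : ℂ, θ = ((2 * Real.pi * a * t : ℝ) : ℂ) := ⟨_, rfl⟩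
    have hpi : (Real.pi : ℂ) ≠ 0 := by exact_mod_cast Real.pi_ne_zero
    have ht' : (t : ℂ) ≠ 0 := by exact_mod_cast ht
    have hc : (2 * Real.pi * t * Complex.I : ℂ) ≠ 0 := by simp [ht]
    have hexp (s : ℝ) :
        planeWave (s * t) = Complex.exp ((2 * Real.pi * t * Complex.I) * s) := by
      rw [planeWave_eq_exp]
      congr 1
      push_cast
      ring
    have hlower : (2 * Real.pi * t * Complex.I : ℂ) * ((-a : ℝ) : ℂ) = -θ * Complex.I := by
      rw [hθ]
      push_cast
      ring
    have hupper : (2 * Real.pi * t * Complex.I : ℂ) * (a : ℂ) = θ * Complex.I := by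
      rw [hθ]
      push_cast
      ring
    simp only [hexp]
    rw [integral_exp_mul_complex hc, hlower, hupper, sineKernel_of_ne_zero a ht,
      Complex.ofReal_div, Complex.ofReal_sin, ← hθ, Complex.sin]
    push_cast
    rw [div_eq_div_iff hc (mul_ne_zero hpi ht')]
    linear_combination (2 * Real.pi * t / 2 : ℂ) * (Complex.exp (θ * Complex.I) -
      Complex.exp (-θ * Complex.I)) * Complex.I_sq

/-- The points `x` whose cell `⌊a x⌋` is retained by the cut-off `M`. -/
def cutoffSet (a : ℝ) (M : ℤ) : Set ℝ := {x | ⌊a * x⌋ ∈ Finset.Icc (-M) M}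

open scoped Classical in
/-- The value of `η` on the cell of `x`. Off the retained cells it is set to `-1`, which makes the
interval `|s| ≤ cutoffEta a M η x` empty. -/
noncomputable def cutoffEta (a : ℝ) (M : ℤ) (η : ℤ → ℝ) (x : ℝ) : ℝ :=
  if x ∈ cutoffSet a M then η ⌊a * x⌋ else -1

theorem cutoffEta_of_mem {a : ℝ} {M : ℤ} (η : ℤ → ℝ) {x : ℝ} (hx : x ∈ cutoffSet a M) :
    cutoffEta a M η x = η ⌊a * x⌋ := if_pos hx

theorem cutoffEta_of_notMem {a : ℝ} {M : ℤ} (η : ℤ → ℝ) {x : ℝ} (hx : x ∉ cutoffSet a M) :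
    cutoffEta a M η x = -1 := if_neg hx

theorem measurable_floor_mul (a : ℝ) : Measurable fun x : ℝ => ⌊a * x⌋ :=
  Int.measurable_floor.comp (measurable_const_mul a)

theorem measurableSet_cutoffSet (a : ℝ) (M : ℤ) : MeasurableSet (cutoffSet a M) :=
  measurable_floor_mul a (MeasurableSet.of_discrete (s := {k | k ∈ Finset.Icc (-M) M}))

@[fun_prop]
theorem measurable_cutoffEta (a : ℝ) (M : ℤ) (η : ℤ → ℝ) : Measurable (cutoffEta a M η) :=
  Measurable.ite (measurableSet_cutoffSet a M)
    ((measurable_of_countable η).comp (measurable_floor_mul a)) measurable_const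

/-- The Fourier multiplier whose kernel is the mixture of the sine kernels with parameters
`η ⌊a x⌋`, for `x` distributed according to `μ` and restricted to the cells retained by `M`. -/
noncomputable def cutoffMultiplier (μ : Measure ℝ) (a : ℝ) (M : ℤ) (η : ℤ → ℝ) (s : ℝ) : ℝ :=
  μ.real {x | |s| ≤ cutoffEta a M η x}

section CutoffMultiplier

variable (μ : Measure ℝ) (a : ℝ) (M : ℤ) (η : ℤ → ℝ)

theorem setOf_le_cutoffEta (s : ℝ) : {x | |s| ≤ cutoffEta a M η x} =
    ⋃ k ∈ (Finset.Icc (-M) M).filter (fun k => |s| ≤ η k), {x | ⌊a * x⌋ = k} := by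
  ext x
  simp only [Set.mem_ofPred_eq, Set.mem_iUnion, Finset.mem_filter, exists_prop, exists_eq_right']
  by_cases hx : x ∈ cutoffSet a M
  · rw [cutoffEta_of_mem η hx]
    exact (and_iff_right hx).symm
  · rw [cutoffEta_of_notMem η hx]
    refine iff_of_false (fun hs => ?_) (fun hmem => hx hmem.1)
    linarith [abs_nonneg s]

theorem cutoffMultiplier_eq_sum [IsFiniteMeasure μ] (s : ℝ) :
    cutoffMultiplier μ a M η s = ∑ k ∈ Finset.Icc (-M) M, μ.real {x | ⌊a * x⌋ = k} *
      (Set.Icc (-η k) (η k)).indicator 1 s := by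
  rw [cutoffMultiplier, setOf_le_cutoffEta, measureReal_biUnion_finset, Finset.sum_filter]
  · refine Finset.sum_congr rfl fun k _ => ?_
    by_cases hk : |s| ≤ η k
    · rw [if_pos hk, Set.indicator_of_mem (Set.mem_Icc.2 (abs_le.1 hk)), Pi.one_apply, mul_one]
    · rw [if_neg hk, Set.indicator_of_notMem fun hs => hk (abs_le.2 (Set.mem_Icc.1 hs)), mul_zero]
  · intro k _ l _ hkl
    exact Set.disjoint_left.2 fun x (hk : ⌊a * x⌋ = k) (hl : ⌊a * x⌋ = l) => hkl (hk.symm.trans hl)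
  · exact fun k _ => measurable_floor_mul a (measurableSet_singleton k)

theorem integrable_cutoffMultiplier [IsFiniteMeasure μ] :
    Integrable (cutoffMultiplier μ a M η) := by
  rw [funext (cutoffMultiplier_eq_sum μ a M η)]
  refine integrable_finsetSum _ fun k _ => Integrable.const_mul ?_ _
  exact (integrable_indicator_iff measurableSet_Icc).2
    (integrableOn_const (C := (1 : ℝ)) (by simp) (by simp))

variable {η}

theorem sum_sineKernel_eq_integral [IsFiniteMeasure μ] (hη : ∀ k ∈ Finset.Icc (-M) M, 0 ≤ η k)
    (t : ℝ) :
    ((∑ k ∈ Finset.Icc (-M) M, μ.real {x | ⌊a * x⌋ = k} * sineKernel (η k) t : ℝ) : ℂ) =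
      ∫ s, (cutoffMultiplier μ a M η s : ℂ) * planeWave (s * t) := by
  have hsum (s : ℝ) : (cutoffMultiplier μ a M η s : ℂ) * planeWave (s * t) =
      ∑ k ∈ Finset.Icc (-M) M, (μ.real {x | ⌊a * x⌋ = k} : ℂ) *
        (Set.Icc (-η k) (η k)).indicator (fun s => planeWave (s * t)) s := by
    rw [cutoffMultiplier_eq_sum, Complex.ofReal_sum, Finset.sum_mul]
    refine Finset.sum_congr rfl fun k _ => ?_
    by_cases hs : s ∈ Set.Icc (-η k) (η k) <;> simp [hs]
  simp only [hsum]
  rw [integral_finsetSum]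
  · push_cast
    refine Finset.sum_congr rfl fun k hk => ?_
    rw [integral_const_mul, integral_indicator measurableSet_Icc, integral_Icc_eq_integral_Ioc,
      ← intervalIntegral.integral_of_le (neg_le_self (hη k hk)), intervalIntegral_planeWave]
  · intro k _
    refine Integrable.const_mul ((integrable_indicator_iff measurableSet_Icc).2 ?_) _
    exact (by fun_prop : Continuous fun s => planeWave (s * t)).integrableOn_Icc

end CutoffMultiplier

namespace IsSurvivalFunction

variable {Ψ : ℝ → ℝ} {a : ℝ}

theorem measureReal_Ico (h : IsSurvivalFunction Ψ) {p q : ℝ} (hpq : p ≤ q) :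
    (shapeMeasure Ψ).real (Set.Ico p q) = Ψ p - Ψ q := by
  have := h.isProbabilityMeasure
  rw [measureReal_congr (Ico_ae_eq_Ioc (μ := shapeMeasure Ψ) (a := p) (b := q)),
    ← Set.Ioi_sdiff_Ioi, measureReal_sdiff (Set.Ioi_subset_Ioi hpq) measurableSet_Ioi,
    h.measureReal_Ioi, h.measureReal_Ioi]

theorem measureReal_cell (h : IsSurvivalFunction Ψ) (ha : 0 < a) (k : ℤ) :
    (shapeMeasure Ψ).real {x | ⌊a * x⌋ = k} = Ψ (k / a) - Ψ ((k + 1) / a) := by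
  have hcell : {x | ⌊a * x⌋ = k} = Set.Ico (k / a) ((k + 1) / a) := by
    ext x
    simp only [Set.mem_ofPred_eq, Int.floor_eq_iff, Set.mem_Ico, div_le_iff₀ ha, lt_div_iff₀ ha,
      mul_comm a x]
  rw [hcell, h.measureReal_Ico (by gcongr; linarith)]

theorem measureReal_cutoffSet (h : IsSurvivalFunction Ψ) (ha : 0 < a) {M : ℤ} (hM : 0 ≤ M) :
    (shapeMeasure Ψ).real (cutoffSet a M) = Ψ (-M / a) - Ψ ((M + 1) / a) := by
  have hM' : (0 : ℝ) ≤ M := by exact_mod_cast hM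
  have hset : cutoffSet a M = Set.Ico (-M / a) ((M + 1) / a) := by
    ext x
    rw [cutoffSet, Set.mem_ofPred_eq, Finset.mem_Icc, Set.mem_Ico, div_le_iff₀ ha, lt_div_iff₀ ha,
      Int.le_floor, ← Int.lt_add_one_iff, Int.floor_lt, mul_comm x]
    push_cast
    rfl
  rw [hset, h.measureReal_Ico (by gcongr; linarith)]

end IsSurvivalFunction

theorem pi_setOf_comp_injective {ι κ X : Type*} [Fintype ι] [Fintype κ] [MeasurableSpace X]
    (μ : Measure X) [IsProbabilityMeasure μ] {g : ι → κ} (hg : Function.Injective g)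
    (S : ι → Set X) :
    Measure.pi (fun _ : κ => μ) {x | ∀ i, x (g i) ∈ S i} = ∏ i, μ (S i) := by
  have hpi : {x : κ → X | ∀ i, x (g i) ∈ S i} =
      Set.univ.pi fun j => ⋂ i, ⋂ _ : g i = j, S i := by
    ext x
    simp only [Set.mem_ofPred_eq, Set.mem_pi, Set.mem_univ, true_imp_iff, Set.mem_iInter]
    exact ⟨fun h j i hij => hij ▸ h i, fun h i => h _ i rfl⟩
  rw [hpi, Measure.pi_pi]
  refine (Fintype.prod_of_injective g hg _ _ (fun j hj => ?_) fun i => ?_).symm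
  · have huniv : ⋂ i, ⋂ _ : g i = j, S i = Set.univ :=
      Set.iInter_eq_univ.2 fun i => Set.iInter_eq_univ.2 fun hi => absurd ⟨i, hi⟩ hj
    rw [huniv, measure_univ]
  · congr 1
    ext x
    simp only [Set.mem_iInter]
    exact ⟨fun hx k hk => hg hk ▸ hx, fun hx => hx i rfl⟩

/-- The length of the intersection of the intervals `[L_i - e_i, L_i + e_i]`. -/
noncomputable def overlap {ι : Type*} (L e : ι → ℝ) : ℝ :=
  max 0 ((⨅ i, (L i + e i)) + ⨅ i, (-L i + e i))

section Overlap

variable {ι : Type*} [Nonempty ι]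

theorem setOf_forall_abs_sub_le [Finite ι] (L e : ι → ℝ) :
    {s : ℝ | ∀ i, |s - L i| ≤ e i} = Set.Icc (-⨅ i, (-L i + e i)) (⨅ i, (L i + e i)) := by
  ext s
  rw [Set.mem_ofPred_eq, Set.mem_Icc, neg_le, le_ciInf_iff (Set.finite_range _).bddBelow,
    le_ciInf_iff (Set.finite_range _).bddBelow, ← forall_and]
  refine forall_congr' fun i => ?_
  rw [abs_sub_le_iff]
  constructor <;> rintro ⟨hupper, hlower⟩ <;> constructor <;> linarith

theorem measureReal_setOf_forall_abs_sub_le [Finite ι] (L e : ι → ℝ) :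
    (volume : Measure ℝ).real {s : ℝ | ∀ i, |s - L i| ≤ e i} = overlap L e := by
  rw [setOf_forall_abs_sub_le, measureReal_def, Real.volume_Icc, ENNReal.toReal_ofReal', overlap,
    max_comm, sub_neg_eq_add]

/-- Both sides are the measure of `{(s, x) | |s - L i| ≤ cutoffEta a M η (x (g i)) for all i}`. -/
theorem integral_prod_cutoffMultiplier (μ : Measure ℝ) [IsProbabilityMeasure μ] (a : ℝ) (M : ℤ)
    (η : ℤ → ℝ) [Fintype ι] {κ : Type*} [Fintype κ] {g : ι → κ} (hg : Function.Injective g)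
    (L : ι → ℝ) :
    ∫ s, ∏ i, cutoffMultiplier μ a M η (s - L i) =
      ∫ x, overlap L (fun i => cutoffEta a M η (x (g i))) ∂Measure.pi fun _ : κ => μ := by
  set A : Set (ℝ × (κ → ℝ)) := {p | ∀ i, |p.1 - L i| ≤ cutoffEta a M η (p.2 (g i))} with hA
  have hAm : MeasurableSet A := by
    rw [hA, Set.ofPred_forall]
    refine MeasurableSet.iInter fun i => measurableSet_le (by fun_prop) ?_
    exact (measurable_cutoffEta a M η).comp ((measurable_pi_apply (g i)).comp measurable_snd)
  have hleft (s : ℝ) : ∏ i, cutoffMultiplier μ a M η (s - L i) =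
      (Measure.pi (fun _ : κ => μ) (Prod.mk s ⁻¹' A)).toReal := by
    have hslice : Prod.mk s ⁻¹' A = {x | ∀ i, x (g i) ∈ {y | |s - L i| ≤ cutoffEta a M η y}} := rfl
    rw [hslice, pi_setOf_comp_injective _ hg, ENNReal.toReal_prod]
    rfl
  have hright (x : κ → ℝ) : overlap L (fun i => cutoffEta a M η (x (g i))) =
      ((volume : Measure ℝ) ((fun s => (s, x)) ⁻¹' A)).toReal :=
    (measureReal_setOf_forall_abs_sub_le _ _).symm
  have hfinite (x : κ → ℝ) : (volume : Measure ℝ) ((fun s => (s, x)) ⁻¹' A) < ⊤ := by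
    have hslice : (fun s => (s, x)) ⁻¹' A =
        {s : ℝ | ∀ i, |s - L i| ≤ cutoffEta a M η (x (g i))} := rfl
    rw [hslice, setOf_forall_abs_sub_le]
    exact measure_Icc_lt_top
  simp only [hleft, hright]
  rw [integral_toReal (measurable_measure_prodMk_left hAm).aemeasurable
      (Eventually.of_forall fun s => measure_lt_top _ _),
    integral_toReal (measurable_measure_prodMk_right hAm).aemeasurable
      (Eventually.of_forall hfinite), ← Measure.prod_apply hAm, ← Measure.prod_apply_symm hAm]

end Overlap

section Overlap

variable {ι : Type*}

theorem iInf_sub_le_of_abs_sub_le [Finite ι] [Nonempty ι] {g k : ι → ℝ} {δ : ℝ}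
    (h : ∀ i, |g i - k i| ≤ δ) : (⨅ i, g i) - δ ≤ ⨅ i, k i :=
  le_ciInf fun i => by
    linarith [ciInf_le (Set.finite_range g).bddBelow i, (abs_le.1 (h i)).2]

theorem abs_iInf_sub_iInf_le [Finite ι] [Nonempty ι] {g k : ι → ℝ} {δ : ℝ}
    (h : ∀ i, |g i - k i| ≤ δ) : |(⨅ i, g i) - ⨅ i, k i| ≤ δ := by
  rw [abs_sub_le_iff, sub_le_comm, sub_le_comm (b := ⨅ i, g i)]
  exact ⟨iInf_sub_le_of_abs_sub_le h,
    iInf_sub_le_of_abs_sub_le fun i => by rw [abs_sub_comm]; exact h i⟩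

theorem abs_iInf_le_sum [Fintype ι] [Nonempty ι] (g : ι → ℝ) : |⨅ i, g i| ≤ ∑ i, |g i| := by
  simpa using abs_iInf_sub_iInf_le (g := g) (k := fun _ => 0) (δ := ∑ i, |g i|) fun i => by
    rw [sub_zero]
    exact Finset.single_le_sum (f := fun i => |g i|) (fun _ _ => abs_nonneg _) (Finset.mem_univ i)

/-- The signed length of the intersection of the intervals `[L_i - y_i, L_i + y_i]`; it is what
remains of `overlap L (ρ + y)` after removal of the main term `2 ρ`, as `ρ → ∞`. -/
noncomputable def centeredOverlap (L y : ι → ℝ) : ℝ :=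
  (⨅ i, (L i + y i)) + ⨅ i, (-L i + y i)

theorem abs_centeredOverlap_le [Fintype ι] [Nonempty ι] (L y : ι → ℝ) :
    |centeredOverlap L y| ≤ 2 * ∑ i, |L i| + 2 * ∑ i, |y i| := by
  have habs (L : ι → ℝ) : |⨅ i, (L i + y i)| ≤ ∑ i, |L i| + ∑ i, |y i| :=
    (abs_iInf_le_sum _).trans
      (by rw [← Finset.sum_add_distrib]; exact Finset.sum_le_sum fun i _ => abs_add_le _ _)
  have hneg := habs fun i => -L i
  simp only [abs_neg] at hneg
  unfold centeredOverlap
  linarith [habs L, abs_add_le (⨅ i, (L i + y i)) (⨅ i, (-L i + y i))]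

theorem abs_centeredOverlap_sub_le [Finite ι] [Nonempty ι] (L : ι → ℝ) {y z : ι → ℝ} {δ : ℝ}
    (h : ∀ i, |y i - z i| ≤ δ) : |centeredOverlap L y - centeredOverlap L z| ≤ 2 * δ := by
  have habs (L : ι → ℝ) : |(⨅ i, (L i + y i)) - ⨅ i, (L i + z i)| ≤ δ :=
    abs_iInf_sub_iInf_le fun i => by simpa using h i
  have hpos := abs_le.1 (habs L)
  have hneg := abs_le.1 (habs fun i => -L i)
  unfold centeredOverlap
  rw [abs_le]
  constructor <;> linarith

theorem overlap_sub_two_mul [Finite ι] [Nonempty ι] (L e : ι → ℝ) (ρ : ℝ) :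
    overlap L e - 2 * ρ = max (-(2 * ρ)) (centeredOverlap L fun i => e i - ρ) := by
  have hsub (L : ι → ℝ) : (⨅ i, (L i + (e i - ρ))) = (⨅ i, (L i + e i)) - ρ := by
    rw [sub_eq_add_neg, ciInf_add (Set.finite_range _).bddBelow]
    simp only [sub_eq_add_neg, add_assoc]
  rw [overlap, centeredOverlap, hsub L, hsub fun i => -L i, ← max_sub_sub_right]
  congr 1 <;> ring

theorem overlap_eq_zero [Finite ι] (L : ι → ℝ) {e : ι → ℝ} {i : ι} (hi : e i ≤ 0) :
    overlap L e = 0 := by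
  refine max_eq_left ?_
  linarith [ciInf_le (Set.finite_range fun i => L i + e i).bddBelow i,
    ciInf_le (Set.finite_range fun i => -L i + e i).bddBelow i]

theorem abs_overlap_sub_le [Fintype ι] [Nonempty ι] (L : ι → ℝ) {e y : ι → ℝ} {ρ δ : ℝ}
    (hρ : 0 ≤ ρ) (h : ∀ i, |e i - (ρ + y i)| ≤ δ) :
    |overlap L e - 2 * ρ| ≤ 2 * ∑ i, |L i| + 2 * ∑ i, |y i| + 2 * δ := by
  have hmax : |max (-(2 * ρ)) (centeredOverlap L fun i => e i - ρ)| ≤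
      |centeredOverlap L fun i => e i - ρ| := by
    refine abs_le.2 ⟨(neg_abs_le _).trans (le_max_right _ _), max_le ?_ (le_abs_self _)⟩
    exact (by linarith : -(2 * ρ) ≤ 0).trans (abs_nonneg _)
  have hdist := abs_centeredOverlap_sub_le L (y := fun i => e i - ρ) (z := y) (δ := δ)
    fun i => by simpa only [sub_sub] using h i
  rw [overlap_sub_two_mul]
  linarith [abs_centeredOverlap_le L y,
    abs_sub_abs_le_abs_sub (centeredOverlap L fun i => e i - ρ) (centeredOverlap L y)]

theorem tendsto_overlap_sub [Finite ι] [Nonempty ι] {κ : Type*} {l : Filter κ} (L : ι → ℝ)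
    {e : κ → ι → ℝ} {y : ι → ℝ} {ρ δ : κ → ℝ} (hρ : Tendsto ρ l atTop) (hδ : Tendsto δ l (𝓝 0))
    (h : ∀ᶠ N in l, ∀ i, |e N i - (ρ N + y i)| ≤ δ N) :
    Tendsto (fun N => overlap L (e N) - 2 * ρ N) l (𝓝 (centeredOverlap L y)) := by
  have hcentered : Tendsto (fun N => centeredOverlap L fun i => e N i - ρ N) l
      (𝓝 (centeredOverlap L y)) := by
    rw [tendsto_iff_dist_tendsto_zero]
    refine squeeze_zero' (Eventually.of_forall fun _ => dist_nonneg) ?_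
      (by simpa using hδ.const_mul 2)
    filter_upwards [h] with N hN
    exact abs_centeredOverlap_sub_le L fun i => by simpa only [sub_sub] using hN i
  have hbot : Tendsto (fun N => -(2 * ρ N)) l atBot :=
    tendsto_neg_atTop_atBot.comp (hρ.const_mul_atTop two_pos)
  refine hcentered.congr' ?_
  filter_upwards [hcentered.eventually (lt_mem_nhds (sub_one_lt (centeredOverlap L y))),
    hbot.eventually (eventually_le_atBot (centeredOverlap L y - 1))] with N hN hN'
  rw [overlap_sub_two_mul, max_eq_right (by linarith)]

@[fun_prop]
theorem measurable_overlap {X : Type*} [MeasurableSpace X] [Countable ι] {L e : X → ι → ℝ}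
    (hL : ∀ i, Measurable fun x => L x i) (he : ∀ i, Measurable fun x => e x i) :
    Measurable fun x => overlap (L x) (e x) := by
  unfold overlap
  exact measurable_const.max ((Measurable.iInf fun i => (hL i).add (he i)).add
    (Measurable.iInf fun i => (hL i).neg.add (he i)))

end Overlap

/-! ### Convergence of the truncated traces -/

section BlockVariables

variable {m : ℕ} (c : Composition (m + 1))

instance nonempty_fin_length : Nonempty (Fin c.length) :=
  ⟨⟨0, c.length_pos_of_pos m.succ_pos⟩⟩

/-- The frequencies `u_1 + ⋯ + u_{m_1 + ⋯ + m_i}` attached to the blocks of a composition, as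
functions of the coordinates `zeroSum` on the hyperplane. -/
noncomputable def blockFreqs (v : Fin m → ℝ) (i : Fin c.length) : ℝ :=
  blockSum c (zeroSum (n := m + 1) v) i

/-- The variables `x_1, …, x_ℓ` attached to the blocks of a composition of length `ℓ`. -/
def blockVars (x : Fin (m + 1) → ℝ) (i : Fin c.length) : ℝ :=
  x (Fin.castLE c.length_le i)

@[fun_prop]
theorem measurable_blockFreqs (i : Fin c.length) :
    Measurable fun v : Fin m → ℝ => blockFreqs c v i := by
  unfold blockFreqs blockSum
  exact (by fun_prop : Continuous _).measurable

@[fun_prop]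
theorem measurable_blockVars (i : Fin c.length) : Measurable fun x => blockVars c x i :=
  measurable_pi_apply _

theorem abs_blockFreqs_le (v : Fin m → ℝ) (i : Fin c.length) :
    |blockFreqs c v i| ≤ (m + 1) * ∑ j, |v j| := by
  unfold blockFreqs blockSum
  calc |∑ j : Fin (m + 1) with j.val < c.sizeUpTo (i.val + 1), zeroSum (n := m + 1) v j|
      ≤ ∑ j : Fin (m + 1) with j.val < c.sizeUpTo (i.val + 1), |zeroSum (n := m + 1) v j| :=
        Finset.abs_sum_le_sum_abs _ _
    _ ≤ ∑ j : Fin (m + 1), |zeroSum (n := m + 1) v j| :=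
        Finset.sum_le_sum_of_subset_of_nonneg (Finset.filter_subset _ _)
          fun _ _ _ => abs_nonneg _
    _ ≤ ∑ _j : Fin (m + 1), ∑ j, |v j| := Finset.sum_le_sum fun j _ => abs_zeroSum_le v j
    _ = (m + 1) * ∑ j, |v j| := by simp

theorem sum_abs_blockFreqs_le (v : Fin m → ℝ) :
    ∑ i, |blockFreqs c v i| ≤ (m + 1) ^ 2 * ∑ j, |v j| := by
  calc ∑ i, |blockFreqs c v i|
      ≤ ∑ _i : Fin c.length, (m + 1) * ∑ j, |v j| :=
        Finset.sum_le_sum fun i _ => abs_blockFreqs_le c v i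
    _ = c.length * ((m + 1) * ∑ j, |v j|) := by simp
    _ ≤ (m + 1) * ((m + 1) * ∑ j, |v j|) := by
        gcongr
        exact_mod_cast c.length_le
    _ = (m + 1) ^ 2 * ∑ j, |v j| := by ring

theorem sum_abs_blockVars_le (x : Fin (m + 1) → ℝ) : ∑ i, |blockVars c x i| ≤ ∑ i, |x i| := by
  classical
  simp only [blockVars]
  rw [← Finset.sum_image (f := fun i => |x i|) (s := Finset.univ)
    (g := Fin.castLE c.length_le) (Fin.castLE_injective c.length_le).injOn]
  exact Finset.sum_le_sum_of_subset_of_nonneg (Finset.subset_univ _) fun _ _ _ => abs_nonneg _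

/-- The weight of linear growth which dominates the integrands over frequencies and positions. -/
noncomputable def linearWeight (p : (Fin m → ℝ) × (Fin (m + 1) → ℝ)) : ℝ :=
  1 + ∑ j, |p.1 j| + ∑ i, |p.2 i|

theorem sum_abs_blocks_le_linearWeight (t : ℝ) (p : (Fin m → ℝ) × (Fin (m + 1) → ℝ)) :
    1 + ∑ i, |blockFreqs c p.1 i| + ∑ i, |t * blockVars c p.2 i| ≤
      ((m + 1) ^ 2 + |t|) * linearWeight p := by
  have hvars : ∑ i, |t * blockVars c p.2 i| ≤ |t| * ∑ i, |p.2 i| := by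
    simp only [abs_mul, ← Finset.mul_sum]
    exact mul_le_mul_of_nonneg_left (sum_abs_blockVars_le c p.2) (abs_nonneg t)
  have hone : (1 : ℝ) ≤ (m + 1) ^ 2 := one_le_pow₀ (by simp)
  have hfst : 0 ≤ |t| * ∑ j, |p.1 j| := by positivity
  have hsnd : 0 ≤ ((m : ℝ) + 1) ^ 2 * ∑ i, |p.2 i| := by positivity
  unfold linearWeight
  linarith [sum_abs_blockFreqs_le c p.1, abs_nonneg t]

variable {A : Set ℝ} {e : ℝ → ℝ} {ρ δ t : ℝ}

/-- The positions `x ∈ ℝ^n` such that `x_1, …, x_ℓ` all lie in `A`. -/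
def retained (A : Set ℝ) : Set (Fin (m + 1) → ℝ) := {x | ∀ i, blockVars c x i ∈ A}

theorem measurableSet_retained (hA : MeasurableSet A) : MeasurableSet (retained c A) := by
  rw [retained, Set.ofPred_forall]
  exact MeasurableSet.iInter fun i => measurable_blockVars c i hA

theorem measureReal_retained (μ : Measure ℝ) [IsProbabilityMeasure μ] (A : Set ℝ) :
    (Measure.pi fun _ : Fin (m + 1) => μ).real (retained c A) = μ.real A ^ c.length := by
  have hpi := pi_setOf_comp_injective μ (Fin.castLE_injective c.length_le) fun _ => A
  rw [measureReal_def, retained]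
  simp only [blockVars]
  rw [hpi, ENNReal.toReal_prod, Finset.prod_const, Finset.card_univ, Fintype.card_fin,
    measureReal_def]

/-- The length of the intersection of the intervals `[blockFreqs_i - e(x_i), blockFreqs_i + e(x_i)]`
minus `2 ρ`, the subtraction being carried out on retained positions only: the intersection is
empty off these, so the difference stays bounded as `ρ → ∞`. -/
noncomputable def truncatedOverlap (A : Set ℝ) (e : ℝ → ℝ) (ρ : ℝ)
    (p : (Fin m → ℝ) × (Fin (m + 1) → ℝ)) : ℝ :=
  overlap (blockFreqs c p.1) (fun i => e (blockVars c p.2 i)) -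
    2 * ρ * (retained c A).indicator 1 p.2

theorem truncatedOverlap_of_mem {p : (Fin m → ℝ) × (Fin (m + 1) → ℝ)} (hp : p.2 ∈ retained c A) :
    truncatedOverlap c A e ρ p =
      overlap (blockFreqs c p.1) (fun i => e (blockVars c p.2 i)) - 2 * ρ := by
  rw [truncatedOverlap, Set.indicator_of_mem hp, Pi.one_apply, mul_one]

theorem truncatedOverlap_of_notMem (he : ∀ x ∉ A, e x ≤ 0)
    {p : (Fin m → ℝ) × (Fin (m + 1) → ℝ)} (hp : p.2 ∉ retained c A) :
    truncatedOverlap c A e ρ p = 0 := by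
  obtain ⟨i, hi⟩ := not_forall.1 hp
  rw [truncatedOverlap, Set.indicator_of_notMem hp, overlap_eq_zero _ (i := i) (he _ hi),
    mul_zero, sub_zero]

theorem measurable_truncatedOverlap (hA : MeasurableSet A) (he : Measurable e) (ρ : ℝ) :
    Measurable (truncatedOverlap c A e ρ) := by
  have hind : Measurable ((retained c A).indicator (1 : (Fin (m + 1) → ℝ) → ℝ)) :=
    measurable_one.indicator (measurableSet_retained c hA)
  unfold truncatedOverlap
  fun_prop

theorem abs_truncatedOverlap_le (hρ : 0 ≤ ρ) (hδ : δ ≤ 1) (he : ∀ x ∉ A, e x ≤ 0)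
    (hE : ∀ x ∈ A, |e x - (ρ + t * x)| ≤ δ) (p : (Fin m → ℝ) × (Fin (m + 1) → ℝ)) :
    |truncatedOverlap c A e ρ p| ≤ 2 * ((m + 1) ^ 2 + |t|) * linearWeight p := by
  by_cases hp : p.2 ∈ retained c A
  · have hbound := abs_overlap_sub_le (blockFreqs c p.1) (y := fun i => t * blockVars c p.2 i) hρ
      fun i => hE _ (hp i)
    rw [truncatedOverlap_of_mem c hp]
    linarith [sum_abs_blocks_le_linearWeight c t p]
  · rw [truncatedOverlap_of_notMem c he hp, abs_zero]
    unfold linearWeight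
    positivity

theorem tendsto_truncatedOverlap {κ : Type*} {l : Filter κ} {A : κ → Set ℝ} {e : κ → ℝ → ℝ}
    {ρ δ : κ → ℝ} (hρ : Tendsto ρ l atTop) (hδ : Tendsto δ l (𝓝 0))
    (hE : ∀ᶠ N in l, ∀ x ∈ A N, |e N x - (ρ N + t * x)| ≤ δ N)
    {p : (Fin m → ℝ) × (Fin (m + 1) → ℝ)} (hp : ∀ᶠ N in l, p.2 ∈ retained c (A N)) :
    Tendsto (fun N => truncatedOverlap c (A N) (e N) (ρ N) p) l
      (𝓝 (centeredOverlap (blockFreqs c p.1) fun i => t * blockVars c p.2 i)) := by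
  refine (tendsto_overlap_sub (blockFreqs c p.1) (e := fun N i => e N (blockVars c p.2 i))
    hρ hδ ?_).congr' ?_
  · filter_upwards [hE, hp] with N hEN hpN i using hEN _ (hpN i)
  · filter_upwards [hp] with N hpN using (truncatedOverlap_of_mem c hpN).symm

end BlockVariables

section Integrability

variable {f : ℝ → ℝ} {m : ℕ} {μ : Measure ℝ} [IsProbabilityMeasure μ]

theorem integrable_sum_abs_eval (hμ : Integrable id μ) (κ : Type*) [Fintype κ] :
    Integrable (fun x : κ → ℝ => ∑ i, |x i|) (Measure.pi fun _ => μ) :=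
  integrable_finsetSum _ fun _ _ => (integrable_comp_eval (μ := fun _ : κ => μ) hμ).abs

theorem integrable_linearWeight_right (hμ : Integrable id μ) (v : Fin m → ℝ) :
    Integrable (fun x : Fin (m + 1) → ℝ => linearWeight (v, x)) (Measure.pi fun _ => μ) :=
  (integrable_const (1 + ∑ j, |v j|)).add (integrable_sum_abs_eval hμ _)

theorem IsH1Compact.integrable_norm_hyperplaneProd_mul_linearWeight (hf : IsH1Compact f)
    (hμ : Integrable id μ) (m : ℕ) :
    Integrable (fun p : (Fin m → ℝ) × (Fin (m + 1) → ℝ) => ‖hyperplaneProd f p.1‖ * linearWeight p)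
      (volume.prod (Measure.pi fun _ => μ)) := by
  have hnorm : Integrable fun v : Fin m → ℝ => ‖hyperplaneProd f v‖ :=
    hf.integrable_hyperplaneProd.norm
  have hfreq : Integrable fun v : Fin m → ℝ => ‖hyperplaneProd f v‖ * (1 + ∑ j, |v j|) := by
    refine (hnorm.add (integrable_finsetSum Finset.univ fun j _ =>
      hf.integrable_abs_mul_hyperplaneProd j)).congr (Eventually.of_forall fun v => ?_)
    simp only [Pi.add_apply, ← Finset.sum_mul]
    ring
  refine ((hfreq.mul_prod (integrable_const (1 : ℝ))).add
    (hnorm.mul_prod (integrable_sum_abs_eval hμ _))).congr (Eventually.of_forall fun p => ?_)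
  simp only [Pi.add_apply, linearWeight]
  ring

theorem norm_hyperplaneProd_mul_le (f : ℝ → ℝ) {G : (Fin m → ℝ) × (Fin (m + 1) → ℝ) → ℝ} {C : ℝ}
    (hG : ∀ p, |G p| ≤ C * linearWeight p) (p : (Fin m → ℝ) × (Fin (m + 1) → ℝ)) :
    ‖hyperplaneProd f p.1 * (G p : ℂ)‖ ≤ C * (‖hyperplaneProd f p.1‖ * linearWeight p) := by
  rw [norm_mul, Complex.norm_real, Real.norm_eq_abs, mul_left_comm]
  exact mul_le_mul_of_nonneg_left (hG p) (norm_nonneg _)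

theorem IsH1Compact.integrable_hyperplaneProd_mul (hf : IsH1Compact f) (hμ : Integrable id μ)
    {G : (Fin m → ℝ) × (Fin (m + 1) → ℝ) → ℝ} (hGm : Measurable G) {C : ℝ}
    (hG : ∀ p, |G p| ≤ C * linearWeight p) :
    Integrable (fun p => hyperplaneProd f p.1 * (G p : ℂ)) (volume.prod (Measure.pi fun _ => μ)) :=
  ((hf.integrable_norm_hyperplaneProd_mul_linearWeight hμ m).const_mul C).mono'
    (((hf.continuous_hyperplaneProd.measurable.comp measurable_fst).mul
      (Complex.measurable_ofReal.comp hGm)).aestronglyMeasurable)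
    (Eventually.of_forall (norm_hyperplaneProd_mul_le f hG))

end Integrability

section TruncatedIntegral

variable {f : ℝ → ℝ} {m : ℕ} (c : Composition (m + 1)) {μ : Measure ℝ} [IsProbabilityMeasure μ]
  {A : Set ℝ} {e : ℝ → ℝ} {ρ δ t : ℝ}

theorem integral_truncatedOverlap (hμ : Integrable id μ) (hA : MeasurableSet A)
    (hem : Measurable e) (hρ : 0 ≤ ρ) (hδ : δ ≤ 1) (he : ∀ x ∉ A, e x ≤ 0)
    (hE : ∀ x ∈ A, |e x - (ρ + t * x)| ≤ δ) (v : Fin m → ℝ) :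
    ∫ x, truncatedOverlap c A e ρ (v, x) ∂Measure.pi (fun _ => μ) =
      ∫ x, overlap (blockFreqs c v) (fun i => e (blockVars c x i)) ∂Measure.pi (fun _ => μ) -
        2 * ρ * μ.real A ^ c.length := by
  have htrunc : Integrable (fun x => truncatedOverlap c A e ρ (v, x)) (Measure.pi fun _ => μ) :=
    ((integrable_linearWeight_right hμ v).const_mul (2 * ((m + 1) ^ 2 + |t|))).mono'
      ((measurable_truncatedOverlap c hA hem ρ).comp measurable_prodMk_left).aestronglyMeasurable
      (Eventually.of_forall fun x => abs_truncatedOverlap_le c hρ hδ he hE (v, x))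
  have hind : Integrable (fun x => 2 * ρ * (retained c A).indicator 1 x)
      (Measure.pi fun _ => μ) :=
    ((integrable_indicator_iff (measurableSet_retained c hA)).2
      (integrable_const (1 : ℝ)).integrableOn).const_mul _
  have hsplit (x : Fin (m + 1) → ℝ) : overlap (blockFreqs c v) (fun i => e (blockVars c x i)) =
      truncatedOverlap c A e ρ (v, x) + 2 * ρ * (retained c A).indicator 1 x :=
    (sub_add_cancel _ _).symm
  simp only [hsplit]
  rw [integral_add htrunc hind, integral_const_mul,
    integral_indicator_one (measurableSet_retained c hA), measureReal_retained,
    add_sub_cancel_right]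

theorem IsH1Compact.integral_hyperplaneProd_mul_truncatedOverlap (hf : IsH1Compact f)
    (hμ : Integrable id μ) (hA : MeasurableSet A) (hem : Measurable e) (hρ : 0 ≤ ρ) (hδ : δ ≤ 1)
    (he : ∀ x ∉ A, e x ≤ 0) (hE : ∀ x ∈ A, |e x - (ρ + t * x)| ≤ δ) :
    ∫ p, hyperplaneProd f p.1 * (truncatedOverlap c A e ρ p : ℂ)
        ∂volume.prod (Measure.pi fun _ => μ) =
      (∫ v : Fin m → ℝ, hyperplaneProd f v *
        ((∫ x, overlap (blockFreqs c v) (fun i => e (blockVars c x i))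
          ∂Measure.pi (fun _ => μ) : ℝ) : ℂ)) -
        (2 * ρ * μ.real A ^ c.length : ℝ) * ∫ v : Fin m → ℝ, hyperplaneProd f v := by
  have hinteg := hf.integrable_hyperplaneProd_mul hμ (measurable_truncatedOverlap c hA hem ρ)
    (abs_truncatedOverlap_le c hρ hδ he hE)
  have hinner (v : Fin m → ℝ) : ∫ x, hyperplaneProd f v * (truncatedOverlap c A e ρ (v, x) : ℂ)
        ∂Measure.pi (fun _ => μ) =
      hyperplaneProd f v * ((∫ x, overlap (blockFreqs c v) (fun i => e (blockVars c x i))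
          ∂Measure.pi (fun _ => μ) : ℝ) : ℂ) -
        (2 * ρ * μ.real A ^ c.length : ℝ) * hyperplaneProd f v := by
    rw [integral_const_mul, integral_complex_ofReal,
      integral_truncatedOverlap c hμ hA hem hρ hδ he hE v, Complex.ofReal_sub, mul_sub,
      mul_comm (hyperplaneProd f v) ((2 * ρ * μ.real A ^ c.length : ℝ) : ℂ)]
  have hmain := hf.integrable_hyperplaneProd (m := m) |>.const_mul
    ((2 * ρ * μ.real A ^ c.length : ℝ) : ℂ)
  have houter := hinteg.integral_prod_left
  rw [integral_prod _ hinteg]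
  simp only [hinner] at houter ⊢
  rw [integral_sub (by simpa only [Pi.add_def, sub_add_cancel] using houter.add hmain) hmain,
    integral_const_mul]

end TruncatedIntegral

theorem tendsto_mul_one_sub_pow {κ : Type*} {l : Filter κ} {ρ q : κ → ℝ} (hρ : ∀ᶠ N in l, 0 ≤ ρ N)
    (hq0 : ∀ N, 0 ≤ q N) (hq1 : ∀ N, q N ≤ 1)
    (h : Tendsto (fun N => ρ N * (1 - q N)) l (𝓝 0)) (k : ℕ) :
    Tendsto (fun N => ρ N * (1 - q N ^ k)) l (𝓝 0) := by
  refine squeeze_zero' ?_ ?_ (by simpa using h.const_mul (k : ℝ))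
  · filter_upwards [hρ] with N hN
    exact mul_nonneg hN (sub_nonneg.2 (pow_le_one₀ (hq0 N) (hq1 N)))
  · filter_upwards [hρ] with N hN
    have hbernoulli := one_add_mul_le_pow (a := q N - 1) (by linarith [hq0 N]) k
    rw [add_sub_cancel] at hbernoulli
    rw [mul_left_comm]
    exact mul_le_mul_of_nonneg_left (by linarith) hN

section Convergence

variable {f : ℝ → ℝ} {m : ℕ} (c : Composition (m + 1)) {μ : Measure ℝ} [IsProbabilityMeasure μ]
  {κ : Type*} {l : Filter κ} {A : κ → Set ℝ} {e : κ → ℝ → ℝ} {ρ δ : κ → ℝ} {t : ℝ}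

theorem ae_eventually_mem_retained (hmem : ∀ᵐ x ∂μ, ∀ᶠ N in l, x ∈ A N) :
    ∀ᵐ p ∂(volume : Measure (Fin m → ℝ)).prod (Measure.pi fun _ : Fin (m + 1) => μ),
      ∀ᶠ N in l, p.2 ∈ retained c (A N) := by
  have hpi : ∀ᵐ x ∂Measure.pi fun _ : Fin (m + 1) => μ, ∀ i, ∀ᶠ N in l, x i ∈ A N :=
    ae_all_iff.2 fun i => (measurePreserving_eval (fun _ => μ) i).quasiMeasurePreserving.ae hmem
  filter_upwards [Measure.quasiMeasurePreserving_snd.ae hpi] with p hp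
  exact eventually_all.2 fun i => hp _

variable [l.IsCountablyGenerated]

theorem IsH1Compact.tendsto_integral_truncatedOverlap (hf : IsH1Compact f) (hμ : Integrable id μ)
    (hA : ∀ N, MeasurableSet (A N)) (hem : ∀ N, Measurable (e N)) (he : ∀ N, ∀ x ∉ A N, e N x ≤ 0)
    (hρ : Tendsto ρ l atTop) (hδ : Tendsto δ l (𝓝 0))
    (hE : ∀ᶠ N in l, ∀ x ∈ A N, |e N x - (ρ N + t * x)| ≤ δ N)
    (hmem : ∀ᵐ x ∂μ, ∀ᶠ N in l, x ∈ A N) :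
    Tendsto (fun N => ∫ p, hyperplaneProd f p.1 * (truncatedOverlap c (A N) (e N) (ρ N) p : ℂ)
        ∂volume.prod (Measure.pi fun _ => μ)) l
      (𝓝 (∫ p, hyperplaneProd f p.1 * ((centeredOverlap (blockFreqs c p.1)
        fun i => t * blockVars c p.2 i : ℝ) : ℂ) ∂volume.prod (Measure.pi fun _ => μ))) := by
  have hbound : ∀ᶠ N in l, ∀ p, |truncatedOverlap c (A N) (e N) (ρ N) p| ≤
      2 * ((m + 1) ^ 2 + |t|) * linearWeight p := by
    filter_upwards [hE, hδ.eventually (ge_mem_nhds one_pos), hρ.eventually_ge_atTop 0]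
      with N hEN hδN hρN using abs_truncatedOverlap_le c hρN hδN (he N) hEN
  refine tendsto_integral_filter_of_dominated_convergence
    (fun p => 2 * ((m + 1) ^ 2 + |t|) * (‖hyperplaneProd f p.1‖ * linearWeight p)) ?_ ?_
    ((hf.integrable_norm_hyperplaneProd_mul_linearWeight hμ m).const_mul _) ?_
  · filter_upwards [hbound] with N hN
    exact (hf.integrable_hyperplaneProd_mul hμ
      (measurable_truncatedOverlap c (hA N) (hem N) _) hN).aestronglyMeasurable
  · filter_upwards [hbound] with N hN
    exact Eventually.of_forall (norm_hyperplaneProd_mul_le f hN)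
  · filter_upwards [ae_eventually_mem_retained c hmem] with p hp
    exact ((Complex.continuous_ofReal.tendsto _).comp
      (tendsto_truncatedOverlap c hρ hδ hE hp)).const_mul _

theorem IsH1Compact.tendsto_integral_overlap (hf : IsH1Compact f) (hμ : Integrable id μ)
    (hA : ∀ N, MeasurableSet (A N)) (hem : ∀ N, Measurable (e N)) (he : ∀ N, ∀ x ∉ A N, e N x ≤ 0)
    (hρ : Tendsto ρ l atTop) (hδ : Tendsto δ l (𝓝 0))
    (hE : ∀ᶠ N in l, ∀ x ∈ A N, |e N x - (ρ N + t * x)| ≤ δ N)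
    (hmem : ∀ᵐ x ∂μ, ∀ᶠ N in l, x ∈ A N)
    (hmass : Tendsto (fun N => ρ N * (1 - μ.real (A N))) l (𝓝 0)) :
    Tendsto (fun N => (∫ v : Fin m → ℝ, hyperplaneProd f v *
        ((∫ x, overlap (blockFreqs c v) (fun i => e N (blockVars c x i))
          ∂Measure.pi (fun _ => μ) : ℝ) : ℂ)) - 2 * ρ N * ∫ v : Fin m → ℝ, hyperplaneProd f v) l
      (𝓝 (∫ p, hyperplaneProd f p.1 * ((centeredOverlap (blockFreqs c p.1)
        fun i => t * blockVars c p.2 i : ℝ) : ℂ) ∂volume.prod (Measure.pi fun _ => μ))) := by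
  have hρ0 : ∀ᶠ N in l, 0 ≤ ρ N := hρ.eventually_ge_atTop 0
  have herror : Tendsto (fun N => ((2 * (ρ N * (1 - μ.real (A N) ^ c.length)) : ℝ) : ℂ) *
      ∫ v : Fin m → ℝ, hyperplaneProd f v) l (𝓝 0) := by
    have hpow := tendsto_mul_one_sub_pow hρ0 (fun _ => measureReal_nonneg)
      (fun _ => measureReal_le_one) hmass c.length
    simpa using ((Complex.continuous_ofReal.tendsto _).comp (hpow.const_mul 2)).mul_const
      (∫ v : Fin m → ℝ, hyperplaneProd f v)
  have hlim := (hf.tendsto_integral_truncatedOverlap c hμ hA hem he hρ hδ hE hmem).sub herror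
  rw [sub_zero] at hlim
  refine hlim.congr' ?_
  filter_upwards [hE, hδ.eventually (ge_mem_nhds one_pos), hρ0] with N hEN hδN hρN
  rw [hf.integral_hyperplaneProd_mul_truncatedOverlap c hμ (hA N) (hem N) hρN hδN (he N) hEN]
  push_cast
  ring

end Convergence

/-! ### The limit of the kernel cumulants -/

theorem kernelL_eq_sum {Ψ : ℝ → ℝ} {α τ N : ℝ} {ξ : ℤ → ℝ} (hξ : IsMeanValueChoice Ψ α τ N ξ)
    (Γ : ℝ) (η : ℤ → ℝ) (x y : ℝ) :
    kernelL Ψ α τ Γ η ξ N x y =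
      ∑ k ∈ Finset.Icc (-⌊Γ * N ^ α⌋) ⌊Γ * N ^ α⌋,
        (Ψ (k / (τ * N ^ α)) - Ψ ((k + 1) / (τ * N ^ α))) * sineKernel (η k) (x - y) := by
  rw [kernelL, Finset.mul_sum]
  refine Finset.sum_congr rfl fun k _ => ?_
  rw [← (hξ k).2, mul_assoc]

theorem IsH1Compact.compTrace_eq_integral_overlap {f : ℝ → ℝ} (hf : IsH1Compact f)
    {μ : Measure ℝ} [IsProbabilityMeasure μ] {a : ℝ} {M : ℤ} {η : ℤ → ℝ}
    (hη : ∀ k ∈ Finset.Icc (-M) M, 0 ≤ η k) {K : ℝ → ℝ → ℝ}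
    (hK : ∀ x y, K x y = ∑ k ∈ Finset.Icc (-M) M,
      μ.real {x | ⌊a * x⌋ = k} * sineKernel (η k) (x - y))
    {m : ℕ} (c : Composition (m + 1)) :
    (compTrace K f c : ℂ) = ∫ v : Fin m → ℝ, hyperplaneProd f v *
        ((∫ x, overlap (blockFreqs c v) (fun i => cutoffEta a M η (blockVars c x i))
          ∂Measure.pi (fun _ => μ) : ℝ) : ℂ) := by
  have hw : Integrable (cutoffMultiplier μ a M η) := integrable_cutoffMultiplier μ a M η
  rw [hf.compTrace_eq c hw fun x y => by rw [hK]; exact sum_sineKernel_eq_integral μ a M hη _,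
    integral_prod_symm _ (hf.integrable_prod_mul_hyperplaneProd c hw)]
  refine integral_congr_ae (Eventually.of_forall fun v => ?_)
  simp only
  rw [integral_mul_const, integral_complex_ofReal, mul_comm]
  congr 2
  exact integral_prod_cutoffMultiplier μ a M η (Fin.castLE_injective c.length_le) (blockFreqs c v)

/-- The growth conditions of `GrowthConditions` for arbitrary functions `η_N`: the asymptotics that
determine the limits of the cumulants. -/
structure CutoffConditions (Ψ : ℝ → ℝ) (α τ ν β ε : ℝ) (Γ : ℝ → ℝ) (η : ℝ → ℤ → ℝ) : Prop where
  cutoff_pos : ∀ N, 0 < N → 0 < Γ N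
  cutoff_small : Tendsto (fun N : ℝ => Γ N / N ^ ν) atTop (𝓝 0)
  expansion : ∃ C N₀ : ℝ, ∀ N ≥ N₀, ∀ k : ℤ, |(k : ℝ)| ≤ Γ N * N ^ α →
    |η N k - (N ^ ν + β * k * N ^ (-α))| ≤ C * N ^ (-ε)
  tails : Tendsto (fun N : ℝ => N ^ ν *
    max (Ψ (Γ N / τ)) (1 - Ψ (-(⌊Γ N * N ^ α⌋ : ℝ) / (τ * N ^ α)))) atTop (𝓝 0)

section Growth

variable {Ψ : ℝ → ℝ} {α τ ν β ε : ℝ} {Γ : ℝ → ℝ} {η : ℝ → ℤ → ℝ}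

theorem GrowthConditions.cutoffConditions (hη : GrowthConditions Ψ α τ ν β ε Γ η) :
    CutoffConditions Ψ α τ ν β ε Γ η :=
  ⟨hη.cutoff_pos, hη.cutoff_small, hη.expansion, hη.tails⟩

theorem abs_le_of_mem_Icc_floor {r : ℝ} {k : ℤ} (hk : k ∈ Finset.Icc (-⌊r⌋) ⌊r⌋) :
    |(k : ℝ)| ≤ r := by
  rw [Finset.mem_Icc, ← abs_le] at hk
  exact_mod_cast (Int.cast_le.2 hk).trans (Int.floor_le r)

namespace CutoffConditions

theorem abs_mul_rpow_neg_le {N : ℝ} (hN : 0 < N) {k : ℤ} (hk : |(k : ℝ)| ≤ Γ N * N ^ α) :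
    |(k : ℝ) * N ^ (-α)| ≤ Γ N := by
  rwa [Real.rpow_neg hN.le, ← div_eq_mul_inv, abs_div,
    abs_of_pos (Real.rpow_pos_of_pos hN α), div_le_iff₀ (Real.rpow_pos_of_pos hN α)]

theorem eventually_nonneg (hη : CutoffConditions Ψ α τ ν β ε Γ η) (hν : 0 < ν) (hε : 0 < ε) :
    ∀ᶠ N in atTop, ∀ k ∈ Finset.Icc (-⌊Γ N * N ^ α⌋) ⌊Γ N * N ^ α⌋, 0 ≤ η N k := by
  obtain ⟨C, N₀, hC⟩ := hη.expansion
  have herror : Tendsto (fun N : ℝ => C * N ^ (-ε)) atTop (𝓝 0) := by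
    simpa using (tendsto_rpow_neg_atTop hε).const_mul C
  have hcutoff : Tendsto (fun N : ℝ => |β| * (Γ N / N ^ ν)) atTop (𝓝 0) := by
    simpa using hη.cutoff_small.const_mul |β|
  filter_upwards [eventually_ge_atTop N₀, eventually_gt_atTop 0,
    herror.eventually (gt_mem_nhds one_pos),
    (tendsto_rpow_atTop hν).eventually (eventually_ge_atTop 2),
    hcutoff.eventually (gt_mem_nhds one_half_pos)]
    with N hNN₀ hN herrorN hpow hcutoffN k hk
  have hkΓ := abs_le_of_mem_Icc_floor hk
  have hlinear : |β * k * N ^ (-α)| ≤ |β| * Γ N := by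
    rw [mul_assoc, abs_mul]
    exact mul_le_mul_of_nonneg_left (abs_mul_rpow_neg_le hN hkΓ) (abs_nonneg β)
  rw [← mul_div_assoc, div_lt_iff₀ (by linarith)] at hcutoffN
  linarith [(abs_le.1 hlinear).1, (abs_le.1 (hC N hNN₀ k hkΓ)).1]

theorem abs_cutoffEta_sub_le {N C : ℝ} (hN : 0 < N)
    (hC : ∀ k : ℤ, |(k : ℝ)| ≤ Γ N * N ^ α →
      |η N k - (N ^ ν + β * k * N ^ (-α))| ≤ C * N ^ (-ε))
    {x : ℝ} (hx : x ∈ cutoffSet (τ * N ^ α) ⌊Γ N * N ^ α⌋) :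
    |cutoffEta (τ * N ^ α) ⌊Γ N * N ^ α⌋ (η N) x - (N ^ ν + β * τ * x)| ≤
      C * N ^ (-ε) + |β| * N ^ (-α) := by
  rw [cutoffEta_of_mem _ hx]
  set k := ⌊τ * N ^ α * x⌋
  have hpow : N ^ α * N ^ (-α) = 1 := by rw [← Real.rpow_add hN, add_neg_cancel, Real.rpow_zero]
  have hrounding : |β * k * N ^ (-α) - β * τ * x| ≤ |β| * N ^ (-α) := by
    have hfloor : |(k : ℝ) - τ * N ^ α * x| ≤ 1 := by
      rw [abs_le]
      constructor <;> linarith [Int.floor_le (τ * N ^ α * x), Int.lt_floor_add_one (τ * N ^ α * x)]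
    have hfactor : β * k * N ^ (-α) - β * τ * x =
        β * N ^ (-α) * (k - τ * N ^ α * x) := by
      linear_combination β * τ * x * hpow
    rw [hfactor, abs_mul, abs_mul, abs_of_pos (Real.rpow_pos_of_pos hN (-α))]
    exact mul_le_of_le_one_right (by positivity) hfloor
  calc |η N k - (N ^ ν + β * τ * x)|
      = |(η N k - (N ^ ν + β * k * N ^ (-α))) + (β * k * N ^ (-α) - β * τ * x)| := by ring_nf
    _ ≤ C * N ^ (-ε) + |β| * N ^ (-α) :=
        (abs_add_le _ _).trans (add_le_add (hC k (abs_le_of_mem_Icc_floor hx)) hrounding)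

theorem div_le_floor_div {N : ℝ} (hN : 0 < N) (hτ : 0 < τ) :
    Γ N / τ ≤ (⌊Γ N * N ^ α⌋ + 1) / (τ * N ^ α) := by
  rw [div_le_div_iff₀ hτ (mul_pos hτ (Real.rpow_pos_of_pos hN α)), mul_left_comm, mul_comm _ τ]
  exact mul_le_mul_of_nonneg_left (Int.lt_floor_add_one _).le hτ.le

theorem floor_nonneg (hη : CutoffConditions Ψ α τ ν β ε Γ η) {N : ℝ} (hN : 0 < N) :
    0 ≤ ⌊Γ N * N ^ α⌋ :=
  Int.floor_nonneg.2 (mul_nonneg (hη.cutoff_pos N hN).le (Real.rpow_nonneg hN.le _))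

theorem one_sub_measureReal_cutoffSet_le (hη : CutoffConditions Ψ α τ ν β ε Γ η)
    (hΨ : IsSurvivalFunction Ψ) (hτ : 0 < τ) {N : ℝ} (hN : 0 < N) :
    1 - (shapeMeasure Ψ).real (cutoffSet (τ * N ^ α) ⌊Γ N * N ^ α⌋) ≤
      2 * max (Ψ (Γ N / τ)) (1 - Ψ (-(⌊Γ N * N ^ α⌋ : ℝ) / (τ * N ^ α))) := by
  rw [hΨ.measureReal_cutoffSet (mul_pos hτ (Real.rpow_pos_of_pos hN α)) (hη.floor_nonneg hN),
    two_mul]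
  linarith [hΨ.antitone (div_le_floor_div (Γ := Γ) (α := α) hN hτ),
    le_max_left (Ψ (Γ N / τ)) (1 - Ψ (-(⌊Γ N * N ^ α⌋ : ℝ) / (τ * N ^ α))),
    le_max_right (Ψ (Γ N / τ)) (1 - Ψ (-(⌊Γ N * N ^ α⌋ : ℝ) / (τ * N ^ α)))]

theorem tendsto_mass (hη : CutoffConditions Ψ α τ ν β ε Γ η) (hΨ : IsSurvivalFunction Ψ)
    (hτ : 0 < τ) :
    Tendsto (fun N : ℝ => N ^ ν * (1 - (shapeMeasure Ψ).real
      (cutoffSet (τ * N ^ α) ⌊Γ N * N ^ α⌋))) atTop (𝓝 0) := by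
  have := hΨ.isProbabilityMeasure
  refine squeeze_zero' ?_ ?_ (by simpa using hη.tails.const_mul 2)
  · filter_upwards [eventually_gt_atTop 0] with N hN
    exact mul_nonneg (Real.rpow_nonneg hN.le _) (sub_nonneg.2 measureReal_le_one)
  · filter_upwards [eventually_gt_atTop 0] with N hN
    rw [mul_left_comm]
    exact mul_le_mul_of_nonneg_left (hη.one_sub_measureReal_cutoffSet_le hΨ hτ hN)
      (Real.rpow_nonneg hN.le _)

theorem mem_cutoffSet_of_lt (hΨ : Antitone Ψ) (hτ : 0 < τ) {N x : ℝ} (hN : 0 < N)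
    (hupper : Ψ (Γ N / τ) < Ψ x) (hlower : Ψ x < Ψ (-(⌊Γ N * N ^ α⌋ : ℝ) / (τ * N ^ α))) :
    x ∈ cutoffSet (τ * N ^ α) ⌊Γ N * N ^ α⌋ := by
  have ha : 0 < τ * N ^ α := mul_pos hτ (Real.rpow_pos_of_pos hN α)
  have hxle := (hΨ.reflect_lt hupper).trans_le (div_le_floor_div (α := α) hN hτ)
  have hlex := hΨ.reflect_lt hlower
  rw [div_lt_iff₀ ha, mul_comm x] at hlex
  rw [lt_div_iff₀ ha, mul_comm x] at hxle
  rw [cutoffSet, Set.mem_ofPred_eq, Finset.mem_Icc, Int.le_floor, ← Int.lt_add_one_iff,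
    Int.floor_lt]
  push_cast
  exact ⟨hlex.le, hxle⟩

theorem eventually_mem_cutoffSet (hη : CutoffConditions Ψ α τ ν β ε Γ η)
    (hΨ : IsSurvivalFunction Ψ) (hτ : 0 < τ) (hν : 0 < ν) {x : ℝ} (hx : 0 < shapeDensity Ψ x) :
    ∀ᶠ N in atTop, x ∈ cutoffSet (τ * N ^ α) ⌊Γ N * N ^ α⌋ := by
  have hpos : 0 < Ψ x := (hΨ.mem_Icc x).1.lt_of_ne'
    fun hzero => hx.ne' (hΨ.density_eq_zero_of_eq_zero hzero)
  have hlt : Ψ x < 1 := (hΨ.mem_Icc x).2.lt_of_ne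
    fun hone => hx.ne' (hΨ.density_eq_zero_of_eq_one hone)
  filter_upwards [eventually_gt_atTop 0, (tendsto_rpow_atTop hν).eventually (eventually_ge_atTop 1),
    hη.tails.eventually (gt_mem_nhds (lt_min hpos (sub_pos.2 hlt)))] with N hN hone htails
  have htail := (le_mul_of_one_le_left ((hΨ.mem_Icc _).1.trans (le_max_left _ _)) hone).trans_lt
    htails
  rw [max_lt_iff, lt_min_iff, lt_min_iff] at htail
  exact mem_cutoffSet_of_lt hΨ.antitone hτ hN htail.1.1 (by linarith [htail.2.2])

theorem tendsto_compTrace (hη : CutoffConditions Ψ α τ ν β ε Γ η) (hΨ : IsSurvivalFunction Ψ)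
    (hα : 0 < α) (hτ : 0 < τ) (hν : 0 < ν) (hε : 0 < ε) {ξ : ℝ → ℤ → ℝ}
    (hξ : ∀ N, 0 < N → IsMeanValueChoice Ψ α τ N (ξ N)) {f : ℝ → ℝ} (hf : IsH1Compact f) {m : ℕ}
    (c : Composition (m + 1)) :
    Tendsto (fun N : ℝ => (compTrace (kernelL Ψ α τ (Γ N) (η N) (ξ N) N) f c : ℂ) -
        2 * (N ^ ν : ℝ) * ∫ v : Fin m → ℝ, hyperplaneProd f v) atTop
      (𝓝 (∫ p, hyperplaneProd f p.1 * ((centeredOverlap (blockFreqs c p.1)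
        fun i => β * τ * blockVars c p.2 i : ℝ) : ℂ)
          ∂volume.prod (Measure.pi fun _ => shapeMeasure Ψ))) := by
  have := hΨ.isProbabilityMeasure
  obtain ⟨C, N₀, hC⟩ := hη.expansion
  have hδ : Tendsto (fun N : ℝ => C * N ^ (-ε) + |β| * N ^ (-α)) atTop (𝓝 0) := by
    simpa using ((tendsto_rpow_neg_atTop hε).const_mul C).add
      ((tendsto_rpow_neg_atTop hα).const_mul |β|)
  have hE : ∀ᶠ N in atTop, ∀ x ∈ cutoffSet (τ * N ^ α) ⌊Γ N * N ^ α⌋,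
      |cutoffEta (τ * N ^ α) ⌊Γ N * N ^ α⌋ (η N) x - (N ^ ν + β * τ * x)| ≤
        C * N ^ (-ε) + |β| * N ^ (-α) := by
    filter_upwards [eventually_ge_atTop N₀, eventually_gt_atTop 0] with N hNN₀ hN x hx
    exact abs_cutoffEta_sub_le hN (hC N hNN₀) hx
  refine (hf.tendsto_integral_overlap c hΨ.integrable_id
    (A := fun N => cutoffSet (τ * N ^ α) ⌊Γ N * N ^ α⌋)
    (e := fun N => cutoffEta (τ * N ^ α) ⌊Γ N * N ^ α⌋ (η N))
    (fun N => measurableSet_cutoffSet _ _) (fun N => measurable_cutoffEta _ _ _)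
    (fun N x hx => (cutoffEta_of_notMem _ hx).trans_le (by norm_num)) (tendsto_rpow_atTop hν) hδ hE
    ((ae_shapeDensity_pos Ψ).mono fun x => hη.eventually_mem_cutoffSet hΨ hτ hν)
    (hη.tendsto_mass hΨ hτ)).congr' ?_
  filter_upwards [eventually_gt_atTop 0, hη.eventually_nonneg hν hε] with N hN hnonneg
  have ha : 0 < τ * N ^ α := mul_pos hτ (Real.rpow_pos_of_pos hN _)
  rw [hf.compTrace_eq_integral_overlap (μ := shapeMeasure Ψ) hnonneg (fun x y => ?_) c]
  simp only [kernelL_eq_sum (hξ N hN), hΨ.measureReal_cell ha]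

/-- The traces diverge at the rate `2 N^ν ∫ f^n`, which does not depend on the composition and
drops out of the cumulant because the weights sum to zero. -/
theorem tendsto_kernelCumulant (hη : CutoffConditions Ψ α τ ν β ε Γ η)
    (hΨ : IsSurvivalFunction Ψ) (hα : 0 < α) (hτ : 0 < τ) (hν : 0 < ν) (hε : 0 < ε)
    {ξ : ℝ → ℤ → ℝ} (hξ : ∀ N, 0 < N → IsMeanValueChoice Ψ α τ N (ξ N)) {f : ℝ → ℝ}
    (hf : IsH1Compact f) {m : ℕ} (hzero : ∑ c : Composition (m + 1), compWeight c = 0) :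
    Tendsto (fun N =>
        (kernelCumulant (kernelL Ψ α τ (Γ N) (η N) (ξ N) N) f (m + 1) : ℂ)) atTop
      (𝓝 (∑ c : Composition (m + 1), (compWeight c : ℂ) *
        ∫ p, hyperplaneProd f p.1 * ((centeredOverlap (blockFreqs c p.1)
          fun i => β * τ * blockVars c p.2 i : ℝ) : ℂ)
            ∂volume.prod (Measure.pi fun _ => shapeMeasure Ψ))) := by
  have hzero' : ∑ c : Composition (m + 1), (compWeight c : ℂ) = 0 := by exact_mod_cast hzero
  refine (tendsto_finsetSum Finset.univ fun c _ => (hη.tendsto_compTrace hΨ hα hτ hν hε hξ hf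
    c).const_mul (compWeight c : ℂ)).congr fun N => ?_
  simp only [mul_sub, Finset.sum_sub_distrib, ← Finset.sum_mul, hzero', zero_mul, sub_zero]
  rw [kernelCumulant]
  push_cast
  rfl

end CutoffConditions

end Growth

/-! ### The coefficients `B^n_Ψ` -/

namespace IsSurvivalFunction

variable {Ψ : ℝ → ℝ}

theorem measure_Ici (h : IsSurvivalFunction Ψ) (t : ℝ) :
    shapeMeasure Ψ (Set.Ici t) = ENNReal.ofReal (Ψ t) := by
  rw [← h.measure_Ioi t, measure_congr (Ioi_ae_eq_Ici (μ := shapeMeasure Ψ) (a := t))]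

theorem pow_mul_density_nonneg (h : IsSurvivalFunction Ψ) (k : ℕ) (x : ℝ) :
    0 ≤ (k + 1) * Ψ x ^ k * shapeDensity Ψ x :=
  mul_nonneg (mul_nonneg (by positivity) (pow_nonneg (h.mem_Icc x).1 _)) (h.density_nonneg x)

theorem integrable_pow_mul_density (h : IsSurvivalFunction Ψ) (k : ℕ) :
    Integrable fun x => (k + 1) * Ψ x ^ k * shapeDensity Ψ x := by
  refine h.integrable_density.bdd_mul (c := k + 1) ?_ (Eventually.of_forall fun x => ?_)
  · have := h.differentiable.continuous
    fun_prop
  · obtain ⟨hnonneg, hle⟩ := h.mem_Icc x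
    rw [norm_mul, norm_pow, Real.norm_of_nonneg hnonneg, Real.norm_of_nonneg (by positivity)]
    exact mul_le_of_le_one_right (by positivity) (pow_le_one₀ hnonneg hle)

theorem integral_Ioi_pow_mul_density (h : IsSurvivalFunction Ψ) (k : ℕ) (t : ℝ) :
    ∫ x in Set.Ioi t, (k + 1) * Ψ x ^ k * shapeDensity Ψ x = Ψ t ^ (k + 1) := by
  have hderiv (x : ℝ) (_ : x ∈ Set.Ici t) : HasDerivAt (fun x => -(Ψ x ^ (k + 1)))
      ((k + 1) * Ψ x ^ k * shapeDensity Ψ x) x := by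
    refine ((h.hasDerivAt x).pow (k + 1)).neg.congr_deriv ?_
    push_cast
    ring
  rw [integral_Ioi_of_hasDerivAt_of_tendsto' hderiv (h.integrable_pow_mul_density k).integrableOn
    (h.tendsto_atTop.pow (k + 1)).neg]
  simp

section Minimum

variable {κ : Type*} [Fintype κ] {k : ℕ} {g : Fin (k + 1) → κ}

theorem map_iInf_eq (h : IsSurvivalFunction Ψ) (hg : Function.Injective g) :
    (Measure.pi fun _ : κ => shapeMeasure Ψ).map (fun x => ⨅ i, x (g i)) =
      volume.withDensity fun x => ENNReal.ofReal ((k + 1) * Ψ x ^ k * shapeDensity Ψ x) := by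
  have := h.isProbabilityMeasure
  have hm : Measurable fun x : κ → ℝ => ⨅ i, x (g i) :=
    Measurable.iInf fun i => measurable_pi_apply _
  have := Measure.isProbabilityMeasure_map (μ := Measure.pi fun _ : κ => shapeMeasure Ψ)
    hm.aemeasurable
  refine Measure.ext_of_Ici _ _ fun t => ?_
  have hpreimage : (fun x : κ → ℝ => ⨅ i, x (g i)) ⁻¹' Set.Ici t =
      {x | ∀ i, x (g i) ∈ Set.Ici t} := by
    ext x
    exact le_ciInf_iff (Set.finite_range fun i => x (g i)).bddBelow
  rw [Measure.map_apply hm measurableSet_Ici, hpreimage,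
    pi_setOf_comp_injective (shapeMeasure Ψ) hg fun _ => Set.Ici t,
    withDensity_apply _ measurableSet_Ici, ← restrict_Ioi_eq_restrict_Ici,
    ← ofReal_integral_eq_lintegral_ofReal (h.integrable_pow_mul_density k).integrableOn
      (Eventually.of_forall (h.pow_mul_density_nonneg k)), h.integral_Ioi_pow_mul_density]
  simp [h.measure_Ici, ENNReal.ofReal_pow (h.mem_Icc t).1]

theorem integral_iInf_eq (h : IsSurvivalFunction Ψ) (hg : Function.Injective g) :
    ∫ x, ⨅ i, x (g i) ∂Measure.pi (fun _ : κ => shapeMeasure Ψ) =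
      (k + 1) * ∫ x, x * shapeDensity Ψ x * Ψ x ^ k := by
  have hm : Measurable fun x : κ → ℝ => ⨅ i, x (g i) :=
    Measurable.iInf fun i => measurable_pi_apply _
  have hdensity : Measurable fun x => (k + 1) * Ψ x ^ k * shapeDensity Ψ x := by
    have := h.differentiable.continuous.measurable
    have := measurable_shapeDensity Ψ
    fun_prop
  rw [← integral_map hm.aemeasurable (f := fun y : ℝ => y) measurable_id.aestronglyMeasurable,
    h.map_iInf_eq hg, integral_withDensity_eq_integral_toReal_smul hdensity.ennreal_ofReal
    (by simp), ← integral_const_mul]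
  refine integral_congr_ae (Eventually.of_forall fun x => ?_)
  simp only [smul_eq_mul]
  rw [ENNReal.toReal_ofReal (h.pow_mul_density_nonneg k x)]
  ring

end Minimum

theorem integral_iInf_blockVars (h : IsSurvivalFunction Ψ) {m : ℕ} (c : Composition (m + 1)) :
    ∫ x, ⨅ i, blockVars c x i ∂Measure.pi (fun _ => shapeMeasure Ψ) =
      c.length * ∫ x, x * shapeDensity Ψ x * Ψ x ^ (c.length - 1) := by
  have hmin (l : ℕ) (hl : 0 < l) (hle : l ≤ m + 1) :
      ∫ x, ⨅ i : Fin l, x (Fin.castLE hle i) ∂Measure.pi (fun _ => shapeMeasure Ψ) =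
        l * ∫ x, x * shapeDensity Ψ x * Ψ x ^ (l - 1) := by
    obtain ⟨k, rfl⟩ := Nat.exists_eq_add_of_le' hl
    rw [h.integral_iInf_eq (Fin.castLE_injective hle), add_tsub_cancel_right, Nat.cast_add_one]
  exact hmin _ (c.length_pos_of_pos m.succ_pos) c.length_le

theorem sum_choose_mul_moment (h : IsSurvivalFunction Ψ) (l r : ℕ) :
    ∑ j ∈ Finset.range (r + 1), (r.choose j : ℝ) *
      ∫ x : ℝ, x * shapeDensity Ψ x * Ψ x ^ (l + j) * (1 - Ψ x) ^ (r - j) =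
      ∫ x : ℝ, x * shapeDensity Ψ x * Ψ x ^ l := by
  simp only [← integral_const_mul]
  rw [← integral_finsetSum _ fun j _ => (h.integrable_moment _ _).const_mul _]
  refine integral_congr_ae (Eventually.of_forall fun x => ?_)
  have hbinomial := add_pow (Ψ x) (1 - Ψ x) r
  rw [add_sub_cancel, one_pow] at hbinomial
  calc ∑ j ∈ Finset.range (r + 1),
        r.choose j * (x * shapeDensity Ψ x * Ψ x ^ (l + j) * (1 - Ψ x) ^ (r - j))
      = x * shapeDensity Ψ x * Ψ x ^ l *
        ∑ j ∈ Finset.range (r + 1), Ψ x ^ j * (1 - Ψ x) ^ (r - j) * (r.choose j : ℝ) := by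
        rw [Finset.mul_sum]
        refine Finset.sum_congr rfl fun j _ => ?_
        rw [pow_add]
        ring
    _ = x * shapeDensity Ψ x * Ψ x ^ l := by rw [← hbinomial, mul_one]

end IsSurvivalFunction

theorem sum_range_sum_Icc_choose {R : Type*} [CommSemiring R] (n : ℕ) (a : ℕ → R)
    (M : ℕ → ℕ → R) :
    ∑ k ∈ Finset.range n, (∑ l ∈ Finset.Icc 1 (k + 1), a l * ((n - l).choose (k + 1 - l) : R)) *
        M k (n - 1 - k) =
      ∑ l ∈ Finset.Icc 1 n, a l * ∑ j ∈ Finset.range (n - l + 1),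
        ((n - l).choose j : R) * M (l - 1 + j) (n - l - j) := by
  simp only [Finset.sum_mul]
  rw [Finset.sum_comm' (t' := Finset.Icc 1 n) (s' := fun l => Finset.Ico (l - 1) n)
    fun k l => by simp only [Finset.mem_range, Finset.mem_Icc, Finset.mem_Ico]; omega]
  refine Finset.sum_congr rfl fun l hl => ?_
  obtain ⟨hpos, hle⟩ := Finset.mem_Icc.1 hl
  rw [Finset.sum_Ico_eq_sum_range, Finset.mul_sum, show n - (l - 1) = n - l + 1 by omega]
  refine Finset.sum_congr rfl fun j _ => ?_
  rw [show l - 1 + j + 1 - l = j by omega, show n - 1 - (l - 1 + j) = n - l - j by omega, mul_assoc]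

theorem sum_compWeight_mul_length {n : ℕ} (hn : 0 < n) (g : ℕ → ℝ) :
    ∑ c : Composition n, compWeight c * (c.length * g c.length) =
      ∑ l ∈ Finset.Icc 1 n, (-1) ^ (l + 1) *
        (∑ c : Composition n with c.length = l, (n ! / ∏ i, (c.blocksFun i)! : ℝ)) * g l := by
  rw [← Finset.sum_fiberwise_of_maps_to (t := Finset.Icc 1 n) (g := Composition.length)
    fun c _ => Finset.mem_Icc.2 ⟨c.length_pos_of_pos hn, c.length_le⟩]
  refine Finset.sum_congr rfl fun l _ => ?_
  rw [Finset.mul_sum, Finset.sum_mul]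
  refine Finset.sum_congr rfl fun c hc => ?_
  obtain rfl : c.length = l := (Finset.mem_filter.1 hc).2
  have hne : (c.length : ℝ) ≠ 0 := Nat.cast_ne_zero.2 (c.length_pos_of_pos hn).ne'
  rw [compWeight]
  field_simp

theorem IsSurvivalFunction.shapeB_eq {Ψ : ℝ → ℝ} (h : IsSurvivalFunction Ψ) {n : ℕ} (hn : 0 < n) :
    shapeB Ψ n = ∑ c : Composition n, compWeight c *
      (c.length * ∫ x, x * shapeDensity Ψ x * Ψ x ^ (c.length - 1)) := by
  rw [sum_compWeight_mul_length hn fun l => ∫ x, x * shapeDensity Ψ x * Ψ x ^ (l - 1)]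
  simp only [shapeB, coeffB, mul_right_comm _ (Nat.cast _)]
  rw [sum_range_sum_Icc_choose n _ fun i j =>
    ∫ x : ℝ, x * shapeDensity Ψ x * Ψ x ^ i * (1 - Ψ x) ^ j]
  simp only [h.sum_choose_mul_moment]

/-! ### Symmetrization over permutations -/

theorem measurePreserving_comp_injective {ι κ X : Type*} [Fintype ι] [Fintype κ]
    [MeasurableSpace X] (μ : Measure X) [IsProbabilityMeasure μ] {g : ι → κ}
    (hg : Function.Injective g) :
    MeasurePreserving (fun x : κ → X => x ∘ g) (Measure.pi fun _ => μ) (Measure.pi fun _ => μ) := by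
  have hm : Measurable fun x : κ → X => x ∘ g :=
    measurable_pi_lambda _ fun i => measurable_pi_apply (g i)
  refine ⟨hm, (Measure.pi_eq fun S hS => ?_).symm⟩
  rw [Measure.map_apply hm (MeasurableSet.univ_pi hS), ← pi_setOf_comp_injective μ hg S]
  congr 1
  ext x
  simp

theorem ae_fst_ne_snd {X : Type*} [MeasurableSpace X] [MeasurableEq X]
    (μ ν : Measure X) [SFinite ν] [NullSingletonClass ν] :
    ∀ᵐ p ∂μ.prod ν, p.1 ≠ p.2 := by
  refine Measure.ae_prod_iff_ae_ae (measurableSet_diagonal (α := X)).compl |>.2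
    (Eventually.of_forall fun x => ?_)
  filter_upwards [(measure_eq_zero_iff_ae_notMem (μ := ν)).1 (measure_singleton x)]
    with y hy using fun hxy => hy hxy.symm

theorem ae_pi_injective {κ X : Type*} [Fintype κ] [MeasurableSpace X] [MeasurableEq X]
    (μ : Measure X) [IsProbabilityMeasure μ] [NullSingletonClass μ] :
    ∀ᵐ x ∂Measure.pi fun _ : κ => μ, Function.Injective x := by
  have hne (i j : κ) (hij : i ≠ j) : ∀ᵐ x ∂Measure.pi fun _ : κ => μ, x i ≠ x j := by
    have hg : Function.Injective ![i, j] := injective_pair_iff_ne.2 hij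
    exact ((measurePreserving_finTwoArrow μ).comp
      (measurePreserving_comp_injective μ hg)).quasiMeasurePreserving.ae (ae_fst_ne_snd μ μ)
  have hall : ∀ᵐ x ∂Measure.pi fun _ : κ => μ, ∀ i j : κ, i ≠ j → x i ≠ x j :=
    ae_all_iff.2 fun i => ae_all_iff.2 fun j => ae_all_iff.2 fun hij => hne i j hij
  filter_upwards [hall] with x hx i j hij using not_not.1 fun h => hx i j h hij

theorem measurableSet_strictMono (n : ℕ) :
    MeasurableSet {x : Fin n → ℝ | StrictMono x} := by
  simp only [StrictMono, Set.ofPred_forall]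
  exact MeasurableSet.iInter fun i => MeasurableSet.iInter fun j => MeasurableSet.iInter fun _ =>
    measurableSet_lt (measurable_pi_apply i) (measurable_pi_apply j)

open scoped Classical in
theorem sum_ite_strictMono_comp_perm {n : ℕ} {α M : Type*} [LinearOrder α] [AddCommMonoid M]
    {x : Fin n → α} (hx : Function.Injective x) (a : M) :
    ∑ σ : Equiv.Perm (Fin n), (if StrictMono (x ∘ σ) then a else 0) = a := by
  have hsort : StrictMono (x ∘ Tuple.sort x) :=
    (Tuple.monotone_sort x).strictMono_of_injective (hx.comp (Equiv.injective _))
  rw [Finset.sum_eq_single (Tuple.sort x), if_pos hsort]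
  · exact fun σ _ hσ => if_neg fun hmono => hσ (Equiv.ext fun i =>
      hx (congrFun (Tuple.unique_monotone hmono.monotone hsort.monotone) i))
  · exact fun hmem => absurd (Finset.mem_univ _) hmem

section Symmetrization

variable {n : ℕ} {Y : Type*} [MeasurableSpace Y] (ν : Measure Y) [SFinite ν]

theorem measurePreserving_prod_comp_perm {X : Type*} [MeasurableSpace X] (μ : Measure X)
    [IsProbabilityMeasure μ] (σ : Equiv.Perm (Fin n)) :
    MeasurePreserving (fun p : Y × (Fin n → X) => (p.1, p.2 ∘ σ))
      (ν.prod (Measure.pi fun _ => μ)) (ν.prod (Measure.pi fun _ => μ)) :=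
  (MeasurePreserving.id ν).prod (measurePreserving_comp_injective μ σ.injective)

variable (μ : Measure ℝ) [IsProbabilityMeasure μ] {G : Y × (Fin n → ℝ) → ℝ}

theorem integrable_comp_perm (hG : Integrable G (ν.prod (Measure.pi fun _ => μ)))
    (σ : Equiv.Perm (Fin n)) :
    Integrable (fun p => G (p.1, p.2 ∘ σ)) (ν.prod (Measure.pi fun _ => μ)) :=
  (measurePreserving_prod_comp_perm ν μ σ).integrable_comp_of_integrable hG

open scoped Classical in
theorem integral_ite_strictMono_comp_perm (hG : Integrable G (ν.prod (Measure.pi fun _ => μ)))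
    (σ : Equiv.Perm (Fin n)) :
    ∫ p, (if StrictMono (p.2 ∘ σ) then G p else 0) ∂ν.prod (Measure.pi fun _ => μ) =
      ∫ p in Set.univ ×ˢ {x | StrictMono x}, G (p.1, p.2 ∘ σ.symm)
        ∂ν.prod (Measure.pi fun _ => μ) := by
  have hset : MeasurableSet ((Set.univ : Set Y) ×ˢ {x : Fin n → ℝ | StrictMono x}) :=
    MeasurableSet.univ.prod (measurableSet_strictMono n)
  have hmp := measurePreserving_prod_comp_perm ν μ σ
  rw [← integral_indicator hset]
  conv_rhs => rw [← hmp.map_eq]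
  rw [integral_map hmp.aemeasurable]
  · refine integral_congr_ae (Eventually.of_forall fun p => ?_)
    simp [Set.indicator_apply, Function.comp_assoc]
  · rw [hmp.map_eq]
    exact ((integrable_comp_perm ν μ hG σ.symm).indicator hset).aestronglyMeasurable

theorem integral_symmetrize [NullSingletonClass μ]
    (hG : Integrable G (ν.prod (Measure.pi fun _ => μ))) :
    ∫ p, G p ∂ν.prod (Measure.pi fun _ => μ) =
      ∫ p in Set.univ ×ˢ {x | StrictMono x}, ∑ σ : Equiv.Perm (Fin n), G (p.1, p.2 ∘ σ)
        ∂ν.prod (Measure.pi fun _ => μ) := by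
  classical
  have hinjective : ∀ᵐ p ∂ν.prod (Measure.pi fun _ : Fin n => μ), Function.Injective p.2 :=
    Measure.quasiMeasurePreserving_snd.ae (ae_pi_injective μ)
  have hset (σ : Equiv.Perm (Fin n)) :
      MeasurableSet {p : Y × (Fin n → ℝ) | StrictMono (p.2 ∘ σ)} :=
    (measurePreserving_prod_comp_perm ν μ σ).measurable
      (measurable_snd (measurableSet_strictMono n))
  calc ∫ p, G p ∂ν.prod (Measure.pi fun _ => μ)
      = ∫ p, ∑ σ : Equiv.Perm (Fin n), (if StrictMono (p.2 ∘ σ) then G p else 0)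
          ∂ν.prod (Measure.pi fun _ => μ) := by
        refine integral_congr_ae ?_
        filter_upwards [hinjective] with p hp using (sum_ite_strictMono_comp_perm hp _).symm
    _ = ∑ σ : Equiv.Perm (Fin n), ∫ p, (if StrictMono (p.2 ∘ σ) then G p else 0)
          ∂ν.prod (Measure.pi fun _ => μ) :=
        integral_finsetSum _ fun σ _ => (hG.indicator (hset σ)).congr
          (Eventually.of_forall fun p => by simp only [Set.indicator_apply, Set.mem_ofPred_eq])
    _ = ∑ σ : Equiv.Perm (Fin n), ∫ p in Set.univ ×ˢ {x | StrictMono x}, G (p.1, p.2 ∘ σ)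
          ∂ν.prod (Measure.pi fun _ => μ) := by
        simp only [integral_ite_strictMono_comp_perm ν μ hG]
        exact Equiv.sum_comp (Equiv.inv (Equiv.Perm (Fin n))) fun σ =>
          ∫ p in Set.univ ×ˢ {x | StrictMono x}, G (p.1, p.2 ∘ σ) ∂ν.prod (Measure.pi fun _ => μ)
    _ = _ := (integral_finsetSum _ fun σ _ => (integrable_comp_perm ν μ hG σ).integrableOn).symm

end Symmetrization

section Reflection

variable {m : ℕ} {Z : Type*} [MeasurableSpace Z] (π : Measure Z) [SFinite π]

theorem measurePreserving_neg_fst :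
    MeasurePreserving (fun p : (Fin m → ℝ) × Z => (-p.1, p.2)) (volume.prod π) (volume.prod π) :=
  (Measure.measurePreserving_neg volume).prod (MeasurePreserving.id π)

theorem integral_comp_neg_fst (G : (Fin m → ℝ) × Z → ℝ) :
    ∫ p, G (-p.1, p.2) ∂volume.prod π = ∫ p, G p ∂volume.prod π :=
  (measurePreserving_neg_fst π).integral_comp
    ((MeasurableEquiv.neg (Fin m → ℝ)).prodCongr (MeasurableEquiv.refl Z)).measurableEmbedding G

theorem integral_eq_zero_of_odd_fst {G : (Fin m → ℝ) × Z → ℝ}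
    (hG : ∀ p, G (-p.1, p.2) = -G p) : ∫ p, G p ∂volume.prod π = 0 := by
  have hself := integral_comp_neg_fst π G
  simp only [hG, integral_neg] at hself
  linarith

end Reflection

/-! ### The limit of the kernel cumulants in closed form -/

theorem ciSup_const_sub {ι : Type*} [Finite ι] [Nonempty ι] (a : ℝ) (g : ι → ℝ) :
    ⨆ i, (a - g i) = a - ⨅ i, g i :=
  ((OrderIso.subLeft a).map_ciInf (Set.finite_range g).bddBelow).symm

section BlockMinimum

variable {m : ℕ} (c : Composition (m + 1)) (t : ℝ)

theorem blockFreqs_neg (v : Fin m → ℝ) (i : Fin c.length) :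
    blockFreqs c (-v) i = -blockFreqs c v i := by
  simp only [blockFreqs, blockSum, zeroSum_neg, Finset.sum_neg_distrib]

/-- The smallest of the numbers `t x_i - (u_1 + ⋯ + u_{m_1 + ⋯ + m_i})` over the blocks of a
composition; both the centered overlaps and the functions `G^m_t` are made of such minima. -/
noncomputable def blockMin (p : (Fin m → ℝ) × (Fin (m + 1) → ℝ)) : ℝ :=
  ⨅ i, (-blockFreqs c p.1 i + t * blockVars c p.2 i)

@[fun_prop]
theorem measurable_blockMin : Measurable (blockMin c t) :=
  Measurable.iInf fun i => by fun_prop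

theorem abs_blockMin_le (p : (Fin m → ℝ) × (Fin (m + 1) → ℝ)) :
    |blockMin c t p| ≤ ((m + 1) ^ 2 + |t|) * linearWeight p := by
  have hsum : |blockMin c t p| ≤ ∑ i, |blockFreqs c p.1 i| + ∑ i, |t * blockVars c p.2 i| := by
    refine (abs_iInf_le_sum _).trans ?_
    rw [← Finset.sum_add_distrib]
    exact Finset.sum_le_sum fun i _ => (abs_add_le _ _).trans_eq (by rw [abs_neg])
  linarith [sum_abs_blocks_le_linearWeight c t p]

theorem abs_blockMin_neg_fst_le (p : (Fin m → ℝ) × (Fin (m + 1) → ℝ)) :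
    |blockMin c t (-p.1, p.2)| ≤ ((m + 1) ^ 2 + |t|) * linearWeight p := by
  simpa only [linearWeight, Pi.neg_apply, abs_neg] using abs_blockMin_le c t (-p.1, p.2)

theorem centeredOverlap_eq_blockMin_add (p : (Fin m → ℝ) × (Fin (m + 1) → ℝ)) :
    centeredOverlap (blockFreqs c p.1) (fun i => t * blockVars c p.2 i) =
      blockMin c t (-p.1, p.2) + blockMin c t p := by
  simp only [centeredOverlap, blockMin, blockFreqs_neg, neg_neg]

theorem argMinIndex_le (σ : Equiv.Perm (Fin (m + 1))) (i : Fin c.length) :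
    σ (Fin.castLE c.length_le (argMinIndex m.succ_pos c σ)) ≤ σ (Fin.castLE c.length_le i) :=
  Function.argmin_le (fun i : Fin c.length => σ (Fin.castLE c.length_le i)) i

theorem compG_eq_sum_sub_blockMin (v : Fin m → ℝ) (x : Fin (m + 1) → ℝ) :
    compG m.succ_pos t c (zeroSum (n := m + 1) v) x =
      ∑ σ : Equiv.Perm (Fin (m + 1)), (-blockFreqs c v (argMinIndex m.succ_pos c σ) +
        t * blockVars c (x ∘ σ) (argMinIndex m.succ_pos c σ) - blockMin c t (v, x ∘ σ)) := by
  refine Finset.sum_congr rfl fun σ _ => ?_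
  rw [blockMin, ← ciSup_const_sub]
  congr 1 with i
  simp only [blockLambda, blockFreqs, blockVars, Function.comp_apply]
  ring

theorem blockVars_argMinIndex {x : Fin (m + 1) → ℝ} (hx : Monotone x)
    (σ : Equiv.Perm (Fin (m + 1))) :
    blockVars c (x ∘ σ) (argMinIndex m.succ_pos c σ) = ⨅ i, blockVars c (x ∘ σ) i :=
  le_antisymm (le_ciInf fun i => hx (argMinIndex_le c σ i))
    (ciInf_le (Set.finite_range _).bddBelow _)

theorem sum_blockMin_comp_perm (v : Fin m → ℝ) {x : Fin (m + 1) → ℝ} (hx : Monotone x) :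
    ∑ σ : Equiv.Perm (Fin (m + 1)), blockMin c t (v, x ∘ σ) =
      -compG m.succ_pos t c (zeroSum (n := m + 1) v) x -
        ∑ σ : Equiv.Perm (Fin (m + 1)), blockFreqs c v (argMinIndex m.succ_pos c σ) +
        t * ∑ σ : Equiv.Perm (Fin (m + 1)), ⨅ i, blockVars c (x ∘ σ) i := by
  simp only [compG_eq_sum_sub_blockMin, blockVars_argMinIndex c hx, Finset.sum_sub_distrib,
    Finset.sum_add_distrib, Finset.sum_neg_distrib, ← Finset.mul_sum]
  ring

theorem linearWeight_comp_perm (p : (Fin m → ℝ) × (Fin (m + 1) → ℝ))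
    (σ : Equiv.Perm (Fin (m + 1))) : linearWeight (p.1, p.2 ∘ σ) = linearWeight p := by
  simp only [linearWeight, Function.comp_apply, Equiv.sum_comp σ fun i => |p.2 i|]

theorem abs_neg_blockFreqs_add_blockVars_le (p : (Fin m → ℝ) × (Fin (m + 1) → ℝ))
    (i : Fin c.length) :
    |-blockFreqs c p.1 i + t * blockVars c p.2 i| ≤ ((m + 1) ^ 2 + |t|) * linearWeight p := by
  have hfreq := Finset.single_le_sum (f := fun i => |blockFreqs c p.1 i|)
    (fun _ _ => abs_nonneg _) (Finset.mem_univ i)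
  have hvar := Finset.single_le_sum (f := fun i => |t * blockVars c p.2 i|)
    (fun _ _ => abs_nonneg _) (Finset.mem_univ i)
  have htriangle := abs_add_le (-blockFreqs c p.1 i) (t * blockVars c p.2 i)
  rw [abs_neg] at htriangle
  linarith [sum_abs_blocks_le_linearWeight c t p]

theorem abs_compG_le (p : (Fin m → ℝ) × (Fin (m + 1) → ℝ)) :
    |compG m.succ_pos t c (zeroSum (n := m + 1) p.1) p.2| ≤
      (m + 1)! * (2 * ((m + 1) ^ 2 + |t|)) * linearWeight p := by
  have hterm (σ : Equiv.Perm (Fin (m + 1))) :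
      |-blockFreqs c p.1 (argMinIndex m.succ_pos c σ) +
        t * blockVars c (p.2 ∘ σ) (argMinIndex m.succ_pos c σ) - blockMin c t (p.1, p.2 ∘ σ)| ≤
      2 * ((m + 1) ^ 2 + |t|) * linearWeight p := by
    have hweight := linearWeight_comp_perm p σ
    have hleft := abs_neg_blockFreqs_add_blockVars_le c t (p.1, p.2 ∘ σ)
      (argMinIndex m.succ_pos c σ)
    have hright := abs_blockMin_le c t (p.1, p.2 ∘ σ)
    rw [hweight] at hleft hright
    refine (abs_sub _ _).trans ?_
    linarith
  rw [compG_eq_sum_sub_blockMin]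
  refine (Finset.abs_sum_le_sum_abs _ _).trans ((Finset.sum_le_sum fun σ _ => hterm σ).trans_eq ?_)
  rw [Finset.sum_const, Finset.card_univ, Fintype.card_perm, Fintype.card_fin, nsmul_eq_mul]
  ring

theorem measurable_compG : Measurable fun p : (Fin m → ℝ) × (Fin (m + 1) → ℝ) =>
    compG m.succ_pos t c (zeroSum (n := m + 1) p.1) p.2 := by
  simp only [compG_eq_sum_sub_blockMin]
  fun_prop

end BlockMinimum

section LimitIntegrals

variable {f : ℝ → ℝ} {m : ℕ} (c : Composition (m + 1)) {t : ℝ} {μ : Measure ℝ}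
  [IsProbabilityMeasure μ]

theorem re_hyperplaneProd_neg (f : ℝ → ℝ) (v : Fin m → ℝ) :
    (hyperplaneProd f (-v)).re = (hyperplaneProd f v).re := by
  rw [hyperplaneProd_neg, Complex.conj_re]

theorem IsH1Compact.integral_re_hyperplaneProd (hf : IsH1Compact f) (m : ℕ) :
    ∫ v : Fin m → ℝ, (hyperplaneProd f v).re = ∫ x, f x ^ (m + 1) := by
  have hre := integral_re (𝕜 := ℂ) (hf.integrable_hyperplaneProd (m := m))
  simp only [RCLike.re_to_complex] at hre
  rw [hre, hf.integral_hyperplaneProd, Complex.ofReal_re]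

theorem IsH1Compact.integrable_re_hyperplaneProd_mul (hf : IsH1Compact f) (hμ : Integrable id μ)
    {G : (Fin m → ℝ) × (Fin (m + 1) → ℝ) → ℝ} (hGm : Measurable G) {C : ℝ}
    (hG : ∀ p, |G p| ≤ C * linearWeight p) :
    Integrable (fun p => (hyperplaneProd f p.1).re * G p)
      (volume.prod (Measure.pi fun _ => μ)) :=
  (hf.integrable_hyperplaneProd_mul hμ hGm hG).re.congr
    (Eventually.of_forall fun _ => Complex.re_mul_ofReal _ _)

theorem IsH1Compact.re_integral_hyperplaneProd_mul (hf : IsH1Compact f) (hμ : Integrable id μ)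
    {G : (Fin m → ℝ) × (Fin (m + 1) → ℝ) → ℝ} (hGm : Measurable G) {C : ℝ}
    (hG : ∀ p, |G p| ≤ C * linearWeight p) :
    (∫ p, hyperplaneProd f p.1 * (G p : ℂ) ∂volume.prod (Measure.pi fun _ => μ)).re =
      ∫ p, (hyperplaneProd f p.1).re * G p ∂volume.prod (Measure.pi fun _ => μ) := by
  have hre := integral_re (𝕜 := ℂ) (hf.integrable_hyperplaneProd_mul hμ hGm hG)
  simp only [RCLike.re_to_complex, Complex.re_mul_ofReal] at hre
  exact hre.symm

theorem IsH1Compact.integrable_re_mul_blockMin (hf : IsH1Compact f) (hμ : Integrable id μ) :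
    Integrable (fun p => (hyperplaneProd f p.1).re * blockMin c t p)
      (volume.prod (Measure.pi fun _ => μ)) :=
  hf.integrable_re_hyperplaneProd_mul hμ (measurable_blockMin c t) (abs_blockMin_le c t)

theorem IsH1Compact.integrable_re_mul_compG (hf : IsH1Compact f) (hμ : Integrable id μ) :
    Integrable (fun p : (Fin m → ℝ) × (Fin (m + 1) → ℝ) => (hyperplaneProd f p.1).re *
      compG m.succ_pos t c (zeroSum (n := m + 1) p.1) p.2)
      (volume.prod (Measure.pi fun _ => μ)) :=
  hf.integrable_re_hyperplaneProd_mul hμ (measurable_compG c t) (abs_compG_le c t)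

theorem IsH1Compact.integrable_re_mul_blockFreqs (hf : IsH1Compact f) (hμ : Integrable id μ)
    (i : Fin c.length) :
    Integrable (fun p : (Fin m → ℝ) × (Fin (m + 1) → ℝ) =>
      (hyperplaneProd f p.1).re * blockFreqs c p.1 i) (volume.prod (Measure.pi fun _ => μ)) :=
  hf.integrable_re_hyperplaneProd_mul hμ (by fun_prop) fun p => by
    simpa using abs_neg_blockFreqs_add_blockVars_le c 0 p i

theorem IsH1Compact.integrable_re_mul_iInf_blockVars (hf : IsH1Compact f)
    (hμ : Integrable id μ) :
    Integrable (fun p : (Fin m → ℝ) × (Fin (m + 1) → ℝ) =>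
      (hyperplaneProd f p.1).re * ⨅ i, blockVars c p.2 i)
      (volume.prod (Measure.pi fun _ => μ)) := by
  refine hf.integrable_re_hyperplaneProd_mul hμ (C := 1) (Measurable.iInf fun i => by fun_prop)
    fun p => ?_
  have hvars := (abs_iInf_le_sum _).trans (sum_abs_blockVars_le c p.2)
  have hfst : 0 ≤ ∑ j, |p.1 j| := by positivity
  unfold linearWeight
  linarith

theorem IsH1Compact.re_integral_centeredOverlap (hf : IsH1Compact f) (hμ : Integrable id μ) :
    (∫ p, hyperplaneProd f p.1 * ((centeredOverlap (blockFreqs c p.1)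
        fun i => t * blockVars c p.2 i : ℝ) : ℂ) ∂volume.prod (Measure.pi fun _ => μ)).re =
      2 * ∫ p, (hyperplaneProd f p.1).re * blockMin c t p
        ∂volume.prod (Measure.pi fun _ => μ) := by
  have hm : Measurable fun p : (Fin m → ℝ) × (Fin (m + 1) → ℝ) => blockMin c t (-p.1, p.2) :=
    (measurable_blockMin c t).comp (measurable_fst.neg.prodMk measurable_snd)
  have hle (p : (Fin m → ℝ) × (Fin (m + 1) → ℝ)) : |blockMin c t (-p.1, p.2) + blockMin c t p| ≤
      2 * ((m + 1) ^ 2 + |t|) * linearWeight p := by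
    linarith [abs_add_le (blockMin c t (-p.1, p.2)) (blockMin c t p), abs_blockMin_le c t p,
      abs_blockMin_neg_fst_le c t p]
  have hreflect := integral_comp_neg_fst (Measure.pi fun _ : Fin (m + 1) => μ)
    fun p : (Fin m → ℝ) × (Fin (m + 1) → ℝ) => (hyperplaneProd f p.1).re * blockMin c t p
  simp only [re_hyperplaneProd_neg] at hreflect
  simp only [centeredOverlap_eq_blockMin_add]
  rw [hf.re_integral_hyperplaneProd_mul hμ (by fun_prop) hle]
  simp only [mul_add]
  rw [integral_add (hf.integrable_re_hyperplaneProd_mul hμ hm (abs_blockMin_neg_fst_le c t))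
    (hf.integrable_re_mul_blockMin c hμ), hreflect, two_mul]

theorem setIntegral_re_mul_sum_blockFreqs (π : Measure (Fin (m + 1) → ℝ)) [SFinite π]
    (S : Set (Fin (m + 1) → ℝ)) :
    ∫ p in Set.univ ×ˢ S, (hyperplaneProd f p.1).re *
      ∑ σ : Equiv.Perm (Fin (m + 1)), blockFreqs c p.1 (argMinIndex m.succ_pos c σ)
      ∂volume.prod π = 0 := by
  rw [← Measure.prod_restrict, Measure.restrict_univ]
  refine integral_eq_zero_of_odd_fst _ fun p => ?_
  simp only [re_hyperplaneProd_neg, blockFreqs_neg, Finset.sum_neg_distrib, mul_neg]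

theorem IsH1Compact.integral_re_mul_blockMin [NullSingletonClass μ] (hf : IsH1Compact f)
    (hμ : Integrable id μ) :
    ∫ p, (hyperplaneProd f p.1).re * blockMin c t p ∂volume.prod (Measure.pi fun _ => μ) =
      t * ∫ p : (Fin m → ℝ) × (Fin (m + 1) → ℝ),
          (hyperplaneProd f p.1).re * ⨅ i, blockVars c p.2 i ∂volume.prod (Measure.pi fun _ => μ) -
        ∫ p : (Fin m → ℝ) × (Fin (m + 1) → ℝ) in Set.univ ×ˢ {x | StrictMono x},
          (hyperplaneProd f p.1).re * compG m.succ_pos t c (zeroSum (n := m + 1) p.1) p.2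
          ∂volume.prod (Measure.pi fun _ => μ) := by
  have hset : MeasurableSet
      ((Set.univ : Set (Fin m → ℝ)) ×ˢ {x : Fin (m + 1) → ℝ | StrictMono x}) :=
    MeasurableSet.univ.prod (measurableSet_strictMono _)
  have hvars := hf.integrable_re_mul_iInf_blockVars c hμ
  have hvarsPerm := (integrable_finsetSum Finset.univ fun σ _ =>
    integrable_comp_perm volume μ hvars σ).const_mul t
  have hfreqs := integrable_finsetSum (Finset.univ : Finset (Equiv.Perm (Fin (m + 1))))
    fun σ _ => hf.integrable_re_mul_blockFreqs c hμ (argMinIndex m.succ_pos c σ)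
  have hG := hf.integrable_re_mul_compG c (t := t) hμ
  simp only [← Finset.mul_sum] at hvarsPerm hfreqs
  rw [integral_symmetrize volume μ (hf.integrable_re_mul_blockMin c hμ),
    integral_symmetrize volume μ hvars, ← integral_const_mul]
  simp only [← Finset.mul_sum]
  calc ∫ p : (Fin m → ℝ) × (Fin (m + 1) → ℝ) in Set.univ ×ˢ {x | StrictMono x},
          (hyperplaneProd f p.1).re * ∑ σ : Equiv.Perm (Fin (m + 1)), blockMin c t (p.1, p.2 ∘ σ)
          ∂volume.prod (Measure.pi fun _ => μ)
      = ∫ p : (Fin m → ℝ) × (Fin (m + 1) → ℝ) in Set.univ ×ˢ {x | StrictMono x},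
          (t * ((hyperplaneProd f p.1).re *
            ∑ σ : Equiv.Perm (Fin (m + 1)), ⨅ i, blockVars c (p.2 ∘ σ) i) -
          (hyperplaneProd f p.1).re * compG m.succ_pos t c (zeroSum (n := m + 1) p.1) p.2 -
          (hyperplaneProd f p.1).re *
            ∑ σ : Equiv.Perm (Fin (m + 1)), blockFreqs c p.1 (argMinIndex m.succ_pos c σ))
          ∂volume.prod (Measure.pi fun _ => μ) := by
        refine setIntegral_congr_fun hset fun p hp => ?_
        simp only [sum_blockMin_comp_perm c t p.1 hp.2.monotone]
        ring
    _ = _ := by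
        rw [integral_sub (hvarsPerm.integrableOn.sub' hG.integrableOn) hfreqs.integrableOn,
          integral_sub hvarsPerm.integrableOn hG.integrableOn,
          setIntegral_re_mul_sum_blockFreqs, sub_zero]

end LimitIntegrals

namespace IsSurvivalFunction

variable {Ψ f : ℝ → ℝ} {m : ℕ}

theorem integral_re_mul_iInf_blockVars (h : IsSurvivalFunction Ψ) (hf : IsH1Compact f)
    (c : Composition (m + 1)) :
    ∫ p, (hyperplaneProd f p.1).re * ⨅ i, blockVars c p.2 i
        ∂(volume : Measure (Fin m → ℝ)).prod (Measure.pi fun _ => shapeMeasure Ψ) =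
      (∫ x, f x ^ (m + 1)) *
        (c.length * ∫ x, x * shapeDensity Ψ x * Ψ x ^ (c.length - 1)) := by
  have := h.isProbabilityMeasure
  rw [integral_prod_mul (fun v => (hyperplaneProd f v).re) (fun x => ⨅ i, blockVars c x i),
    hf.integral_re_hyperplaneProd, h.integral_iInf_blockVars]

theorem prod_pi_shapeMeasure (h : IsSurvivalFunction Ψ) {Y ι : Type*} [MeasurableSpace Y]
    [Fintype ι] (ν : Measure Y) :
    ν.prod (Measure.pi fun _ : ι => shapeMeasure Ψ) =
      (ν.prod volume).withDensity fun p : Y × (ι → ℝ) =>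
        ENNReal.ofReal (∏ i, shapeDensity Ψ (p.2 i)) := by
  have hm : Measurable fun x : ι → ℝ => ENNReal.ofReal (∏ i, shapeDensity Ψ (x i)) := by
    have := measurable_shapeDensity Ψ
    fun_prop
  have := h.isProbabilityMeasure
  have : SFinite (volume.withDensity fun x : ι → ℝ =>
      ENNReal.ofReal (∏ i, shapeDensity Ψ (x i))) := h.pi_shapeMeasure ι ▸ inferInstance
  rw [h.pi_shapeMeasure, prod_withDensity_right hm]

section ProductDensity

variable {Y ι : Type*} [MeasurableSpace Y] [Fintype ι]

theorem measurable_ofReal_prod_shapeDensity (Ψ : ℝ → ℝ) :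
    Measurable fun p : Y × (ι → ℝ) => ENNReal.ofReal (∏ i, shapeDensity Ψ (p.2 i)) := by
  have := measurable_shapeDensity Ψ
  fun_prop

variable (ν : Measure Y) (G : Y × (ι → ℝ) → ℝ)

theorem integrable_prod_pi_shapeMeasure_iff (h : IsSurvivalFunction Ψ) :
    Integrable G (ν.prod (Measure.pi fun _ => shapeMeasure Ψ)) ↔
      Integrable (fun p => (∏ i, shapeDensity Ψ (p.2 i)) * G p) (ν.prod volume) := by
  rw [h.prod_pi_shapeMeasure, integrable_withDensity_iff_integrable_smul'
    (measurable_ofReal_prod_shapeDensity Ψ) (by simp)]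
  simp only [ENNReal.toReal_ofReal (Finset.prod_nonneg fun _ _ => h.density_nonneg _), smul_eq_mul]

theorem setIntegral_prod_pi_shapeMeasure (h : IsSurvivalFunction Ψ) {S : Set (Y × (ι → ℝ))}
    (hS : MeasurableSet S) :
    ∫ p in S, G p ∂ν.prod (Measure.pi fun _ => shapeMeasure Ψ) =
      ∫ p in S, (∏ i, shapeDensity Ψ (p.2 i)) * G p ∂ν.prod volume := by
  rw [h.prod_pi_shapeMeasure, setIntegral_withDensity_eq_setIntegral_toReal_smul
    (measurable_ofReal_prod_shapeDensity Ψ) (by simp) G hS]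
  simp only [ENNReal.toReal_ofReal (Finset.prod_nonneg fun _ _ => h.density_nonneg _), smul_eq_mul]

end ProductDensity

theorem limitIntegrand_eq (Ψ f : ℝ → ℝ) (t : ℝ) (p : (Fin m → ℝ) × (Fin (m + 1) → ℝ)) :
    limitIntegrand m.succ_pos Ψ f t p = (∏ i, shapeDensity Ψ (p.2 i)) *
      ∑ c : Composition (m + 1), compWeight c * ((hyperplaneProd f p.1).re *
        compG m.succ_pos t c (zeroSum (n := m + 1) p.1) p.2) := by
  have hprod : (∏ i, 𝓕 (fun y : ℝ => (f y : ℂ)) (zeroSum (n := m + 1) p.1 i) *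
      (shapeDensity Ψ (p.2 i) : ℂ)) =
      hyperplaneProd f p.1 * ((∏ i, shapeDensity Ψ (p.2 i) : ℝ) : ℂ) := by
    rw [Finset.prod_mul_distrib]
    push_cast
    rfl
  unfold limitIntegrand
  rw [hprod, Complex.re_mul_ofReal]
  simp only [mul_left_comm (compWeight _), ← Finset.mul_sum]
  ring

theorem integrable_limitIntegrand (h : IsSurvivalFunction Ψ) (hf : IsH1Compact f) (t : ℝ) :
    Integrable (limitIntegrand m.succ_pos Ψ f t) := by
  have := h.isProbabilityMeasure
  have hsum := integrable_finsetSum Finset.univ fun (c : Composition (m + 1)) _ =>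
    (hf.integrable_re_mul_compG c (t := t) h.integrable_id).const_mul (compWeight c)
  exact ((h.integrable_prod_pi_shapeMeasure_iff volume _).1 hsum).congr
    (Eventually.of_forall fun p => (limitIntegrand_eq Ψ f t p).symm)

theorem integral_limitIntegrand (h : IsSurvivalFunction Ψ) (hf : IsH1Compact f) (t : ℝ) :
    ∫ p in limitDomain (m + 1), limitIntegrand m.succ_pos Ψ f t p =
      ∑ c : Composition (m + 1), compWeight c *
        ∫ p : (Fin m → ℝ) × (Fin (m + 1) → ℝ) in Set.univ ×ˢ {x | StrictMono x},
          (hyperplaneProd f p.1).re * compG m.succ_pos t c (zeroSum (n := m + 1) p.1) p.2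
          ∂(volume : Measure (Fin m → ℝ)).prod (Measure.pi fun _ => shapeMeasure Ψ) := by
  have := h.isProbabilityMeasure
  have hinteg (c : Composition (m + 1)) :=
    (hf.integrable_re_mul_compG c (t := t) h.integrable_id).integrableOn
      (s := Set.univ ×ˢ {x | StrictMono x})
  simp only [← integral_const_mul]
  rw [← integral_finsetSum _ fun c _ => (hinteg c).const_mul (compWeight c),
    h.setIntegral_prod_pi_shapeMeasure _ _ (MeasurableSet.univ.prod (measurableSet_strictMono _))]
  exact integral_congr_ae (Eventually.of_forall (limitIntegrand_eq Ψ f t))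

theorem re_sum_integral_centeredOverlap (h : IsSurvivalFunction Ψ) (hf : IsH1Compact f) (t : ℝ) :
    (∑ c : Composition (m + 1), (compWeight c : ℂ) *
        ∫ p, hyperplaneProd f p.1 * ((centeredOverlap (blockFreqs c p.1)
          fun i => t * blockVars c p.2 i : ℝ) : ℂ)
          ∂volume.prod (Measure.pi fun _ => shapeMeasure Ψ)).re =
      limitCumulant m.succ_pos Ψ f t := by
  have := h.isProbabilityMeasure
  rw [Complex.re_sum]
  simp only [Complex.re_ofReal_mul, hf.re_integral_centeredOverlap _ h.integrable_id,
    hf.integral_re_mul_blockMin _ h.integrable_id, h.integral_re_mul_iInf_blockVars hf]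
  rw [limitCumulant, h.integral_limitIntegrand hf, h.shapeB_eq m.succ_pos, Finset.mul_sum,
    Finset.mul_sum, Finset.sum_mul, ← Finset.sum_sub_distrib]
  refine Finset.sum_congr rfl fun c _ => ?_
  simp only [Nat.succ_eq_add_one]
  ring

end IsSurvivalFunction

/-! ### Fredholm determinants -/

section Fredholm

variable {E : Type*}

/-- The determinant of `K` with rows `x, z₁, …, z_k` and columns `y, z₁, …, z_k`, the integrand of
the numerator of the resolvent in Fredholm's theory. -/
noncomputable def borderedDet (K : E → E → ℝ) {k : ℕ} (x y : E) (z : Fin k → E) : ℝ :=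
  (Matrix.of fun i j : Fin (k + 1) =>
    K ((Fin.cons x z : Fin (k + 1) → E) i) ((Fin.cons y z : Fin (k + 1) → E) j)).det

/-- The determinant of `K` at the points `z₁, …, z_k`, the integrand of the `k`-th coefficient of
the Fredholm determinant. -/
noncomputable def kernelDet (K : E → E → ℝ) {k : ℕ} (z : Fin k → E) : ℝ :=
  (Matrix.of fun i j : Fin k => K (z i) (z j)).det

/-- The product of `K` along the path `x, z₁, …, z_k, y`, the integrand of an iterated kernel. -/
noncomputable def pathProd (K : E → E → ℝ) : (k : ℕ) → (Fin k → E) → E → E → ℝ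
  | 0, _, x, y => K x y
  | k + 1, z, x, y => K x (z 0) * pathProd K k (Fin.tail z) (z 0) y

section Algebra

variable {K : E → E → ℝ}

theorem borderedDet_self (s : E) {k : ℕ} (z : Fin k → E) :
    borderedDet K s s z = kernelDet K (Fin.cons s z : Fin (k + 1) → E) := rfl

theorem borderedDet_eq_mul_det {k : ℕ} (j : Fin (k + 1)) (y : E) (z : Fin (k + 1) → E) :
    borderedDet K (z j) y (j.removeNth z) = (-1) ^ (j : ℕ) * (Matrix.of fun i l =>
      K (z i) ((Fin.cons y (j.removeNth z) : Fin (k + 1) → E) l)).det := by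
  have hperm := Matrix.det_permute j.cycleRange.symm (Matrix.of fun i l : Fin (k + 1) =>
    K (z i) ((Fin.cons y (j.removeNth z) : Fin (k + 1) → E) l))
  rw [Equiv.Perm.sign_symm, Fin.sign_cycleRange] at hperm
  push_cast at hperm
  rw [← hperm, borderedDet]
  congr 1
  ext i l
  have hrow := Fin.insertNth_apply_cycleRange_symm j (z j) (j.removeNth z) i
  rw [Fin.insertNth_self_removeNth] at hrow
  simp only [Matrix.of_apply, Matrix.submatrix_apply, id, hrow]

/-- Laplace expansion along the first row; the rows of the `j`-th minor are reordered so as to form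
a bordered determinant again. -/
theorem borderedDet_succ {k : ℕ} (x y : E) (z : Fin (k + 1) → E) :
    borderedDet K x y z = K x y * kernelDet K z -
      ∑ j : Fin (k + 1), K x (z j) * borderedDet K (z j) y (j.removeNth z) := by
  have hminor (j : Fin (k + 1)) :
      (Matrix.of fun i l : Fin (k + 2) => K ((Fin.cons x z : Fin (k + 2) → E) i)
        ((Fin.cons y z : Fin (k + 2) → E) l)).submatrix Fin.succ j.succ.succAbove =
      Matrix.of fun i l => K (z i) ((Fin.cons y (j.removeNth z) : Fin (k + 1) → E) l) := by
    ext i l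
    induction l using Fin.cases <;> simp [Fin.removeNth]
  have hsign (j : Fin (k + 1)) : ((-1 : ℝ) ^ (j : ℕ)) * (-1) ^ (j : ℕ) = 1 := by
    rw [← mul_pow]; simp
  rw [borderedDet, Matrix.det_succ_row_zero, Fin.sum_univ_succ, sub_eq_add_neg,
    ← Finset.sum_neg_distrib]
  congr 1
  · simp only [Fin.val_zero, pow_zero, one_mul, Matrix.of_apply, Fin.cons_zero]
    congr 1
  · refine Finset.sum_congr rfl fun j _ => ?_
    rw [hminor, borderedDet_eq_mul_det]
    simp only [Matrix.of_apply, Fin.cons_zero, Fin.cons_succ, Fin.val_succ, pow_succ]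
    linear_combination
      -K x (z j) * (Matrix.of fun i l =>
        K (z i) ((Fin.cons y (j.removeNth z) : Fin (k + 1) → E) l)).det * (0 * hsign j)

theorem pathProd_eq_prod {k : ℕ} (z : Fin k → E) (x y : E) :
    pathProd K k z x y = ∏ i : Fin (k + 1), K ((Fin.cons x z : Fin (k + 1) → E) i)
      ((Fin.snoc z y : Fin (k + 1) → E) i) := by
  induction k generalizing x with
  | zero => simp [pathProd, Fin.snoc]
  | succ k ih =>
    have hsnoc : (Fin.snoc z y : Fin (k + 2) → E) = Fin.cons (z 0) (Fin.snoc (Fin.tail z) y) := by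
      rw [Fin.cons_snoc_eq_snoc_cons, Fin.cons_self_tail]
    have hcons : (Fin.cons (z 0) (Fin.tail z) : Fin (k + 1) → E) = z := Fin.cons_self_tail z
    rw [pathProd, ih, hsnoc, hcons, Fin.prod_univ_succ (n := k + 1)]
    rfl

theorem pathProd_self {k : ℕ} (s : E) (z : Fin k → E) :
    pathProd K k z s s = ∏ i : Fin (k + 1), K ((Fin.cons s z : Fin (k + 1) → E) i)
      ((Fin.cons s z : Fin (k + 1) → E) (finRotate (k + 1) i)) := by
  rw [pathProd_eq_prod, Fin.snoc_eq_cons_rotate]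

end Algebra

section Continuity

variable [TopologicalSpace E] {K : E → E → ℝ} {X : Type*} [TopologicalSpace X] {k : ℕ}

theorem continuous_borderedDet (hK : Continuous fun p : E × E => K p.1 p.2) {x y : X → E}
    {z : X → Fin k → E} (hx : Continuous x) (hy : Continuous y) (hz : Continuous z) :
    Continuous fun a => borderedDet K (x a) (y a) (z a) :=
  Continuous.matrix_det (continuous_matrix fun i j => hK.comp₂
    (continuous_pi_iff.1 (Continuous.finCons (A := fun _ => E) hx hz) i)
    (continuous_pi_iff.1 (Continuous.finCons (A := fun _ => E) hy hz) j))

theorem continuous_kernelDet (hK : Continuous fun p : E × E => K p.1 p.2) :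
    Continuous fun z : Fin k → E => kernelDet K z :=
  Continuous.matrix_det (continuous_matrix fun i j =>
    hK.comp₂ (continuous_apply i) (continuous_apply j))

theorem continuous_pathProd (hK : Continuous fun p : E × E => K p.1 p.2) {x y : X → E}
    {z : X → Fin k → E} (hx : Continuous x) (hy : Continuous y) (hz : Continuous z) :
    Continuous fun a => pathProd K k (z a) (x a) (y a) := by
  induction k generalizing x with
  | zero => exact hK.comp₂ hx hy
  | succ k ih =>
    have hhead : Continuous fun a => z a 0 := (continuous_apply 0).comp hz
    have htail : Continuous fun a => Fin.tail (z a) :=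
      continuous_pi fun i => (continuous_apply i.succ).comp hz
    exact (hK.comp₂ hx hhead).mul (ih hhead htail)

end Continuity

section Integrals

variable [MeasurableSpace E]

/-- The integral `∫ g(z₁) ⋯ g(z_k) F(z) dμ^k(z)` of `F` against a product weight. -/
noncomputable def weightedIntegral (μ : Measure E) (g : E → ℝ) {k : ℕ} (F : (Fin k → E) → ℝ) : ℝ :=
  ∫ z : Fin k → E, (∏ i, g (z i)) * F z ∂Measure.pi fun _ => μ

/-- The trace of the `(k + 1)`-st power of the integral operator with kernel `g(x) K(x, y)`, as an
integral over cycles of `k + 1` points. -/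
noncomputable def cyclicIntegral (μ : Measure E) (g : E → ℝ) (K : E → E → ℝ) (k : ℕ) : ℝ :=
  weightedIntegral μ g fun w : Fin (k + 1) → E => ∏ i, K (w i) (w (finRotate (k + 1) i))

/-- The `k`-th coefficient of the Fredholm determinant `det(1 + s g K)` as a power series in `s`. -/
noncomputable def fredholmCoeff (μ : Measure E) (g : E → ℝ) (K : E → E → ℝ) (k : ℕ) : ℝ :=
  weightedIntegral μ g (fun z : Fin k → E => kernelDet K z) / k !

variable {μ : Measure E} {g : E → ℝ}

theorem weightedIntegral_zero (F : (Fin 0 → E) → ℝ) : weightedIntegral μ g F = F Fin.elim0 := by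
  rw [weightedIntegral, Measure.pi_of_empty _ Fin.elim0]
  simp

theorem weightedIntegral_const_mul {k : ℕ} (a : ℝ) (F : (Fin k → E) → ℝ) :
    weightedIntegral μ g (fun z => a * F z) = a * weightedIntegral μ g F := by
  simp only [weightedIntegral, ← integral_const_mul, mul_left_comm a]

theorem fredholmCoeff_zero (K : E → E → ℝ) : fredholmCoeff μ g K 0 = 1 := by
  simp [fredholmCoeff, weightedIntegral_zero, kernelDet]

theorem weightedIntegral_kernelDet (K : E → E → ℝ) (k : ℕ) :
    weightedIntegral μ g (fun z : Fin k → E => kernelDet K z) = k ! * fredholmCoeff μ g K k := by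
  rw [fredholmCoeff, mul_div_cancel₀ _ (by positivity)]

theorem integral_weight_mul_sum {ι : Type*} (s : Finset ι) (a : ℝ) (b : ι → ℝ) {F : ι → E → ℝ}
    (hF : ∀ j ∈ s, Integrable (fun x => g x * F j x) μ) :
    ∫ x, g x * (a * ∑ j ∈ s, b j * F j x) ∂μ = a * ∑ j ∈ s, b j * ∫ x, g x * F j x ∂μ := by
  simp only [← integral_const_mul]
  rw [← integral_finsetSum _ fun j hj => (hF j hj).const_mul _, ← integral_const_mul]
  refine integral_congr_ae (Eventually.of_forall fun x => ?_)
  simp only [Finset.mul_sum]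
  exact Finset.sum_congr rfl fun j _ => by ring

variable [TopologicalSpace E] [BorelSpace E] [SecondCountableTopology E] [T2Space E]
  [SigmaFinite μ] [IsLocallyFiniteMeasure μ]

theorem integrable_prod_mul_of_continuous (hg : Continuous g) (hgc : HasCompactSupport g) {k : ℕ}
    {F : (Fin k → E) → ℝ} (hF : Continuous F) :
    Integrable (fun z => (∏ i, g (z i)) * F z) (Measure.pi fun _ => μ) := by
  refine Continuous.integrable_of_hasCompactSupport (by fun_prop) ?_
  refine HasCompactSupport.intro (isCompact_univ_pi fun _ : Fin k => hgc) fun z hz => ?_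
  simp only [Set.mem_pi, Set.mem_univ, true_imp_iff, not_forall] at hz
  obtain ⟨i, hi⟩ := hz
  rw [Finset.prod_eq_zero (Finset.mem_univ i) (image_eq_zero_of_notMem_tsupport (f := g) hi),
    zero_mul]

theorem weightedIntegral_insertNth (hg : Continuous g) (hgc : HasCompactSupport g) {k : ℕ}
    {F : (Fin (k + 1) → E) → ℝ} (hF : Continuous F) (j : Fin (k + 1)) :
    Integrable (fun s => g s * weightedIntegral μ g fun z => F (j.insertNth s z)) μ ∧
    weightedIntegral μ g F = ∫ s, g s * weightedIntegral μ g (fun z => F (j.insertNth s z)) ∂μ := by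
  have hmp := (measurePreserving_piFinSuccAbove (fun _ : Fin (k + 1) => μ) j).symm
  have hinteg := hmp.integrable_comp_of_integrable (integrable_prod_mul_of_continuous hg hgc hF)
  have hsplit : ∀ p : E × (Fin k → E),
      ((fun z => (∏ i, g (z i)) * F z) ∘
        (MeasurableEquiv.piFinSuccAbove (fun _ : Fin (k + 1) => E) j).symm) p =
      g p.1 * ((∏ i, g (p.2 i)) * F (j.insertNth p.1 p.2)) := by
    intro p
    have hinsert : (MeasurableEquiv.piFinSuccAbove (fun _ : Fin (k + 1) => E) j).symm p =
        j.insertNth p.1 p.2 := rfl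
    simp only [Function.comp_apply, hinsert]
    rw [Fin.prod_univ_succAbove _ j]
    simp only [Fin.insertNth_apply_same, Fin.insertNth_apply_succAbove, mul_assoc]
  have hinner : ∀ s, ∫ z : Fin k → E, g s * ((∏ i, g (z i)) * F (j.insertNth s z))
        ∂Measure.pi (fun _ => μ) =
      g s * weightedIntegral μ g fun z => F (j.insertNth s z) := fun s => integral_const_mul _ _
  have hinteg' := hinteg.congr (Eventually.of_forall hsplit)
  constructor
  · exact hinteg'.integral_prod_left.congr (Eventually.of_forall hinner)
  · rw [weightedIntegral, ← hmp.integral_comp' (g := fun z => (∏ i, g (z i)) * F z)]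
    simp only [← hinner]
    rw [← integral_prod _ hinteg']
    exact integral_congr_ae (Eventually.of_forall hsplit)

theorem weightedIntegral_cons (hg : Continuous g) (hgc : HasCompactSupport g) {k : ℕ}
    {F : (Fin (k + 1) → E) → ℝ} (hF : Continuous F) :
    Integrable (fun s => g s * weightedIntegral μ g fun z => F (Fin.cons s z)) μ ∧
    weightedIntegral μ g F = ∫ s, g s * weightedIntegral μ g (fun z => F (Fin.cons s z)) ∂μ := by
  simpa only [Fin.insertNth_zero'] using weightedIntegral_insertNth (μ := μ) hg hgc hF 0

theorem weightedIntegral_sub_sum (hg : Continuous g) (hgc : HasCompactSupport g) {k : ℕ}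
    {ι : Type*} (s : Finset ι) {F : (Fin k → E) → ℝ} {H : ι → (Fin k → E) → ℝ}
    (hF : Continuous F) (hH : ∀ i, Continuous (H i)) :
    weightedIntegral μ g (fun z => F z - ∑ i ∈ s, H i z) =
      weightedIntegral μ g F - ∑ i ∈ s, weightedIntegral μ g (H i) := by
  have hinteg {F : (Fin k → E) → ℝ} (hF : Continuous F) :=
    integrable_prod_mul_of_continuous (μ := μ) hg hgc hF
  simp only [weightedIntegral, mul_sub, Finset.mul_sum]
  rw [integral_sub (hinteg hF) (integrable_finsetSum _ fun i _ => hinteg (hH i)),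
    integral_finsetSum _ fun i _ => hinteg (hH i)]

variable {K : E → E → ℝ}

theorem weightedIntegral_borderedDet_succ (hg : Continuous g) (hgc : HasCompactSupport g)
    (hK : Continuous fun p : E × E => K p.1 p.2) (k : ℕ) (x y : E) :
    weightedIntegral μ g (fun z : Fin (k + 1) → E => borderedDet K x y z) =
      K x y * weightedIntegral μ g (fun z : Fin (k + 1) → E => kernelDet K z) -
      (k + 1) * ∫ s, g s * (K x s *
        weightedIntegral μ g (fun z : Fin k → E => borderedDet K s y z)) ∂μ := by
  have hcont (j : Fin (k + 1)) : Continuous fun z : Fin (k + 1) → E =>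
      K x (z j) * borderedDet K (z j) y (j.removeNth z) :=
    (hK.comp₂ continuous_const (continuous_apply j)).mul
      (continuous_borderedDet hK (continuous_apply j) continuous_const
        (continuous_pi fun i => continuous_apply _))
  have hterm (j : Fin (k + 1)) : weightedIntegral μ g (fun z : Fin (k + 1) → E =>
      K x (z j) * borderedDet K (z j) y (j.removeNth z)) = ∫ s, g s * (K x s *
        weightedIntegral μ g (fun z : Fin k → E => borderedDet K s y z)) ∂μ := by
    rw [(weightedIntegral_insertNth hg hgc (hcont j) j).2]
    simp only [Fin.insertNth_apply_same, Fin.removeNth_insertNth, weightedIntegral_const_mul]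
  simp only [borderedDet_succ]
  rw [weightedIntegral_sub_sum hg hgc _ (F := fun z => K x y * kernelDet K z)
    (continuous_const.mul (continuous_kernelDet hK)) hcont, weightedIntegral_const_mul]
  simp only [hterm, Finset.sum_const, Finset.card_univ, Fintype.card_fin, nsmul_eq_mul,
    Nat.cast_add, Nat.cast_one]

theorem weightedIntegral_pathProd_succ (hg : Continuous g) (hgc : HasCompactSupport g)
    (hK : Continuous fun p : E × E => K p.1 p.2) (k : ℕ) (x y : E) :
    Integrable (fun s => g s * (K x s *
      weightedIntegral μ g (fun z : Fin k → E => pathProd K k z s y))) μ ∧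
    weightedIntegral μ g (fun z : Fin (k + 1) → E => pathProd K (k + 1) z x y) =
      ∫ s, g s * (K x s *
        weightedIntegral μ g (fun z : Fin k → E => pathProd K k z s y)) ∂μ := by
  simpa only [pathProd, Fin.cons_zero, Fin.tail_cons, weightedIntegral_const_mul] using
    weightedIntegral_cons (μ := μ) hg hgc
      (F := fun z : Fin (k + 1) → E => pathProd K (k + 1) z x y)
      (continuous_pathProd hK continuous_const continuous_const continuous_id)

theorem cyclicIntegral_eq (hg : Continuous g) (hgc : HasCompactSupport g)
    (hK : Continuous fun p : E × E => K p.1 p.2) (k : ℕ) :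
    Integrable (fun s => g s * weightedIntegral μ g (fun z : Fin k → E => pathProd K k z s s)) μ ∧
    cyclicIntegral μ g K k =
      ∫ s, g s * weightedIntegral μ g (fun z : Fin k → E => pathProd K k z s s) ∂μ := by
  simp only [pathProd_self]
  exact weightedIntegral_cons hg hgc
    (F := fun w : Fin (k + 1) → E => ∏ i, K (w i) (w (finRotate (k + 1) i)))
    (continuous_finsetProd _ fun i _ =>
      hK.comp₂ (continuous_apply _) (continuous_apply _))

/-- Fredholm's formula for the resolvent, one coefficient at a time. -/
theorem weightedIntegral_borderedDet (hg : Continuous g) (hgc : HasCompactSupport g)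
    (hK : Continuous fun p : E × E => K p.1 p.2) (k : ℕ) (x y : E) :
    weightedIntegral μ g (fun z : Fin k → E => borderedDet K x y z) =
      k ! * ∑ j ∈ Finset.range (k + 1), (-1) ^ j * fredholmCoeff μ g K (k - j) *
        weightedIntegral μ g (fun z : Fin j → E => pathProd K j z x y) := by
  induction k generalizing x with
  | zero => simp [weightedIntegral_zero, fredholmCoeff_zero, borderedDet, pathProd]
  | succ k ih =>
    have hpath_zero : weightedIntegral μ g (fun z : Fin 0 → E => pathProd K 0 z x y) = K x y :=
      weightedIntegral_zero _
    have hpath_succ (j : ℕ) := weightedIntegral_pathProd_succ (μ := μ) hg hgc hK j x y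
    have hsum : (∫ s, g s * (K x s * (k ! * ∑ j ∈ Finset.range (k + 1),
          (-1) ^ j * fredholmCoeff μ g K (k - j) *
          weightedIntegral μ g (fun z : Fin j → E => pathProd K j z s y))) ∂μ) =
        k ! * ∑ j ∈ Finset.range (k + 1), (-1) ^ j * fredholmCoeff μ g K (k - j) *
          weightedIntegral μ g (fun z : Fin (j + 1) → E => pathProd K (j + 1) z x y) := by
      simp only [fun j => (hpath_succ j).2]
      rw [← integral_weight_mul_sum _ _ _ fun j _ => (hpath_succ j).1]
      simp only [mul_left_comm (K x _), Finset.mul_sum]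
    rw [weightedIntegral_borderedDet_succ hg hgc hK, Finset.sum_range_succ']
    simp only [ih, Nat.add_sub_add_right]
    rw [hsum, hpath_zero, weightedIntegral_kernelDet, Nat.factorial_succ]
    push_cast
    simp only [pow_succ, pow_zero, mul_neg, mul_one, neg_mul, one_mul,
      Finset.sum_neg_distrib]
    ring

/-- The Plemelj recursion: Newton's identities between the coefficients of a Fredholm determinant
and the traces of the powers of the operator. -/
theorem fredholmCoeff_succ (hg : Continuous g) (hgc : HasCompactSupport g)
    (hK : Continuous fun p : E × E => K p.1 p.2) (k : ℕ) :
    (k + 1) * fredholmCoeff μ g K (k + 1) = ∑ j ∈ Finset.range (k + 1),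
      (-1) ^ j * cyclicIntegral μ g K j * fredholmCoeff μ g K (k - j) := by
  have hcyclic (j : ℕ) := cyclicIntegral_eq (μ := μ) hg hgc hK j
  have hsum := integral_weight_mul_sum (Finset.range (k + 1)) (k ! : ℝ)
    (fun j => (-1) ^ j * fredholmCoeff μ g K (k - j)) fun j _ => (hcyclic j).1
  rw [fredholmCoeff, (weightedIntegral_cons hg hgc (continuous_kernelDet hK)).2]
  simp only [← borderedDet_self, weightedIntegral_borderedDet hg hgc hK]
  rw [hsum, Nat.factorial_succ]
  simp only [← (hcyclic _).2, mul_right_comm _ (fredholmCoeff _ _ _ _)]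
  push_cast
  field_simp

end Integrals

end Fredholm

/-! ### Newton's identities and the exponential of a power series -/

section Newton

theorem summable_norm_mul_pow {c : ℕ → ℝ} {r R z : ℝ} (hc : ∀ k, |c k| ≤ r ^ k)
    (hR : r * R < 1) (hz : |z| ≤ R) : Summable fun k => ‖c k * z ^ k‖ := by
  have hr : 0 ≤ r := by simpa using (abs_nonneg _).trans (hc 1)
  have hR0 : 0 ≤ R := (abs_nonneg z).trans hz
  refine Summable.of_nonneg_of_le (fun _ => norm_nonneg _) (fun k => ?_)
    (summable_geometric_of_lt_one (mul_nonneg hr hR0) hR)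
  rw [Real.norm_eq_abs, abs_mul, abs_pow, mul_pow]
  gcongr
  exact hc k

theorem norm_mul_deriv_pow_le {c : ℕ → ℝ} {r R z : ℝ} (hc : ∀ k, |c k| ≤ r ^ k)
    (hz : |z| < R) (k : ℕ) : ‖c k * (k * z ^ (k - 1))‖ ≤ (k : ℝ) ^ 1 * (r * R) ^ k * R⁻¹ := by
  have hR0 : 0 < R := (abs_nonneg z).trans_lt hz
  have hr : 0 ≤ r := by simpa using (abs_nonneg _).trans (hc 1)
  rcases k with _ | k
  · simp
  · calc ‖c (k + 1) * ((k + 1 : ℕ) * z ^ k)‖ = |c (k + 1)| * ((k + 1 : ℕ) * |z| ^ k) := by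
          rw [Real.norm_eq_abs, abs_mul, abs_mul, abs_pow, Nat.abs_cast]
      _ ≤ r ^ (k + 1) * ((k + 1 : ℕ) * R ^ k) := by gcongr; exact hc _
      _ = _ := by field_simp; ring

theorem hasDerivAt_tsum_pow {c : ℕ → ℝ} {r R z : ℝ} (hc : ∀ k, |c k| ≤ r ^ k) (hR : r * R < 1)
    (hz : |z| < R) :
    HasDerivAt (fun z => ∑' k, c k * z ^ k) (∑' k, (k + 1) * c (k + 1) * z ^ k) z := by
  have hr : 0 ≤ r := by simpa using (abs_nonneg _).trans (hc 1)
  have hR0 : 0 < R := (abs_nonneg z).trans_lt hz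
  have hratio : ‖r * R‖ < 1 := by rwa [Real.norm_of_nonneg (mul_nonneg hr hR0.le)]
  have hmajorant : Summable fun k : ℕ => (k : ℝ) ^ 1 * (r * R) ^ k * R⁻¹ :=
    (summable_pow_mul_geometric_of_norm_lt_one 1 hratio).mul_right _
  have hmem (y : ℝ) : y ∈ Metric.ball (0 : ℝ) R ↔ |y| < R := by
    rw [mem_ball_zero_iff, Real.norm_eq_abs]
  have hderiv := hasDerivAt_tsum_of_isPreconnected hmajorant Metric.isOpen_ball
    (convex_ball (0 : ℝ) R).isPreconnected
    (g := fun k y => c k * y ^ k) (g' := fun k y => c k * (k * y ^ (k - 1)))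
    (fun k y _ => (hasDerivAt_pow k y).const_mul (c k))
    (fun k y hy => norm_mul_deriv_pow_le hc ((hmem y).1 hy) k)
    ((hmem 0).2 (by simpa using hR0)) (y₀ := 0)
    (summable_norm_mul_pow (z := 0) hc hR (by simpa using hR0.le)).of_norm ((hmem z).2 hz)
  have hsum : Summable fun k : ℕ => c k * (k * z ^ (k - 1)) :=
    Summable.of_norm_bounded hmajorant (norm_mul_deriv_pow_le hc hz)
  refine hderiv.congr_deriv ?_
  rw [hsum.tsum_eq_zero_add, Nat.cast_zero, zero_mul, mul_zero, zero_add]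
  refine tsum_congr fun k => ?_
  rw [Nat.add_sub_cancel, Nat.cast_succ]
  ring

variable {a T : ℕ → ℝ} {r R z : ℝ}

theorem abs_le_pow_of_newton (ha₀ : a 0 = 1) (hT : ∀ j, |T j| ≤ r ^ (j + 1))
    (hrec : ∀ k : ℕ, (k + 1) * a (k + 1) = ∑ j ∈ Finset.range (k + 1), T j * a (k - j)) (k : ℕ) :
    |a k| ≤ r ^ k := by
  induction k using Nat.strong_induction_on with
  | _ k ih =>
    rcases k with _ | k
    · simp [ha₀]
    · have hk : (0 : ℝ) < k + 1 := by positivity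
      refine le_of_mul_le_mul_left ?_ hk
      calc (k + 1 : ℝ) * |a (k + 1)| = |(k + 1) * a (k + 1)| := by rw [abs_mul, abs_of_pos hk]
        _ ≤ ∑ j ∈ Finset.range (k + 1), |T j * a (k - j)| := by
          rw [hrec]; exact Finset.abs_sum_le_sum_abs _ _
        _ ≤ ∑ _j ∈ Finset.range (k + 1), r ^ (k + 1) := by
          refine Finset.sum_le_sum fun j hj => ?_
          have hjk : j ≤ k := Nat.lt_succ_iff.1 (Finset.mem_range.1 hj)
          rw [abs_mul, show k + 1 = (j + 1) + (k - j) by omega, pow_add]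
          exact mul_le_mul (hT j) (ih _ (by omega)) (abs_nonneg _) ((abs_nonneg _).trans (hT j))
        _ = _ := by simp

theorem hasDerivAt_tsum_of_newton (ha : ∀ k, |a k| ≤ r ^ k) (hR : r * R < 1) (hz : |z| < R)
    (hT : Summable fun j => ‖T j * z ^ j‖)
    (hrec : ∀ k : ℕ, (k + 1) * a (k + 1) = ∑ j ∈ Finset.range (k + 1), T j * a (k - j)) :
    HasDerivAt (fun z => ∑' k, a k * z ^ k) ((∑' j, T j * z ^ j) * ∑' k, a k * z ^ k) z := by
  convert hasDerivAt_tsum_pow ha hR hz using 1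
  rw [tsum_mul_tsum_eq_tsum_sum_range_of_summable_norm hT (summable_norm_mul_pow ha hR hz.le)]
  refine tsum_congr fun k => ?_
  rw [hrec, Finset.sum_mul]
  refine Finset.sum_congr rfl fun j hj => ?_
  have hjk : j ≤ k := Nat.lt_succ_iff.1 (Finset.mem_range.1 hj)
  rw [mul_mul_mul_comm, ← pow_add, Nat.add_sub_cancel' hjk]

theorem hasDerivAt_tsum_div_pow (hT : ∀ j, |T j| ≤ r ^ (j + 1)) (hR : r * R < 1)
    (hz : |z| < R) :
    HasDerivAt (fun z => ∑' j, T j / (j + 1) * z ^ (j + 1)) (∑' j, T j * z ^ j) z := by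
  -- At `k = 0` the division by zero makes the coefficient vanish, as it should.
  have hcoeff (k : ℕ) : |T (k - 1) / k| ≤ r ^ k := by
    rcases k with _ | k
    · simp
    · rw [Nat.add_sub_cancel, abs_div, Nat.abs_cast]
      exact (div_le_self (abs_nonneg _) (by simp)).trans (hT k)
  have hderiv := hasDerivAt_tsum_pow hcoeff hR hz
  have hev : (fun z : ℝ => ∑' j, T j / (j + 1) * z ^ (j + 1)) =ᶠ[𝓝 z]
      fun z => ∑' k : ℕ, T (k - 1) / k * z ^ k := by
    filter_upwards [(continuous_abs.tendsto z).eventually_lt_const hz] with y hy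
    rw [(summable_norm_mul_pow hcoeff hR hy.le).of_norm.tsum_eq_zero_add]
    simp
  refine (hderiv.congr_of_eventuallyEq hev).congr_deriv (tsum_congr fun k => ?_)
  have hk : (k + 1 : ℝ) ≠ 0 := by positivity
  simp only [Nat.add_sub_cancel, Nat.cast_add, Nat.cast_one, mul_div_cancel₀ _ hk]

/-- Newton's recursion is the differential equation `D' = L' D` for the generating functions. -/
theorem hasSum_exp_of_newton (hr : r < 1) (ha₀ : a 0 = 1) (hT : ∀ j, |T j| ≤ r ^ (j + 1))
    (hrec : ∀ k : ℕ, (k + 1) * a (k + 1) = ∑ j ∈ Finset.range (k + 1), T j * a (k - j)) :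
    HasSum a (Real.exp (∑' j : ℕ, T j / (j + 1))) := by
  have hr0 : 0 ≤ r := by simpa using (abs_nonneg _).trans (hT 0)
  have ha := abs_le_pow_of_newton ha₀ hT hrec
  have hT' (j : ℕ) : |T j| ≤ r ^ j := (hT j).trans (pow_le_pow_of_le_one hr0 hr.le j.le_succ)
  obtain ⟨R, hR1, hR⟩ : ∃ R, 1 < R ∧ r * R < 1 := by
    refine ⟨2 / (1 + r), ?_, ?_⟩
    · rw [lt_div_iff₀ (by linarith)]; linarith
    · rw [← mul_div_assoc, div_lt_one (by linarith)]; linarith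
  set D : ℝ → ℝ := fun z => ∑' k, a k * z ^ k with hD
  set L : ℝ → ℝ := fun z => ∑' j, T j / (j + 1) * z ^ (j + 1) with hL
  have hconst (z : ℝ) (hz : z ∈ Set.Icc (0 : ℝ) 1) :
      HasDerivAt (fun z => Real.exp (-L z) * D z) 0 z := by
    have hzR : |z| < R := by rw [abs_of_nonneg hz.1]; linarith [hz.2]
    have hLz : HasDerivAt L _ z := hasDerivAt_tsum_div_pow hT hR hzR
    have hDz : HasDerivAt D _ z :=
      hasDerivAt_tsum_of_newton ha hR hzR (summable_norm_mul_pow hT' hR hzR.le) hrec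
    refine (hLz.fun_neg.exp.fun_mul hDz).congr_deriv ?_
    ring
  have hval := constant_of_has_deriv_right_zero
    (fun z hz => (hconst z hz).continuousAt.continuousWithinAt)
    (fun z hz => (hconst z ⟨hz.1, hz.2.le⟩).hasDerivWithinAt) 1 (by simp)
  have hL0 : L 0 = 0 := by simp [hL]
  have hD0 : D 0 = 1 := by
    simp only [hD]
    rw [tsum_eq_single 0 fun k hk => by simp [hk]]
    simp [ha₀]
  have hsum : HasSum a (D 1) := by
    simpa [hD] using
      (summable_norm_mul_pow ha hR (z := 1) (by simpa using hR1.le)).of_norm.hasSum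
  have hL1 : L 1 = ∑' j : ℕ, T j / (j + 1) := by simp [hL]
  rw [hL0, hD0, neg_zero, Real.exp_zero, one_mul, Real.exp_neg, inv_mul_eq_one₀ (by positivity),
    hL1] at hval
  rwa [hval]

end Newton

/-! ### Power series composed with an exponential -/

section ExpSeries

variable {E F : Type*} [NormedRing E] [NormedAlgebra ℝ E] [NormedAddCommGroup F] [NormedSpace ℝ F]

/-- The power series of `t ↦ exp (t a) - 1` at the origin. -/
noncomputable def expSubOneSeries (a : E) : FormalMultilinearSeries ℝ ℝ E :=
  (NormedSpace.expSeries ℝ E).compContinuousLinearMap (ContinuousLinearMap.toSpanSingleton ℝ a) -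
    constFormalMultilinearSeries ℝ ℝ (1 : E)

theorem hasFPowerSeriesAt_exp_sub_one [CompleteSpace E] (a : E) :
    HasFPowerSeriesAt (fun t : ℝ => NormedSpace.exp (t • a) - 1) (expSubOneSeries a) 0 := by
  have hexp : HasFPowerSeriesOnBall NormedSpace.exp (NormedSpace.expSeries ℝ E)
      (ContinuousLinearMap.toSpanSingleton ℝ a 0) ⊤ := by
    rw [map_zero]; exact NormedSpace.exp_hasFPowerSeriesOnBall
  exact hexp.compContinuousLinearMap.hasFPowerSeriesAt.sub hasFPowerSeriesAt_const

theorem expSubOneSeries_apply_one (a : E) {n : ℕ} (hn : n ≠ 0) :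
    expSubOneSeries a n (fun _ => 1) = ((n ! : ℝ))⁻¹ • a ^ n := by
  have hsub : expSubOneSeries a n = (NormedSpace.expSeries ℝ E).compContinuousLinearMap
      (ContinuousLinearMap.toSpanSingleton ℝ a) n - constFormalMultilinearSeries ℝ ℝ (1 : E) n :=
    rfl
  rw [hsub, constFormalMultilinearSeries_apply_of_nonzero hn, sub_zero,
    FormalMultilinearSeries.compContinuousLinearMap_apply, ← NormedSpace.expSeries_apply_eq]
  congr 1
  ext i
  simp

/-- Faà di Bruno's formula, with the set partitions collected according to their block sizes. -/
theorem iteratedDeriv_comp_exp_sub_one [CompleteSpace E] [CompleteSpace F] {G : E → F}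
    {p : FormalMultilinearSeries ℝ E F} (hG : HasFPowerSeriesAt G p 0) (a : E) (n : ℕ) :
    iteratedDeriv n (fun t : ℝ => G (NormedSpace.exp (t • a) - 1)) 0 =
      (n ! : ℝ) • ∑ c : Composition n,
        p c.length fun i => ((c.blocksFun i)! : ℝ)⁻¹ • a ^ c.blocksFun i := by
  have hG' : HasFPowerSeriesAt G p ((fun t : ℝ => NormedSpace.exp (t • a) - 1) 0) := by
    simpa using hG
  obtain ⟨r, hr⟩ := HasFPowerSeriesAt.comp (f := fun t : ℝ => NormedSpace.exp (t • a) - 1) hG'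
    (hasFPowerSeriesAt_exp_sub_one a)
  have hcoeff := hr.factorial_smul 1 n
  rw [iteratedDeriv_eq_iteratedFDeriv]
  change iteratedFDeriv ℝ n (G ∘ fun t : ℝ => NormedSpace.exp (t • a) - 1) 0 _ = _
  rw [← hcoeff, ← Nat.cast_smul_eq_nsmul ℝ]
  congr 1
  rw [FormalMultilinearSeries.comp, sum_apply]
  refine Finset.sum_congr rfl fun c _ => ?_
  rw [FormalMultilinearSeries.compAlongComposition_apply]
  congr 1
  ext1 i
  rw [← expSubOneSeries_apply_one a (Nat.one_le_iff_ne_zero.1 (c.one_le_blocksFun i))]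
  rfl

/-- The weighted sum is the `n`-th derivative at the origin of `log (1 + (exp t - 1)) = t`. -/
theorem sum_compWeight {n : ℕ} (hn : 2 ≤ n) : ∑ c : Composition n, compWeight c = 0 := by
  have hfaa := iteratedDeriv_comp_exp_sub_one hasFPowerSeriesAt_log_one_add (1 : ℝ) n
  have hlog : (fun t : ℝ => Real.log (1 + (NormedSpace.exp (t • (1 : ℝ)) - 1))) = id := by
    ext t
    rw [← Real.exp_eq_exp_ℝ]
    simp
  have hderiv : iteratedDeriv n (id : ℝ → ℝ) 0 = 0 := by
    obtain ⟨k, rfl⟩ := Nat.exists_eq_add_of_le' hn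
    rw [iteratedDeriv_succ', iteratedDeriv_succ']
    simp
  rw [hlog, hderiv, smul_eq_mul, Finset.mul_sum] at hfaa
  rw [hfaa]
  refine Finset.sum_congr rfl fun c _ => ?_
  simp only [FormalMultilinearSeries.ofScalars, smul_apply,
    ContinuousMultilinearMap.mkPiAlgebraFin_apply, List.prod_ofFn, one_pow, smul_eq_mul, mul_one,
    Finset.prod_inv_distrib, compWeight, pow_succ, Nat.cast_prod]
  ring

end ExpSeries

/-! ### The logarithm of a Fredholm determinant -/

section LogDet

open scoped BoundedContinuousFunction

variable {E : Type*} [TopologicalSpace E]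

/-- The multilinear map `(g₁, …, g_l) ↦ g₁(x₁) ⋯ g_l(x_l)`. -/
noncomputable def evalProd {l : ℕ} (x : Fin l → E) :
    MultilinearMap ℝ (fun _ : Fin l => E →ᵇ ℝ) ℝ :=
  (MultilinearMap.mkPiAlgebra ℝ (Fin l) ℝ).compLinearMap fun i =>
    (BoundedContinuousFunction.evalCLM ℝ (x i)).toLinearMap

theorem evalProd_apply {l : ℕ} (x : Fin l → E) (g : Fin l → E →ᵇ ℝ) :
    evalProd x g = ∏ i, g i (x i) := by
  simp [evalProd]

theorem abs_evalProd_mul_le (K : E × E →ᵇ ℝ) {l : ℕ} (g : Fin l → E →ᵇ ℝ) (x : Fin l → E) :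
    |evalProd x g * ∏ i, K (x i, x (finRotate l i))| ≤ ‖K‖ ^ l * ∏ i, ‖g i‖ := by
  rw [abs_mul, mul_comm, evalProd_apply, Finset.abs_prod, Finset.abs_prod]
  refine mul_le_mul ?_ ?_ (by positivity) (by positivity)
  · calc ∏ i, |K (x i, x (finRotate l i))| ≤ ∏ _i : Fin l, ‖K‖ :=
          Finset.prod_le_prod (fun _ _ => abs_nonneg _) fun _ _ => K.norm_coe_le_norm _
      _ = ‖K‖ ^ l := by simp
  · exact Finset.prod_le_prod (fun _ _ => abs_nonneg _) fun i _ => (g i).norm_coe_le_norm (x i)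

variable [MeasurableSpace E]

/-- The trace of the product of the integral operators on `L²(μ)` with kernels `g_i(x) K(x, y)`,
`i = 1, …, l`. -/
noncomputable def traceIntegral (μ : Measure E) (K : E × E →ᵇ ℝ) (l : ℕ) (g : Fin l → E →ᵇ ℝ) :
    ℝ :=
  ∫ x : Fin l → E, evalProd x g * ∏ i, K (x i, x (finRotate l i)) ∂Measure.pi fun _ => μ

theorem cyclicIntegral_eq_traceIntegral (μ : Measure E) (K : E × E →ᵇ ℝ) (g : E →ᵇ ℝ) (j : ℕ) :
    cyclicIntegral μ g (fun x y => K (x, y)) j = traceIntegral μ K (j + 1) fun _ => g := by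
  simp only [cyclicIntegral, weightedIntegral, traceIntegral, evalProd_apply]

variable (μ : Measure E) [IsFiniteMeasure μ] (K : E × E →ᵇ ℝ)

theorem abs_traceIntegral_le {l : ℕ} (g : Fin l → E →ᵇ ℝ) :
    |traceIntegral μ K l g| ≤ (‖K‖ * μ.real Set.univ) ^ l * ∏ i, ‖g i‖ := by
  have hmass : (Measure.pi fun _ : Fin l => μ).real Set.univ = μ.real Set.univ ^ l := by
    simp [Measure.real, Measure.pi_univ]
  have hle := norm_integral_le_of_norm_le_const (μ := Measure.pi fun _ : Fin l => μ)
    (Eventually.of_forall fun x => (Real.norm_eq_abs _).trans_le (abs_evalProd_mul_le K g x))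
  rw [hmass] at hle
  exact hle.trans_eq (by ring)

variable [OpensMeasurableSpace E] [SecondCountableTopology E]

theorem integrable_evalProd_mul {l : ℕ} (g : Fin l → E →ᵇ ℝ) :
    Integrable (fun x : Fin l → E => evalProd x g * ∏ i, K (x i, x (finRotate l i)))
      (Measure.pi fun _ => μ) := by
  refine Integrable.of_bound (Continuous.aestronglyMeasurable ?_) (‖K‖ ^ l * ∏ i, ‖g i‖)
    (Eventually.of_forall (abs_evalProd_mul_le K g))
  simp only [evalProd_apply]
  exact (continuous_finsetProd _ fun i _ => (g i).continuous.comp (continuous_apply i)).mul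
    (continuous_finsetProd _ fun i _ =>
      K.continuous.comp ((continuous_apply _).prodMk (continuous_apply _)))

/-- `traceIntegral` as a continuous multilinear map. -/
noncomputable def traceMap (l : ℕ) : ContinuousMultilinearMap ℝ (fun _ : Fin l => E →ᵇ ℝ) ℝ :=
  MultilinearMap.mkContinuous
    { toFun := traceIntegral μ K l
      map_update_add' := fun m i a b => by
        simp only [traceIntegral, MultilinearMap.map_update_add, add_mul]
        exact integral_add (integrable_evalProd_mul μ K _) (integrable_evalProd_mul μ K _)
      map_update_smul' := fun m i t a => by
        simp only [traceIntegral, MultilinearMap.map_update_smul, smul_eq_mul, mul_assoc]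
        exact integral_const_mul _ _ }
    ((‖K‖ * μ.real Set.univ) ^ l) (abs_traceIntegral_le μ K)

/-- The power series at the origin of `g ↦ log det (1 + g K)`, that is,
`∑_{l ≥ 1} (-1) ^ (l + 1) / l * tr (g K) ^ l`. -/
noncomputable def logDetSeries : FormalMultilinearSeries ℝ (E →ᵇ ℝ) ℝ :=
  fun l => ((-1 : ℝ) ^ (l + 1) / l) • traceMap μ K l

theorem logDetSeries_apply (l : ℕ) (g : Fin l → E →ᵇ ℝ) :
    logDetSeries μ K l g = (-1 : ℝ) ^ (l + 1) / l * traceIntegral μ K l g := rfl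

theorem norm_logDetSeries_le (l : ℕ) : ‖logDetSeries μ K l‖ ≤ (‖K‖ * μ.real Set.univ) ^ l := by
  have hcoeff : ‖(-1 : ℝ) ^ (l + 1) / l‖ ≤ 1 := by
    rw [norm_div, norm_pow, norm_neg, norm_one, one_pow, Real.norm_natCast]
    rcases l with _ | l
    · simp
    · exact div_le_self zero_le_one (by simp)
  refine ContinuousMultilinearMap.opNorm_le_bound (by positivity) fun g => ?_
  rw [logDetSeries_apply, norm_mul]
  exact (mul_le_of_le_one_left (norm_nonneg _) hcoeff).trans (abs_traceIntegral_le μ K g)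

theorem radius_logDetSeries_pos : 0 < (logDetSeries μ K).radius := by
  have hr : 0 < (‖K‖ * μ.real Set.univ + 1)⁻¹ := by positivity
  refine (ENNReal.coe_pos.2 (show 0 < (⟨_, hr.le⟩ : NNReal) from hr)).trans_le
    (FormalMultilinearSeries.le_radius_of_bound _ 1 fun l => ?_)
  calc ‖logDetSeries μ K l‖ * (‖K‖ * μ.real Set.univ + 1)⁻¹ ^ l
      ≤ (‖K‖ * μ.real Set.univ) ^ l * (‖K‖ * μ.real Set.univ + 1)⁻¹ ^ l := by
        gcongr
        exact norm_logDetSeries_le μ K l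
    _ = (‖K‖ * μ.real Set.univ / (‖K‖ * μ.real Set.univ + 1)) ^ l := by
        rw [← mul_pow, div_eq_mul_inv]
    _ ≤ 1 := pow_le_one₀ (by positivity) (div_le_one_of_le₀ (by simp) (by positivity))

theorem sum_logDetSeries {g : E →ᵇ ℝ} (hg : ‖K‖ * μ.real Set.univ * ‖g‖ < 1) :
    (logDetSeries μ K).sum g =
      ∑' j : ℕ, (-1) ^ j * cyclicIntegral μ g (fun x y => K (x, y)) j / (j + 1) := by
  have hsum : Summable fun l => logDetSeries μ K l fun _ => g := by
    refine Summable.of_norm_bounded (summable_geometric_of_lt_one (by positivity) hg) fun l => ?_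
    refine ((logDetSeries μ K l).le_opNorm _).trans ?_
    rw [Finset.prod_const, Finset.card_univ, Fintype.card_fin, mul_pow _ ‖g‖]
    gcongr
    exact norm_logDetSeries_le μ K l
  rw [FormalMultilinearSeries.sum, hsum.tsum_eq_zero_add]
  simp only [logDetSeries_apply, Nat.cast_zero, div_zero, zero_mul, zero_add,
    cyclicIntegral_eq_traceIntegral]
  refine tsum_congr fun j => ?_
  rw [pow_succ, pow_succ]
  push_cast
  ring

theorem hasSum_fredholmCoeff [BorelSpace E] [T2Space E] {g : E →ᵇ ℝ} (hgc : HasCompactSupport g)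
    (hg : ‖K‖ * μ.real Set.univ * ‖g‖ < 1) :
    HasSum (fredholmCoeff μ g fun x y => K (x, y)) (Real.exp ((logDetSeries μ K).sum g)) := by
  rw [sum_logDetSeries μ K hg]
  refine hasSum_exp_of_newton hg (fredholmCoeff_zero _) (fun j => ?_)
    (fredholmCoeff_succ g.continuous hgc K.continuous)
  rw [abs_mul, abs_pow, abs_neg, abs_one, one_pow, one_mul, cyclicIntegral_eq_traceIntegral]
  refine (abs_traceIntegral_le μ K _).trans_eq ?_
  rw [Finset.prod_const, Finset.card_univ, Fintype.card_fin, ← mul_pow]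

end LogDet

/-! ### Cumulants of a linear statistic -/

section LinearStatistic

open scoped BoundedContinuousFunction

theorem integral_pi_restrict_of_forall_eq_zero {ι E G : Type*} [Fintype ι] [MeasurableSpace E]
    [NormedAddCommGroup G] [NormedSpace ℝ G] {μ : Measure E} [SigmaFinite μ] {S : Set E}
    {F : (ι → E) → G} (hF : ∀ x i, x i ∉ S → F x = 0) :
    ∫ x, F x ∂Measure.pi (fun _ => μ.restrict S) = ∫ x, F x ∂Measure.pi fun _ => μ := by
  rw [← Measure.restrict_pi_pi]
  refine setIntegral_eq_integral_of_forall_compl_eq_zero fun x hx => ?_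
  obtain ⟨i, hi⟩ : ∃ i, x i ∉ S := by simpa [Set.mem_pi] using hx
  exact hF x i hi

theorem fredholmCoeff_restrict {E : Type*} [MeasurableSpace E] {μ : Measure E} [SigmaFinite μ]
    {S : Set E} {g : E → ℝ} (hg : ∀ x ∉ S, g x = 0) (K : E → E → ℝ) :
    fredholmCoeff (μ.restrict S) g K = fredholmCoeff μ g K := by
  ext k
  rw [fredholmCoeff, weightedIntegral, integral_pi_restrict_of_forall_eq_zero fun z i hz => by
    rw [Finset.prod_eq_zero (Finset.mem_univ i) (hg _ hz), zero_mul]]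
  rfl

theorem traceIntegral_pow_eq_compTrace (K : ℝ × ℝ →ᵇ ℝ) (f : ℝ →ᵇ ℝ) {n : ℕ} (c : Composition n) :
    traceIntegral (volume.restrict (tsupport f)) K c.length
        (fun i => ((c.blocksFun i)! : ℝ)⁻¹ • f ^ c.blocksFun i) =
      (∏ i, ((c.blocksFun i)! : ℝ))⁻¹ * compTrace (fun x y => K (x, y)) f c := by
  have heval (x : Fin c.length → ℝ) :
      evalProd x (fun i => ((c.blocksFun i)! : ℝ)⁻¹ • f ^ c.blocksFun i) =
        (∏ i, ((c.blocksFun i)! : ℝ))⁻¹ * ∏ i, f (x i) ^ c.blocksFun i := by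
    rw [evalProd_apply, ← Finset.prod_inv_distrib, ← Finset.prod_mul_distrib]
    rfl
  simp only [traceIntegral, heval, mul_assoc, integral_const_mul, ← Finset.prod_mul_distrib]
  rw [integral_pi_restrict_of_forall_eq_zero fun x i hx => ?_]
  · rfl
  · refine Finset.prod_eq_zero (Finset.mem_univ i) ?_
    rw [image_eq_zero_of_notMem_tsupport hx,
      zero_pow (Nat.one_le_iff_ne_zero.1 (c.one_le_blocksFun i)), zero_mul]

theorem logDetSeries_pow (K : ℝ × ℝ →ᵇ ℝ) (f : ℝ →ᵇ ℝ)
    [IsFiniteMeasure (volume.restrict (tsupport f))] {n : ℕ} (c : Composition n) :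
    (n ! : ℝ) * logDetSeries (volume.restrict (tsupport f)) K c.length
        (fun i => ((c.blocksFun i)! : ℝ)⁻¹ • f ^ c.blocksFun i) =
      compWeight c * compTrace (fun x y => K (x, y)) f c := by
  rw [logDetSeries_apply, traceIntegral_pow_eq_compTrace, compWeight]
  push_cast
  ring

theorem exp_smul_sub_one_apply {E : Type*} [TopologicalSpace E] (a : E →ᵇ ℝ) (t : ℝ) (x : E) :
    (NormedSpace.exp (t • a) - 1) x = Real.exp (t * a x) - 1 := by
  have hseries := (NormedSpace.exp_series_hasSum_exp' (𝕂 := ℝ) (t • a)).mapL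
    (BoundedContinuousFunction.evalCLM ℝ x)
  have hexp := NormedSpace.exp_series_hasSum_exp' (𝕂 := ℝ) (t * a x)
  rw [← Real.exp_eq_exp_ℝ] at hexp
  have heval : (NormedSpace.exp (t • a)) x = Real.exp (t * a x) := by
    refine hseries.unique ?_
    convert hexp using 2 with n
    simp
  rw [BoundedContinuousFunction.sub_apply, heval, BoundedContinuousFunction.coe_one, Pi.one_apply]

theorem finprod_mem_one_add_exp_sub_one {E : Type*} {s : Set E} {f : E → ℝ}
    (hs : (s ∩ Function.support f).Finite) (t : ℝ) :
    ∏ᶠ x ∈ s, (1 + ((Real.exp (t * f x) - 1 : ℝ) : ℂ)) =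
      (Real.exp (t * ∑ᶠ x ∈ s, f x) : ℝ) := by
  have hfactor (x : E) : 1 + ((Real.exp (t * f x) - 1 : ℝ) : ℂ) = (Real.exp (t * f x) : ℝ) := by
    push_cast; ring
  have hsupport : s ∩ Function.mulSupport (fun x => ((Real.exp (t * f x) : ℝ) : ℂ)) ⊆
      hs.toFinset := by
    rw [hs.coe_toFinset]
    refine Set.inter_subset_inter_right s fun x hx hfx => hx ?_
    simp [hfx]
  have hsubset : (hs.toFinset : Set E) ⊆ s := by simp
  simp only [hfactor]
  rw [finprod_mem_eq_prod_of_subset _ hsupport hsubset, finsum_mem_eq_sum _ hs, Finset.mul_sum,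
    Real.exp_sum, Complex.ofReal_prod]

theorem hasCompactSupport_exp_mul_sub_one {E : Type*} [TopologicalSpace E] {f : E → ℝ}
    (hfc : HasCompactSupport f) (t : ℝ) : HasCompactSupport fun x => Real.exp (t * f x) - 1 :=
  hfc.comp_left (g := fun y => Real.exp (t * y) - 1) (by simp)

variable {Ω : Type*} [MeasurableSpace Ω] {P : Measure Ω} {X : Ω → Set ℝ} {K : ℝ → ℝ → ℝ}
  {f : ℝ → ℝ}

theorem IsDeterminantalProcess.finprod_eq_exp (hX : IsDeterminantalProcess P X K)
    (hfc : HasCompactSupport f) (t : ℝ) (ω : Ω) :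
    ∏ᶠ x ∈ X ω, (1 + ((Real.exp (t * f x) - 1 : ℝ) : ℂ)) =
      (Real.exp (t * linearStatistic X f ω) : ℝ) :=
  finprod_mem_one_add_exp_sub_one ((hX.locallyFinite ω _ hfc).subset
    (Set.inter_subset_inter_right _ (subset_tsupport f))) t

theorem IsDeterminantalProcess.integrable_exp (hX : IsDeterminantalProcess P X K)
    (hf : Continuous f) (hfc : HasCompactSupport f) (t : ℝ) :
    Integrable (fun ω => Real.exp (t * linearStatistic X f ω)) P := by
  have hinteg := hX.integrable (fun x => ((Real.exp (t * f x) - 1 : ℝ) : ℂ)) (by fun_prop)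
    ((hasCompactSupport_exp_mul_sub_one hfc t).comp_left Complex.ofReal_zero)
  simp only [hX.finprod_eq_exp hfc] at hinteg
  exact hinteg.re

theorem IsDeterminantalProcess.hasSum_mgf (hX : IsDeterminantalProcess P X K)
    (hf : Continuous f) (hfc : HasCompactSupport f) (t : ℝ) :
    HasSum (fredholmCoeff volume (fun x => Real.exp (t * f x) - 1) K)
      (mgf (linearStatistic X f) P t) := by
  have hsum := hX.hasSum (fun x => ((Real.exp (t * f x) - 1 : ℝ) : ℂ)) (by fun_prop)
    ((hasCompactSupport_exp_mul_sub_one hfc t).comp_left Complex.ofReal_zero)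
  simp only [hX.finprod_eq_exp hfc, ← Complex.ofReal_prod, ← Complex.ofReal_mul,
    integral_complex_ofReal] at hsum
  rw [← Complex.hasSum_ofReal, mgf]
  convert hsum using 2 with k
  rw [fredholmCoeff, weightedIntegral, Complex.ofReal_div, Complex.ofReal_natCast,
    one_div_mul_eq_div]
  rfl

/-- By Macchi's formula the moment generating function is the Fredholm determinant
`det (1 + (exp (t f) - 1) K)`; near `t = 0` the logarithm of the latter is a power series. -/
theorem IsDeterminantalProcess.eventually_cgf_eq {K : ℝ × ℝ →ᵇ ℝ} {f : ℝ →ᵇ ℝ}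
    [IsFiniteMeasure (volume.restrict (tsupport f))]
    (hX : IsDeterminantalProcess P X fun x y => K (x, y)) (hfc : HasCompactSupport f) :
    cgf (linearStatistic X f) P =ᶠ[𝓝 0] fun t : ℝ =>
      (logDetSeries (volume.restrict (tsupport f)) K).sum (NormedSpace.exp (t • f) - 1) := by
  have hcont : Continuous fun t : ℝ =>
      ‖K‖ * (volume.restrict (tsupport f)).real Set.univ * ‖NormedSpace.exp (t • f) - 1‖ :=
    (((NormedSpace.exp_continuous (𝔸 := ℝ →ᵇ ℝ)).comp
      (continuous_id.smul continuous_const)).sub continuous_const).norm.const_mul _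
  have hsmall := (hcont.tendsto 0).eventually_lt_const (u := 1) (by simp)
  filter_upwards [hsmall] with t ht
  have hexp : ((NormedSpace.exp (t • f) - 1 : ℝ →ᵇ ℝ) : ℝ → ℝ) = fun x => Real.exp (t * f x) - 1 :=
    funext (exp_smul_sub_one_apply f t)
  have hsum := hasSum_fredholmCoeff (volume.restrict (tsupport f)) K
    (g := NormedSpace.exp (t • f) - 1) (hexp ▸ hasCompactSupport_exp_mul_sub_one hfc t) ht
  rw [hexp, fredholmCoeff_restrict fun x hx => by
    simp [image_eq_zero_of_notMem_tsupport hx]] at hsum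
  rw [cgf, (hX.hasSum_mgf f.continuous hfc t).unique hsum, Real.log_exp]

theorem IsDeterminantalProcess.cumulant_eq (hX : IsDeterminantalProcess P X K)
    (hK : Continuous fun p : ℝ × ℝ => K p.1 p.2) {M : ℝ} (hM : ∀ x y, |K x y| ≤ M)
    (hf : Continuous f) (hfc : HasCompactSupport f) (n : ℕ) :
    cumulant P (linearStatistic X f) n = kernelCumulant K f n := by
  obtain ⟨C, hC⟩ := hfc.exists_bound_of_continuous hf
  let f' : ℝ →ᵇ ℝ := .ofNormedAddCommGroup f hf C hC
  let K' : ℝ × ℝ →ᵇ ℝ := .ofNormedAddCommGroup (fun p => K p.1 p.2) hK M fun p => hM p.1 p.2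
  have : IsFiniteMeasure (volume.restrict (tsupport f')) :=
    isFiniteMeasure_restrict.2 (IsCompact.measure_lt_top hfc).ne
  have hseries := ((logDetSeries (volume.restrict (tsupport f')) K').hasFPowerSeriesOnBall
    (radius_logDetSeries_pos _ K')).hasFPowerSeriesAt
  have hcgf := IsDeterminantalProcess.eventually_cgf_eq (K := K') (f := f') hX hfc
  calc cumulant P (linearStatistic X f) n
      = n ! * ∑ c : Composition n, logDetSeries (volume.restrict (tsupport f')) K' c.length
          (fun i => ((c.blocksFun i)! : ℝ)⁻¹ • f' ^ c.blocksFun i) :=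
        hcgf.iteratedDeriv_eq n |>.trans (iteratedDeriv_comp_exp_sub_one hseries f' n)
    _ = kernelCumulant K f n := by
        rw [Finset.mul_sum]
        exact Finset.sum_congr rfl fun c _ => logDetSeries_pow K' f' c

end LinearStatistic

/-! ### The limit theorem -/

section KernelL

variable (Ψ : ℝ → ℝ) (α τ Γ : ℝ) (η ξ : ℤ → ℝ) (N : ℝ)

theorem continuous_sineKernel (a : ℝ) : Continuous (sineKernel a) :=
  continuous_const.mul (Real.continuous_sinc.comp (continuous_const_mul _))

theorem continuous_kernelL : Continuous fun p : ℝ × ℝ => kernelL Ψ α τ Γ η ξ N p.1 p.2 :=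
  continuous_const.mul (continuous_finsetSum _ fun k _ => continuous_const.mul
    ((continuous_sineKernel (η k)).comp (continuous_fst.sub continuous_snd)))

theorem abs_sineKernel_le (a t : ℝ) : |sineKernel a t| ≤ |2 * a| := by
  rw [sineKernel, abs_mul]
  exact mul_le_of_le_one_right (abs_nonneg _) (Real.abs_sinc_le_one _)

theorem abs_kernelL_le (x y : ℝ) :
    |kernelL Ψ α τ Γ η ξ N x y| ≤ |1 / (τ * N ^ α)| *
      ∑ k ∈ Finset.Icc (-⌊Γ * N ^ α⌋) ⌊Γ * N ^ α⌋,
        |shapeDensity Ψ ((k + ξ k) / (τ * N ^ α))| * |2 * η k| := by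
  rw [kernelL, abs_mul]
  refine mul_le_mul_of_nonneg_left ((Finset.abs_sum_le_sum_abs _ _).trans
    (Finset.sum_le_sum fun k _ => ?_)) (abs_nonneg _)
  rw [abs_mul]
  exact mul_le_mul_of_nonneg_left (abs_sineKernel_le _ _) (abs_nonneg _)

end KernelL

theorem CutoffConditions.tendsto_limitCumulant {Ψ : ℝ → ℝ} {α τ ν β ε : ℝ} {Γ : ℝ → ℝ}
    {η ξ : ℝ → ℤ → ℝ} {f : ℝ → ℝ} (hη : CutoffConditions Ψ α τ ν β ε Γ η)
    (hΨ : IsSurvivalFunction Ψ) (hα : 0 < α) (hτ : 0 < τ) (hν : 0 < ν) (hε : 0 < ε)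
    (hξ : ∀ N, 0 < N → IsMeanValueChoice Ψ α τ N (ξ N)) (hf : IsH1Compact f) {n : ℕ}
    (hn : 2 ≤ n) :
    Tendsto (fun N => kernelCumulant (kernelL Ψ α τ (Γ N) (η N) (ξ N) N) f n) atTop
      (𝓝 (limitCumulant (Nat.zero_lt_of_lt hn) Ψ f (β * τ))) := by
  obtain ⟨m, rfl⟩ := Nat.exists_eq_add_one_of_ne_zero (Nat.ne_zero_of_lt hn)
  have hlim := (Complex.continuous_re.tendsto _).comp
    (hη.tendsto_kernelCumulant hΨ hα hτ hν hε hξ hf (sum_compWeight hn))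
  rwa [hΨ.re_sum_integral_centeredOverlap hf] at hlim

theorem mainTheorem7_general {Ψ : ℝ → ℝ} (hΨ : IsSurvivalFunction Ψ)
    {α τ ν β ε : ℝ} (hα : 0 < α) (hτ : 0 < τ) (hν : 0 < ν) (hε : 0 < ε)
    {Γ : ℝ → ℝ} {η ξ : ℝ → ℤ → ℝ} (hη : CutoffConditions Ψ α τ ν β ε Γ η)
    (hξ : ∀ N, 0 < N → IsMeanValueChoice Ψ α τ N (ξ N))
    {f : ℝ → ℝ} (hf : IsH1Compact f) {n : ℕ} (hn : 2 ≤ n) :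
    (∀ k < n, Integrable fun x : ℝ =>
      x * shapeDensity Ψ x * Ψ x ^ k * (1 - Ψ x) ^ (n - 1 - k)) ∧
    IntegrableOn (limitIntegrand (Nat.zero_lt_of_lt hn) Ψ f (β * τ)) (limitDomain n) ∧
    Tendsto (fun N => kernelCumulant (kernelL Ψ α τ (Γ N) (η N) (ξ N) N) f n) atTop
      (𝓝 (limitCumulant (Nat.zero_lt_of_lt hn) Ψ f (β * τ))) ∧
    ∀ (Ω : ℝ → Type*) [∀ N, MeasurableSpace (Ω N)] (P : ∀ N, Measure (Ω N))
      (X : ∀ N, Ω N → Set ℝ),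
      (∀ᶠ N in atTop, IsDeterminantalProcess (P N) (X N)
        (kernelL Ψ α τ (Γ N) (η N) (ξ N) N)) →
      (∀ᶠ N in atTop, ∀ t : ℝ,
        Integrable (fun ω => Real.exp (t * linearStatistic (X N) f ω)) (P N)) ∧
      Tendsto (fun N => cumulant (P N) (linearStatistic (X N) f) n) atTop
        (𝓝 (limitCumulant (Nat.zero_lt_of_lt hn) Ψ f (β * τ))) := by
  have hlim := hη.tendsto_limitCumulant hΨ hα hτ hν hε hξ hf hn
  refine ⟨fun k _ => hΨ.integrable_moment k _, ?_, hlim, fun Ω _ P X hX => ⟨?_, ?_⟩⟩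
  · obtain ⟨m, rfl⟩ := Nat.exists_eq_add_one_of_ne_zero (Nat.ne_zero_of_lt hn)
    exact (hΨ.integrable_limitIntegrand hf (β * τ)).integrableOn
  · exact hX.mono fun N hN t => hN.integrable_exp hf.continuous hf.compact t
  · refine hlim.congr' (hX.mono fun N hN => Eq.symm ?_)
    exact hN.cumulant_eq (continuous_kernelL ..) (abs_kernelL_le Ψ α τ (Γ N) (η N) (ξ N) N)
      hf.continuous hf.compact n

theorem mainTheorem7
    (Ψ : ℝ → ℝ) (hΨ : IsShape Ψ)
    (α τ ν β ε : ℝ) (hα : α ∈ Set.Ioo (0 : ℝ) 1) (hτ : 0 < τ) (hν : 0 < ν) (hβ : 0 < β)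
    (hε : 0 < ε)
    (Γ : ℝ → ℝ) (η : ℝ → ℤ → ℝ) (hη : GrowthConditions Ψ α τ ν β ε Γ η)
    (ξ : ℝ → ℤ → ℝ) (hξ : ∀ N, 0 < N → IsMeanValueChoice Ψ α τ N (ξ N))
    (f : ℝ → ℝ) (hf : IsH1Compact f)
    (n : ℕ) (hn : 2 ≤ n) :
    -- the integrals in the limit converge absolutely
    (∀ k < n, Integrable fun x : ℝ =>
      x * shapeDensity Ψ x * Ψ x ^ k * (1 - Ψ x) ^ (n - 1 - k)) ∧
    IntegrableOn (limitIntegrand (Nat.zero_lt_of_lt hn) Ψ f (β * τ)) (limitDomain n) ∧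
    -- convergence of the cumulants as expressed through the kernel
    Tendsto (fun N => kernelCumulant (kernelL Ψ α τ (Γ N) (η N) (ξ N) N) f n) atTop
      (𝓝 (limitCumulant (Nat.zero_lt_of_lt hn) Ψ f (β * τ))) ∧
    -- convergence of the cumulants of the linear statistic of the point processes themselves
    ∀ (Ω : ℝ → Type*) [∀ N, MeasurableSpace (Ω N)] (P : ∀ N, Measure (Ω N))
      [∀ N, IsProbabilityMeasure (P N)] (X : ∀ N, Ω N → Set ℝ),
      (∀ᶠ N in atTop, IsDeterminantalProcess (P N) (X N)
        (kernelL Ψ α τ (Γ N) (η N) (ξ N) N)) →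
      (∀ᶠ N in atTop, ∀ t : ℝ,
        Integrable (fun ω => Real.exp (t * linearStatistic (X N) f ω)) (P N)) ∧
      Tendsto (fun N => cumulant (P N) (linearStatistic (X N) f) n) atTop
        (𝓝 (limitCumulant (Nat.zero_lt_of_lt hn) Ψ f (β * τ))) := by
  obtain ⟨hmoment, hinteg, hlim, hprocess⟩ :=
    mainTheorem7_general hΨ.isSurvivalFunction hα.1 hτ hν hε hη.cutoffConditions hξ hf hn
  exact ⟨hmoment, hinteg, hlim, fun Ω _ P _ X hX => hprocess Ω P X hX⟩
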